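/- **Setting.** Let $\mathcal T$ be a finite rooted tree in which every node has at most $D$ children; its leaves are the arms, and $X$ denotes the set of leaves. In each round $t=1,2,\dots$ a payoff function $\pi_t:X\to[0,1]$ is drawn independently from a fixed distribution that is unknown to the algorithm; the algorithm, which knows $\mathcal T$, plays an arm $x_t$ and observes only $\pi_t(x_t)$. Let $\mu(x)=\mathbb E[\pi_t(x)]$ and $\mu^*=\max_{x\in X}\mu(x)$. The regret is $R(T)=\mathbb E\big[\sum_{t=1}^T(\mu^*-\mu(x_t))\big]$. For a node $v$ let $\mathcal T(v)$ be the subtree rooted at $v$ and $X(v)$ its set of leaves. For $u\in\mathcal T(v)$ let $\mathbb P(v,u)$ be the probability that the random walk which starts at $v$ and moves at each step to a uniformly random child reaches $u$; a *random sample* from $\mathcal T(v)$ is the leaf at which this walk ends. Put $\mu(v)=\sum_{x\in X(v)}\mu(x)\,\mathbb P(v,x)$ and $\mathrm{wgt}(v)=\max_{x,y\in X(v)}|\mu(x)-\mu(y)|$. * The *quality* of the taxonomy is the largest $q$ such that for every node $v$ for which $X(v)$ contains an arm $x$ with $\mu(x)=\mu^*$ there are nodes $u,u'\in\mathcal T(v)$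 with $|\mu(u)-\mu(u')|\ge \mathrm{wgt}(v)/2$ and $\min(\mathbb P(v,u),\mathbb P(v,u'))\ge q$. * The *zooming dimension* with constant $c>0$ is the smallest $d$ such that for every $\delta\in(0,1]$ the set $\{x\in X:\mu^*-\mu(x)\le\delta\}$ can be covered by at most $c\,\delta^{-d}$ subtrees of weight at most $\delta/8$. **Algorithm TaxonomyBandit** with time horizon $T$ and quality parameter $\hat q$. In each round the algorithm selects a node $v$ and plays a random sample $x$ from $\mathcal T(v)$; the nodes of $\mathcal T(v)$ that are ancestors of $x$ (including $v$ and $x$) are *hit* in this round. Let $n_t(v)$ be the number of rounds before $t$ in which $v$ was hit, $\mu_t(v)$ the average payoff over these rounds ($0$ if there are none), $k=4\sqrt{2/\hat q}$, and $$\mathrm{rad}_t(v)=\sqrt{\frac{8\log T}{2+n_t(v)}},\qquad I_t(v)=\mu_t(v)+(1+4k)\,\mathrm{rad}_t(v),$$ $$\mathrm{wgt}_t(v)=\max_{u_1,u_2\in\mathcal T(v)}\max\big(0,\ |\mu_t(u_1)-\mu_t(u_2)|-\mathrm{rad}_t(u_1)-\mathrm{rad}_t(u_2)\big).$$ Initially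 only the root is active. In each round $t$: (S1) as long as there is an active internal node $v$ with $\mathrm{wgt}_t(v)\ge k\,\mathrm{rad}_t(v)$, deactivate it and activate all its children; (S2) select an active node with the maximal index $I_t$, breaking ties arbitrarily; (S3) play a random sample from the subtree of the selected node. **Theorem.** For every $D$ there is a constant $C$ that depends only on $D$ such that the following holds. Consider an instance as above whose taxonomy has quality $q$, let $c>0$, let $d$ be the zooming dimension with constant $c$, and let $T\ge 2^{1/q}$. Then TaxonomyBandit with time horizon $T$ and any quality parameter $\hat q\in[1/\log_2 T,\ q]$ (in particular $\hat q=1/\log_2 T$, which requires no knowledge of $q$) has regret $$R(T)\le\Big(C\,\frac cq\Big)^{1/(2+d)}\,T^{\,1-1/(2+d)}\,\log T.$$ -/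

import Mathlib

universe u w

open MeasureTheory ProbabilityTheory

noncomputable section

/-!
A taxonomy is a finite rooted tree, represented by Mathlib's `RootedTree`: the order is ancestorship
(`v ≤ u` means that `u` lies in the subtree rooted at `v`), `⊥` is the root, and `v ⋖ u` means that
`u` is a child of `v`. The arms are the leaves, i.e. the maximal elements.
-/
namespace Taxonomy

/-- The arms: the leaves of the tree. -/
abbrev Arm (𝒯 : RootedTree.{u}) : Type u := {x : 𝒯 // IsMax x}

/-- The children of a node. -/
def children {𝒯 : RootedTree.{u}} (v : 𝒯) : Set 𝒯 := {u | v ⋖ u}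

open Classical in
/-- The probability that the random walk which starts at `v` and moves at each step to a uniformly
random child of the current node reaches `u`. The nodes that the walk has to leave on its way to `u`
are those `w` with `v ≤ w < u`. -/
def reachProb {𝒯 : RootedTree.{u}} [Fintype 𝒯] (v u : 𝒯) : ℝ :=
  if v ≤ u then ∏ w ∈ Finset.univ.filter (fun w : 𝒯 => v ≤ w ∧ w < u), ((children w).ncard : ℝ)⁻¹
  else 0

/-- Expected payoffs of the arms, when the payoff function of a round is drawn from `Pay`. -/
def meanPayoff {𝒯 : RootedTree.{u}} (Pay : Measure (Arm 𝒯 → ℝ)) (x : Arm 𝒯) : ℝ :=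
  ∫ f, f x ∂Pay

/-- The largest expected payoff `μ*` of an arm. -/
def bestMean {𝒯 : RootedTree.{u}} (μ : Arm 𝒯 → ℝ) : ℝ := ⨆ x, μ x

open Classical in
/-- The expected payoff `μ(v)` of a random sample from the subtree rooted at `v`. -/
def nodeMean {𝒯 : RootedTree.{u}} [Fintype 𝒯] (μ : Arm 𝒯 → ℝ) (v : 𝒯) : ℝ :=
  ∑ x ∈ Finset.univ.filter (fun x : Arm 𝒯 => v ≤ x.1), μ x * reachProb v x.1

/-- The weight of `v`: the maximal variation of expected payoffs in the subtree rooted at `v`. -/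
def weight {𝒯 : RootedTree.{u}} (μ : Arm 𝒯 → ℝ) (v : 𝒯) : ℝ :=
  sSup {r | ∃ x y : Arm 𝒯, v ≤ x.1 ∧ v ≤ y.1 ∧ r = |μ x - μ y|}

/-- The condition on `q` in the definition of quality. -/
def QualityAtLeast {𝒯 : RootedTree.{u}} [Fintype 𝒯] (μ : Arm 𝒯 → ℝ) (q : ℝ) : Prop :=
  ∀ v : 𝒯, (∃ x : Arm 𝒯, v ≤ x.1 ∧ μ x = bestMean μ) →
    ∃ u u' : 𝒯, v ≤ u ∧ v ≤ u' ∧ weight μ v / 2 ≤ |nodeMean μ u - nodeMean μ u'| ∧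
      q ≤ min (reachProb v u) (reachProb v u')

/-- `q` is the quality of the taxonomy: the largest number satisfying the quality condition. -/
def IsQuality {𝒯 : RootedTree.{u}} [Fintype 𝒯] (μ : Arm 𝒯 → ℝ) (q : ℝ) : Prop :=
  IsGreatest {q | QualityAtLeast μ q} q

/-- For each `δ ∈ (0, 1]`, the set of arms `x` with `μ* - μ(x) ≤ δ` can be covered with at most
`c δ^{-d}` subtrees of weight at most `δ / 8`. -/
def ZoomingCover {𝒯 : RootedTree.{u}} (μ : Arm 𝒯 → ℝ) (c d : ℝ) : Prop :=
  ∀ δ : ℝ, 0 < δ → δ ≤ 1 →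
    ∃ S : Finset 𝒯, (S.card : ℝ) ≤ c * δ ^ (-d) ∧ (∀ v ∈ S, weight μ v ≤ δ / 8) ∧
      ∀ x : Arm 𝒯, bestMean μ - μ x ≤ δ → ∃ v ∈ S, v ≤ x.1

/-- `d` is the zooming dimension with constant `c`. -/
def IsZoomingDim {𝒯 : RootedTree.{u}} (μ : Arm 𝒯 → ℝ) (c d : ℝ) : Prop :=
  IsLeast {d | ZoomingCover μ c d} d

/-- The rounds before round `t` (rounds are numbered from `0`) in which the subtree rooted at `v`
was hit, when `sel s` is the node selected, and `arm s` the arm played, in round `s`. -/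
def hitRounds {𝒯 : RootedTree.{u}} (sel : ℕ → 𝒯) (arm : ℕ → Arm 𝒯) (t : ℕ) (v : 𝒯) : Finset ℕ :=
  open Classical in (Finset.range t).filter (fun s => sel s ≤ v ∧ v ≤ (arm s).1)

/-- The average payoff over the hits of `v` before round `t` (zero if there are none). -/
def avgPayoff {𝒯 : RootedTree.{u}} (sel : ℕ → 𝒯) (arm : ℕ → Arm 𝒯) (pay : ℕ → ℝ)
    (t : ℕ) (v : 𝒯) : ℝ :=
  (∑ s ∈ hitRounds sel arm t v, pay s) / ((hitRounds sel arm t v).card : ℝ)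

/-- The confidence radius, for the time horizon `T`. -/
def confRad {𝒯 : RootedTree.{u}} (T : ℕ) (sel : ℕ → 𝒯) (arm : ℕ → Arm 𝒯) (t : ℕ) (v : 𝒯) : ℝ :=
  Real.sqrt (8 * Real.log T / (2 + ((hitRounds sel arm t v).card : ℝ)))

/-- The factor `k` of the algorithm, for the quality parameter `qhat`. -/
def kFactor (qhat : ℝ) : ℝ := 4 * Real.sqrt (2 / qhat)

/-- The index of a node. -/
def nodeIndex {𝒯 : RootedTree.{u}} (T : ℕ) (qhat : ℝ) (sel : ℕ → 𝒯) (arm : ℕ → Arm 𝒯)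
    (pay : ℕ → ℝ) (t : ℕ) (v : 𝒯) : ℝ :=
  avgPayoff sel arm pay t v + (1 + 4 * kFactor qhat) * confRad T sel arm t v

/-- The weight estimate of a node. -/
def weightEst {𝒯 : RootedTree.{u}} (T : ℕ) (sel : ℕ → 𝒯) (arm : ℕ → Arm 𝒯) (pay : ℕ → ℝ)
    (t : ℕ) (v : 𝒯) : ℝ :=
  ⨆ p : Set.Ici v × Set.Ici v,
    max 0 (|avgPayoff sel arm pay t p.1.1 - avgPayoff sel arm pay t p.2.1|
      - confRad T sel arm t p.1.1 - confRad T sel arm t p.2.1)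

/-- The internal node `v` violates the invariant that active internal nodes have to satisfy. -/
def Violates {𝒯 : RootedTree.{u}} (T : ℕ) (qhat : ℝ) (sel : ℕ → 𝒯) (arm : ℕ → Arm 𝒯)
    (pay : ℕ → ℝ) (t : ℕ) (v : 𝒯) : Prop :=
  ¬ IsMax v ∧ ¬ (weightEst T sel arm pay t v < kFactor qhat * confRad T sel arm t v)

/-- One deactivation: an active node in `bad` becomes inactive and all its children active. -/
def DeactStep {𝒯 : RootedTree.{u}} (bad : 𝒯 → Prop) (A A' : Set 𝒯) : Prop :=
  ∃ v ∈ A, bad v ∧ A' = (A \ {v}) ∪ children v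

/-- An execution of the algorithm with time horizon `T` and quality parameter `qhat`, on the
taxonomy `𝒯`, when the payoff functions of the rounds are independent with law `Pay`. `ℱ t` is the
information before round `t`; it may contain more than the history, so that ties may be broken in an
arbitrary, possibly randomized, way. -/
structure Execution (𝒯 : RootedTree.{u}) [Fintype 𝒯] (Pay : Measure (Arm 𝒯 → ℝ)) (T : ℕ) (qhat : ℝ)
    {Ω : Type w} [mΩ : MeasurableSpace Ω] (P : Measure Ω) where
  /-- the information available before each round -/
  ℱ : Filtration ℕ mΩ
  /-- the set of active nodes in round `t`, after the deactivations of that round -/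
  act : ℕ → Ω → Set 𝒯
  /-- the node selected in round `t` -/
  sel : ℕ → Ω → 𝒯
  /-- the arm played in round `t` -/
  arm : ℕ → Ω → Arm 𝒯
  /-- the payoff function of round `t` -/
  payFun : ℕ → Ω → Arm 𝒯 → ℝ
  measurable_payFun : ∀ t < T, Measurable (payFun t)
  measurable_sel : ∀ t < T, ∀ v, MeasurableSet[ℱ t] {ω | sel t ω = v}
  measurable_arm : ∀ t < T, ∀ x, MeasurableSet[ℱ (t + 1)] {ω | arm t ω = x}
  measurable_pay : ∀ t < T, Measurable[ℱ (t + 1)] (fun ω => payFun t ω (arm t ω))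
  /-- in the first round the deactivations start from the root as the only active node -/
  act_zero : ∀ ω, Relation.ReflTransGen
    (DeactStep (Violates T qhat (fun s => sel s ω) (fun s => arm s ω)
      (fun s => payFun s ω (arm s ω)) 0)) {⊥} (act 0 ω)
  /-- in later rounds they start from the nodes active in the preceding round -/
  act_succ : ∀ t, t + 1 < T → ∀ ω, Relation.ReflTransGen
    (DeactStep (Violates T qhat (fun s => sel s ω) (fun s => arm s ω)
      (fun s => payFun s ω (arm s ω)) (t + 1))) (act t ω) (act (t + 1) ω)
  /-- the deactivations are repeated until the invariant holds -/
  invariant : ∀ t < T, ∀ ω, ∀ v ∈ act t ω,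
    ¬ Violates T qhat (fun s => sel s ω) (fun s => arm s ω) (fun s => payFun s ω (arm s ω)) t v
  sel_mem : ∀ t < T, ∀ ω, sel t ω ∈ act t ω
  /-- the selected node has the maximal index among the active nodes -/
  sel_max : ∀ t < T, ∀ ω, ∀ v ∈ act t ω,
    nodeIndex T qhat (fun s => sel s ω) (fun s => arm s ω) (fun s => payFun s ω (arm s ω)) t v ≤
    nodeIndex T qhat (fun s => sel s ω) (fun s => arm s ω) (fun s => payFun s ω (arm s ω)) t
      (sel t ω)
  /-- Given the information before round `t`, the arm of round `t` is a random sample from the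
  subtree rooted at the selected node, and the payoff function has law `Pay` and is independent of
  the arm. -/
  law : ∀ t < T, ∀ A : Set Ω, MeasurableSet[ℱ t] A → ∀ (v : 𝒯) (x : Arm 𝒯) (B : Set (Arm 𝒯 → ℝ)),
    MeasurableSet B →
    P (A ∩ {ω | sel t ω = v} ∩ {ω | arm t ω = x} ∩ payFun t ⁻¹' B) =
      P (A ∩ {ω | sel t ω = v}) * ENNReal.ofReal (reachProb v x.1) * Pay B

/-- The (expected) regret of an execution: `E[∑_{t < T} (μ* - μ(x_t))]`. -/
def Execution.regret {𝒯 : RootedTree.{u}} [Fintype 𝒯] {Pay : Measure (Arm 𝒯 → ℝ)} {T : ℕ}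
    {qhat : ℝ} {Ω : Type w} [MeasurableSpace Ω] {P : Measure Ω}
    (E : Execution 𝒯 Pay T qhat P) : ℝ :=
  ∫ ω, ∑ t ∈ Finset.range T,
    (bestMean (meanPayoff Pay) - meanPayoff Pay (E.arm t ω)) ∂P

end Taxonomy

end

/-! Write k for `kFactor qhat`, rad for the confidence radius, and call `bestMean μ - nodeMean μ v`
the gap of v. A random sample from the selected node costs its gap in expectation (`regret_eq`), so
it suffices to bound the total gap of the selected nodes on clean runs and to show that other runs
are rare.

Clean runs are cheap. An active node above an optimal arm has weight at most 4k·rad: once it has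
enough hits, its two quality witnesses have radii at most (k/4)·rad, and a larger weight would show
in the weight estimate (`IsClean.weight_le`). Hence its index is at least μ*, and selection by index
bounds the gap of the selected node, and through the invariant that of every node b below it, by a
multiple of k·rad(b) (`IsClean.gap_le`). A deactivated node has k·rad at most its weight, so every
node below it has gap at most 37/5 of that weight (`IsClean.gap_le_weight`). Now cut the tree at the
`frontier` for a resolution δ. Each round of gap more than δ is charged to a frontier node b that it
hits, and the charges to b add up to O(log T / (qhat · max(δ, gap b)))
(`IsClean.sum_costlyRounds_le`). Since 37/5 < 8 · 15/16, a frontier node whose gap is at scale δ'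
has a member of the zooming cover for δ' in its subtree, so there are at most c·δ'^(-d) of them
(`IsClean.card_frontier_le`). Summing over the scales (15/16)^j gives δT + O(c · log T · δ^(-d-1) /
qhat); then δ is balanced, using 1/qhat ≤ log₂ T.

Clean runs are likely. The tree may be huge compared with T, so a plain union bound over nodes
fails. A node with at most one hit has radius at least 1 and needs no estimate; an only child is
never selected and copies the statistics of its parent. The probabilities that the remaining nodes
are hit twice add up to at most 2T² (`sum_twiceProb_le`), because reach probabilities at least halve
at every branching. Each deviation bound carries the probability of two hits as a factor: an
exponential product over the hits, started at the second hit, does not grow in expectation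
(`lintegral_hitProd_le`). -/

namespace Taxonomy

open scoped Classical ENNReal

/-! ### Reach probabilities of the random walk on the tree. -/

section Tree

variable {𝒯 : RootedTree.{u}}

lemma le_or_le_of_le {a b x : 𝒯} (ha : a ≤ x) (hb : b ≤ x) : a ≤ b ∨ b ≤ a :=
  le_total_of_directed hb ha

lemma le_of_lt_of_covBy {a p u : 𝒯} (ha : a < u) (hp : p ⋖ u) : a ≤ p := by
  rcases le_or_le_of_le ha.le hp.le with h | h
  · exact h
  · rcases h.lt_or_eq with h | h
    · exact absurd ha (hp.2 h)
    · exact h.ge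

lemma eq_of_covBy_of_covBy {v a b x : 𝒯} (ha : v ⋖ a) (hb : v ⋖ b) (hax : a ≤ x) (hbx : b ≤ x) :
    a = b := by
  rcases le_or_le_of_le hax hbx with h | h
  · rcases h.lt_or_eq with h | h
    · exact absurd h (hb.2 ha.lt)
    · exact h
  · rcases h.lt_or_eq with h | h
    · exact absurd h (ha.2 hb.lt)
    · exact h.symm

/-- A node is an only child if it is the unique child of its parent. -/
def OnlyChild (u : 𝒯) : Prop := ∃ p : 𝒯, p ⋖ u ∧ children p = {u}

variable [Fintype 𝒯]

lemma exists_child_le {v x : 𝒯} (h : v < x) : ∃ u, v ⋖ u ∧ u ≤ x := by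
  obtain ⟨u, hu, hmin⟩ := (Finset.univ.filter (fun u : 𝒯 => v < u ∧ u ≤ x)).exists_minimal
    ⟨x, by simp [h]⟩
  simp only [Finset.mem_filter, Finset.mem_univ, true_and] at hu hmin
  exact ⟨u, ⟨hu.1, fun c hc hcu => hcu.not_ge (hmin ⟨hc, hcu.le.trans hu.2⟩ hcu.le)⟩, hu.2⟩

lemma exists_child_of_not_isMax {v : 𝒯} (h : ¬ IsMax v) : ∃ u, v ⋖ u := by
  obtain ⟨x, hx⟩ := not_isMax_iff.1 h
  obtain ⟨u, hu, -⟩ := exists_child_le hx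
  exact ⟨u, hu⟩

lemma exists_arm_ge (v : 𝒯) : ∃ x : Arm 𝒯, v ≤ x.1 := by
  obtain ⟨x, hx, hmax⟩ := (Finset.univ.filter (fun u : 𝒯 => v ≤ u)).exists_maximal
    ⟨v, by simp⟩
  simp only [Finset.mem_filter, Finset.mem_univ, true_and] at hx hmax
  exact ⟨⟨x, fun y hy => hmax (hx.trans hy) hy⟩, hx⟩

instance : Nonempty (Arm 𝒯) := ⟨(exists_arm_ge (⊥ : 𝒯)).choose⟩

lemma children_ncard_pos {v : 𝒯} (h : ¬ IsMax v) : 0 < (children v).ncard := by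
  obtain ⟨u, hu⟩ := exists_child_of_not_isMax h
  exact (Set.ncard_pos (Set.toFinite _)).2 ⟨u, hu⟩

lemma reachProb_self (v : 𝒯) : reachProb v v = 1 := by
  rw [reachProb, if_pos le_rfl, Finset.filter_eq_empty_iff.2, Finset.prod_empty]
  rintro w - ⟨h1, h2⟩
  exact h1.not_gt h2

lemma reachProb_of_not_le {v u : 𝒯} (h : ¬ v ≤ u) : reachProb v u = 0 := by
  rw [reachProb, if_neg h]

lemma reachProb_nonneg (v u : 𝒯) : 0 ≤ reachProb v u := by
  rw [reachProb]
  split_ifs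
  · exact Finset.prod_nonneg fun _ _ => by positivity
  · exact le_rfl

lemma reachProb_pos {v u : 𝒯} (h : v ≤ u) : 0 < reachProb v u := by
  rw [reachProb, if_pos h]
  refine Finset.prod_pos fun w hw => ?_
  simp only [Finset.mem_filter, Finset.mem_univ, true_and] at hw
  have := children_ncard_pos (not_isMax_iff.2 ⟨u, hw.2⟩)
  positivity

lemma reachProb_mul {v w u : 𝒯} (h1 : v ≤ w) (h2 : w ≤ u) :
    reachProb v u = reachProb v w * reachProb w u := by
  rw [reachProb, reachProb, reachProb, if_pos h1, if_pos h2, if_pos (h1.trans h2),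
    ← Finset.prod_union]
  · refine Finset.prod_congr ?_ fun _ _ => rfl
    ext z
    simp only [Finset.mem_filter, Finset.mem_univ, true_and, Finset.mem_union]
    constructor
    · rintro ⟨hz1, hz2⟩
      rcases le_or_le_of_le hz2.le h2 with h | h
      · rcases h.lt_or_eq with h | h
        · exact Or.inl ⟨hz1, h⟩
        · exact Or.inr ⟨h.ge, hz2⟩
      · exact Or.inr ⟨h, hz2⟩
    · rintro (⟨hz1, hz2⟩ | ⟨hz1, hz2⟩)
      · exact ⟨hz1, hz2.trans_le h2⟩
      · exact ⟨h1.trans hz1, hz2⟩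
  · rw [Finset.disjoint_left]
    intro z hz hz'
    simp only [Finset.mem_filter, Finset.mem_univ, true_and] at hz hz'
    exact hz'.1.not_gt hz.2

lemma reachProb_of_covBy {v u : 𝒯} (h : v ⋖ u) :
    reachProb v u = ((children v).ncard : ℝ)⁻¹ := by
  rw [reachProb, if_pos h.le]
  have : Finset.univ.filter (fun w : 𝒯 => v ≤ w ∧ w < u) = {v} := by
    ext w
    simp only [Finset.mem_filter, Finset.mem_univ, true_and, Finset.mem_singleton]
    constructor
    · rintro ⟨h1, h2⟩
      exact le_antisymm (le_of_lt_of_covBy h2 h) h1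
    · rintro rfl
      exact ⟨le_rfl, h.lt⟩
  rw [this, Finset.prod_singleton]

/-- Downward induction along the tree, from the leaves to the root. -/
lemma descend_induction {motive : 𝒯 → Prop}
    (step : ∀ v, (∀ u, v < u → motive u) → motive v) (v : 𝒯) : motive v :=
  (wellFounded_gt (α := 𝒯)).induction v fun v ih => step v fun u hu => ih u hu

/-- The random walk which starts at `v` ends in some leaf. -/
lemma sum_reachProb_arms (v : 𝒯) :
    ∑ x ∈ Finset.univ.filter (fun x : Arm 𝒯 => v ≤ x.1), reachProb v x.1 = 1 := by
  induction v using descend_induction with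
  | step v ih =>
    by_cases hv : IsMax v
    · have : Finset.univ.filter (fun x : Arm 𝒯 => v ≤ x.1) = {⟨v, hv⟩} := by
        ext x
        simp only [Finset.mem_filter, Finset.mem_univ, true_and, Finset.mem_singleton]
        constructor
        · intro h
          exact Subtype.ext (le_antisymm (hv h) h)
        · rintro rfl
          exact le_rfl
      rw [this, Finset.sum_singleton, reachProb_self]
    · have hU : Finset.univ.filter (fun x : Arm 𝒯 => v ≤ x.1) =
          (children v).toFinset.biUnion
            (fun u => Finset.univ.filter (fun x : Arm 𝒯 => u ≤ x.1)) := by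
        ext x
        simp only [Finset.mem_filter, Finset.mem_univ, true_and, Finset.mem_biUnion,
          Set.mem_toFinset]
        constructor
        · intro h
          have hlt : v < x.1 := lt_of_le_of_ne h (fun e => hv (e ▸ x.2))
          obtain ⟨u, hu, hux⟩ := exists_child_le hlt
          exact ⟨u, hu, hux⟩
        · rintro ⟨u, hu, hux⟩
          exact (CovBy.le hu).trans hux
      rw [hU, Finset.sum_biUnion]
      · have : ∀ u ∈ (children v).toFinset,
            ∑ x ∈ Finset.univ.filter (fun x : Arm 𝒯 => u ≤ x.1), reachProb v x.1 =
              ((children v).ncard : ℝ)⁻¹ := by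
          intro u hu
          have hu' : u ∈ children v := Set.mem_toFinset.1 hu
          change v ⋖ u at hu'
          rw [← mul_one ((children v).ncard : ℝ)⁻¹, ← ih u hu'.lt, Finset.mul_sum]
          refine Finset.sum_congr rfl fun x hx => ?_
          rw [reachProb_mul hu'.le (Finset.mem_filter.1 hx).2, reachProb_of_covBy hu']
        rw [Finset.sum_congr rfl this, Finset.sum_const, nsmul_eq_mul, Set.ncard_eq_toFinset_card']
        refine mul_inv_cancel₀ ?_
        have := children_ncard_pos hv
        rw [Set.ncard_eq_toFinset_card'] at this
        positivity
      · intro a ha b hb hab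
        rw [Function.onFun, Finset.disjoint_left]
        intro x hxa hxb
        have ha' : a ∈ children v := by simpa using ha
        have hb' : b ∈ children v := by simpa using hb
        exact hab (eq_of_covBy_of_covBy ha' hb'
          (Finset.mem_filter.1 hxa).2 (Finset.mem_filter.1 hxb).2)

lemma sum_reachProb_arms_above {v u : 𝒯} (h : v ≤ u) :
    ∑ x ∈ Finset.univ.filter (fun x : Arm 𝒯 => u ≤ x.1), reachProb v x.1 = reachProb v u := by
  rw [← mul_one (reachProb v u), ← sum_reachProb_arms u, Finset.mul_sum]
  exact Finset.sum_congr rfl fun x hx => reachProb_mul h (Finset.mem_filter.1 hx).2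

lemma reachProb_le_one (v u : 𝒯) : reachProb v u ≤ 1 := by
  by_cases h : v ≤ u
  · rw [← sum_reachProb_arms_above h, ← sum_reachProb_arms v]
    refine Finset.sum_le_sum_of_subset_of_nonneg ?_ fun _ _ _ => reachProb_nonneg _ _
    intro x hx
    simp only [Finset.mem_filter, Finset.mem_univ, true_and] at hx ⊢
    exact h.trans hx
  · rw [reachProb_of_not_le h]
    exact zero_le_one

lemma sum_reachProb_univ (v : 𝒯) : ∑ x : Arm 𝒯, reachProb v x.1 = 1 := by
  rw [← sum_reachProb_arms v, Finset.sum_filter]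
  refine Finset.sum_congr rfl fun x _ => ?_
  split_ifs with h
  · rfl
  · exact reachProb_of_not_le h

lemma nodeMean_eq_sum (μ : Arm 𝒯 → ℝ) (v : 𝒯) :
    nodeMean μ v = ∑ x : Arm 𝒯, μ x * reachProb v x.1 := by
  rw [nodeMean, Finset.sum_filter]
  refine Finset.sum_congr rfl fun x _ => ?_
  split_ifs with h
  · rfl
  · rw [reachProb_of_not_le h, mul_zero]

/-- A node which the random walk from `v` reaches with certainty has the same mean as `v`. -/
lemma nodeMean_eq_of_one_le_reachProb (μ : Arm 𝒯 → ℝ) {v u : 𝒯} (h : v ≤ u)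
    (h1 : 1 ≤ reachProb v u) : nodeMean μ u = nodeMean μ v := by
  have h1' : reachProb v u = 1 := le_antisymm (reachProb_le_one _ _) h1
  have hsub : Finset.univ.filter (fun x : Arm 𝒯 => u ≤ x.1) ⊆
      Finset.univ.filter (fun x : Arm 𝒯 => v ≤ x.1) := by
    intro x hx
    simp only [Finset.mem_filter, Finset.mem_univ, true_and] at hx ⊢
    exact h.trans hx
  have hz : ∑ x ∈ Finset.univ.filter (fun x : Arm 𝒯 => v ≤ x.1) \
      Finset.univ.filter (fun x : Arm 𝒯 => u ≤ x.1), reachProb v x.1 = 0 := by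
    have := Finset.sum_sdiff (f := fun x : Arm 𝒯 => reachProb v x.1) hsub
    rw [sum_reachProb_arms, sum_reachProb_arms_above h, h1'] at this
    linarith
  rw [nodeMean, nodeMean, ← Finset.sum_sdiff hsub]
  refine Eq.trans ?_ (add_eq_right.2 (Finset.sum_eq_zero ?_)).symm
  · refine Finset.sum_congr rfl fun x hx => ?_
    rw [reachProb_mul h (Finset.mem_filter.1 hx).2, h1', one_mul]
  · intro x hx
    rw [(Finset.sum_eq_zero_iff_of_nonneg fun _ _ => reachProb_nonneg _ _).1 hz x hx, mul_zero]

lemma reachProb_onlyChild {p u : 𝒯} (h : p ⋖ u) (hc : children p = {u}) : reachProb p u = 1 := by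
  rw [reachProb_of_covBy h, hc, Set.ncard_singleton, Nat.cast_one, inv_one]

/-- Along a path, the probabilities of reaching the nodes that have siblings add up to at
most one. -/
lemma sum_reachProb_path_le (v x : 𝒯) :
    ∑ w ∈ Finset.univ.filter (fun w : 𝒯 => ¬ OnlyChild w ∧ v < w ∧ w ≤ x), reachProb v w ≤ 1 := by
  induction v using descend_induction with
  | step v ih =>
    by_cases hvx : v < x
    · obtain ⟨u, hu, hux⟩ := exists_child_le hvx
      have hsplit : ∀ w, ¬ OnlyChild w ∧ v < w ∧ w ≤ x →
          w = u ∧ ¬ OnlyChild u ∨ (¬ OnlyChild w ∧ u < w ∧ w ≤ x) := by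
        rintro w ⟨h1, h2, h3⟩
        obtain ⟨u', hu', hw'⟩ := exists_child_le h2
        obtain rfl := eq_of_covBy_of_covBy hu hu' hux (hw'.trans h3)
        rcases hw'.lt_or_eq with h | h
        · exact Or.inr ⟨h1, h, h3⟩
        · exact Or.inl ⟨h.symm, h ▸ h1⟩
      have hrest : ∑ w ∈ Finset.univ.filter (fun w : 𝒯 => ¬ OnlyChild w ∧ u < w ∧ w ≤ x),
          reachProb v w ≤ reachProb v u := by
        calc _ = reachProb v u * ∑ w ∈ Finset.univ.filter
              (fun w : 𝒯 => ¬ OnlyChild w ∧ u < w ∧ w ≤ x), reachProb u w := by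
              rw [Finset.mul_sum]
              exact Finset.sum_congr rfl fun w hw =>
                reachProb_mul hu.le (Finset.mem_filter.1 hw).2.2.1.le
          _ ≤ reachProb v u * 1 := by
              gcongr
              · exact reachProb_nonneg _ _
              · exact ih u hu.lt
          _ = _ := mul_one _
      by_cases hoc : OnlyChild u
      · refine le_trans ?_ (hrest.trans (reachProb_le_one _ _))
        refine Finset.sum_le_sum_of_subset_of_nonneg ?_ fun _ _ _ => reachProb_nonneg _ _
        intro w hw
        simp only [Finset.mem_filter, Finset.mem_univ, true_and] at hw ⊢
        rcases hsplit w hw with h | h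
        · exact absurd hoc h.2
        · exact h
      -- A child with siblings is reached with probability p ≤ 1/2, and by induction the rest of the
      -- path adds at most p, so the total is at most 2p ≤ 1.
      · have hhalf : reachProb v u ≤ 1 / 2 := by
          rw [reachProb_of_covBy hu, one_div]
          have h2 : 2 ≤ (children v).ncard := by
            by_contra hlt
            have h1 : (children v).ncard ≤ 1 := by omega
            rw [Set.ncard_le_one (Set.toFinite _)] at h1
            refine hoc ⟨v, hu, ?_⟩
            ext z
            simp only [Set.mem_singleton_iff]
            exact ⟨fun hz => h1 z hz u hu, fun hz => hz ▸ hu⟩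
          have : (2 : ℝ) ≤ (children v).ncard := by exact_mod_cast h2
          gcongr
        have hle : ∑ w ∈ Finset.univ.filter (fun w : 𝒯 => ¬ OnlyChild w ∧ v < w ∧ w ≤ x),
            reachProb v w ≤ reachProb v u +
            ∑ w ∈ Finset.univ.filter (fun w : 𝒯 => ¬ OnlyChild w ∧ u < w ∧ w ≤ x),
              reachProb v w := by
          rw [← Finset.sum_insert (a := u) (f := fun w => reachProb v w)]
          · refine Finset.sum_le_sum_of_subset_of_nonneg ?_ fun _ _ _ => reachProb_nonneg _ _
            intro w hw
            simp only [Finset.mem_filter, Finset.mem_univ, true_and, Finset.mem_insert] at hw ⊢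
            rcases hsplit w hw with h | h
            · exact Or.inl h.1
            · exact Or.inr h
          · simp
        linarith
    · rw [Finset.filter_eq_empty_iff.2, Finset.sum_empty]
      · exact zero_le_one
      · rintro w - ⟨-, h1, h2⟩
        exact hvx (h1.trans_le h2)

end Tree

/-! ### Node means, weights, quality and zooming dimension. -/

section Means

variable {𝒯 : RootedTree.{u}} [Fintype 𝒯] (μ : Arm 𝒯 → ℝ)

lemma le_bestMean (x : Arm 𝒯) : μ x ≤ bestMean μ :=
  le_ciSup (Set.finite_range μ).bddAbove x

lemma exists_eq_bestMean : ∃ x : Arm 𝒯, μ x = bestMean μ :=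
  exists_eq_ciSup_of_finite

lemma weight_set_finite (v : 𝒯) :
    {r | ∃ x y : Arm 𝒯, v ≤ x.1 ∧ v ≤ y.1 ∧ r = |μ x - μ y|}.Finite := by
  refine (Set.finite_range (fun p : Arm 𝒯 × Arm 𝒯 => |μ p.1 - μ p.2|)).subset ?_
  rintro r ⟨x, y, -, -, rfl⟩
  exact ⟨(x, y), rfl⟩

lemma abs_sub_le_weight {v : 𝒯} {x y : Arm 𝒯} (hx : v ≤ x.1) (hy : v ≤ y.1) :
    |μ x - μ y| ≤ weight μ v :=
  le_csSup (weight_set_finite μ v).bddAbove ⟨x, y, hx, hy, rfl⟩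

lemma weight_le {v : 𝒯} {a : ℝ}
    (h : ∀ x y : Arm 𝒯, v ≤ x.1 → v ≤ y.1 → |μ x - μ y| ≤ a) : weight μ v ≤ a := by
  obtain ⟨x, hx⟩ := exists_arm_ge v
  refine csSup_le ⟨_, x, x, hx, hx, rfl⟩ ?_
  rintro r ⟨x, y, hx, hy, rfl⟩
  exact h x y hx hy

lemma weight_nonneg (v : 𝒯) : 0 ≤ weight μ v := by
  obtain ⟨x, hx⟩ := exists_arm_ge v
  exact (abs_nonneg _).trans (abs_sub_le_weight μ hx hx)

lemma weight_of_isMax {v : 𝒯} (h : IsMax v) : weight μ v ≤ 0 := by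
  refine weight_le μ fun x y hx hy => ?_
  have : x = y := Subtype.ext ((le_antisymm (h hx) hx).trans (le_antisymm (h hy) hy).symm)
  rw [this, sub_self, abs_zero]

lemma weight_attained (v : 𝒯) : ∃ x y : Arm 𝒯, v ≤ x.1 ∧ v ≤ y.1 ∧ weight μ v = |μ x - μ y| := by
  obtain ⟨x, hx⟩ := exists_arm_ge v
  have hne : {r | ∃ x y : Arm 𝒯, v ≤ x.1 ∧ v ≤ y.1 ∧ r = |μ x - μ y|}.Nonempty :=
    ⟨_, x, x, hx, hx, rfl⟩
  exact hne.csSup_mem (weight_set_finite μ v)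

variable {μ}

lemma le_nodeMean {v : 𝒯} {a : ℝ} (h : ∀ x : Arm 𝒯, v ≤ x.1 → a ≤ μ x) : a ≤ nodeMean μ v := by
  rw [← mul_one a, ← sum_reachProb_arms v, Finset.mul_sum]
  exact Finset.sum_le_sum fun x hx => mul_le_mul_of_nonneg_right
    (h x (Finset.mem_filter.1 hx).2) (reachProb_nonneg _ _)

lemma nodeMean_le {v : 𝒯} {a : ℝ} (h : ∀ x : Arm 𝒯, v ≤ x.1 → μ x ≤ a) : nodeMean μ v ≤ a := by
  rw [← mul_one a, ← sum_reachProb_arms v, Finset.mul_sum]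
  exact Finset.sum_le_sum fun x hx => mul_le_mul_of_nonneg_right
    (h x (Finset.mem_filter.1 hx).2) (reachProb_nonneg _ _)

lemma nodeMean_le_bestMean (v : 𝒯) : nodeMean μ v ≤ bestMean μ :=
  nodeMean_le fun x _ => le_bestMean μ x

lemma exists_arm_nodeMean_le (v : 𝒯) : ∃ x : Arm 𝒯, v ≤ x.1 ∧ nodeMean μ v ≤ μ x := by
  by_contra! hcon
  obtain ⟨x, hx, hmax⟩ := (Finset.univ.filter (fun x : Arm 𝒯 => v ≤ x.1)).exists_max_image μ
    ((exists_arm_ge v).imp fun x hx => by simpa using hx)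
  simp only [Finset.mem_filter, Finset.mem_univ, true_and] at hx hmax
  exact (hcon x hx).not_ge (nodeMean_le hmax)

lemma nodeMean_of_isMax (x : Arm 𝒯) : nodeMean μ x.1 = μ x := by
  have h : ∀ y : Arm 𝒯, x.1 ≤ y.1 → μ y = μ x := fun y hy =>
    congrArg μ (Subtype.ext (le_antisymm (x.2 hy) hy))
  exact le_antisymm (nodeMean_le fun y hy => (h y hy).le) (le_nodeMean fun y hy => (h y hy).ge)

lemma nodeMean_sub_le_weight {v u u' : 𝒯} (h : v ≤ u) (h' : v ≤ u') :
    nodeMean μ u - nodeMean μ u' ≤ weight μ v := by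
  have : nodeMean μ u ≤ nodeMean μ u' + weight μ v := by
    refine nodeMean_le fun x hx => ?_
    have : μ x - weight μ v ≤ nodeMean μ u' := by
      refine le_nodeMean fun y hy => ?_
      have := (abs_le.1 (abs_sub_le_weight μ (h.trans hx) (h'.trans hy))).2
      linarith
    linarith
  linarith

lemma abs_nodeMean_sub_le_weight {v u u' : 𝒯} (h : v ≤ u) (h' : v ≤ u') :
    |nodeMean μ u - nodeMean μ u'| ≤ weight μ v :=
  abs_sub_le_iff.2 ⟨nodeMean_sub_le_weight h h', nodeMean_sub_le_weight h' h⟩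

lemma bestMean_le_nodeMean_add_weight {v : 𝒯} (h : ∃ x : Arm 𝒯, v ≤ x.1 ∧ μ x = bestMean μ) :
    bestMean μ ≤ nodeMean μ v + weight μ v := by
  obtain ⟨x, hx, hbest⟩ := h
  have := nodeMean_sub_le_weight (μ := μ) hx (le_refl v)
  rw [nodeMean_of_isMax, hbest] at this
  linarith

lemma quality_le_one {q : ℝ} (hq : QualityAtLeast μ q) : q ≤ 1 := by
  obtain ⟨x, hx⟩ := exists_eq_bestMean μ
  obtain ⟨u, u', -, -, -, h⟩ := hq ⊥ ⟨x, bot_le, hx⟩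
  exact h.trans ((min_le_left _ _).trans (reachProb_le_one _ _))

/-- The least reach probability over comparable pairs is positive and is itself admissible as a
quality: two leaves realising the weight of `v` serve as witnesses. -/
lemma quality_pos {q : ℝ} (hq : IsQuality μ q) : 0 < q := by
  obtain ⟨p, -, hp⟩ := (Finset.univ : Finset (𝒯 × 𝒯)).exists_min_image
    (fun p => if p.1 ≤ p.2 then reachProb p.1 p.2 else 1) Finset.univ_nonempty
  simp only [Finset.mem_univ, true_imp_iff] at hp
  refine lt_of_lt_of_le ?_ (hq.2 (?_ : QualityAtLeast μ
    (if p.1 ≤ p.2 then reachProb p.1 p.2 else 1)))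
  · split_ifs with h
    · exact reachProb_pos h
    · exact one_pos
  · intro v _
    obtain ⟨x, y, hx, hy, hw⟩ := weight_attained μ v
    refine ⟨x.1, y.1, hx, hy, ?_, le_min ?_ ?_⟩
    · rw [nodeMean_of_isMax, nodeMean_of_isMax, ← hw]
      linarith [weight_nonneg μ v]
    · simpa [hx] using hp (v, x.1)
    · simpa [hy] using hp (v, y.1)

/-- A taxonomy of quality one has a single expected payoff. -/
lemma eq_bestMean_of_one_le_quality {q : ℝ} (hq : QualityAtLeast μ q) (h1 : 1 ≤ q)
    (x : Arm 𝒯) : μ x = bestMean μ := by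
  obtain ⟨y, hy⟩ := exists_eq_bestMean μ
  obtain ⟨u, u', hu, hu', hw, h⟩ := hq ⊥ ⟨y, bot_le, hy⟩
  rw [nodeMean_eq_of_one_le_reachProb μ hu (h1.trans (h.trans (min_le_left _ _))),
    nodeMean_eq_of_one_le_reachProb μ hu' (h1.trans (h.trans (min_le_right _ _))), sub_self,
    abs_zero] at hw
  have hxy := abs_sub_le_weight μ (v := (⊥ : 𝒯)) (x := x) (y := y) bot_le bot_le
  have : |μ x - μ y| ≤ 0 := by linarith
  rw [← hy]
  exact sub_eq_zero.1 (abs_nonpos_iff.1 this)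

lemma one_le_card_cover {c d δ : ℝ} (h : ZoomingCover μ c d) (h0 : 0 < δ) (h1 : δ ≤ 1) :
    1 ≤ c * δ ^ (-d) := by
  obtain ⟨S, hS, -, hcov⟩ := h δ h0 h1
  obtain ⟨x, hx⟩ := exists_eq_bestMean μ
  obtain ⟨v, hv, -⟩ := hcov x (by rw [hx, sub_self]; exact h0.le)
  have : 1 ≤ S.card := Finset.card_pos.2 ⟨v, hv⟩
  exact le_trans (by exact_mod_cast this) hS

lemma one_le_const_of_zoomingCover {c d : ℝ} (h : ZoomingCover μ c d) : 1 ≤ c := by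
  simpa using one_le_card_cover h one_pos le_rfl

/-- An optimal arm must always be covered, but for negative `d` the scale δ = (2c)^(1/d) would allow
only 1/2 subtree. -/
lemma dim_nonneg_of_zoomingCover {c d : ℝ} (h : ZoomingCover μ c d) : 0 ≤ d := by
  by_contra! hd
  have hc := one_le_const_of_zoomingCover h
  have h0 : 0 < (2 * c) ^ (1 / d) := by positivity
  have h1 : (2 * c) ^ (1 / d) ≤ 1 :=
    Real.rpow_le_one_of_one_le_of_nonpos (by linarith) (one_div_nonpos.2 hd.le)
  have := one_le_card_cover h h0 h1
  rw [← Real.rpow_mul (by positivity), mul_neg, one_div_mul_cancel hd.ne, Real.rpow_neg_one] at this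
  have h3 : c * (2 * c)⁻¹ = 1 / 2 := by field_simp
  linarith

end Means

/-! ### Deterministic properties of a run of the algorithm. -/

section Runs

variable {𝒯 : RootedTree.{u}}

/-- The rules of the algorithm, for a single sequence of active sets, selected nodes, arms and
payoffs. -/
structure IsRun (T : ℕ) (qhat : ℝ) (act : ℕ → Set 𝒯) (sel : ℕ → 𝒯) (arm : ℕ → Arm 𝒯)
    (pay : ℕ → ℝ) : Prop where
  act_zero : Relation.ReflTransGen (DeactStep (Violates T qhat sel arm pay 0)) {⊥} (act 0)
  act_succ : ∀ t, t + 1 < T →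
    Relation.ReflTransGen (DeactStep (Violates T qhat sel arm pay (t + 1))) (act t) (act (t + 1))
  invariant : ∀ t < T, ∀ v ∈ act t, ¬ Violates T qhat sel arm pay t v
  sel_mem : ∀ t < T, sel t ∈ act t
  sel_max : ∀ t < T, ∀ v ∈ act t,
    nodeIndex T qhat sel arm pay t v ≤ nodeIndex T qhat sel arm pay t (sel t)

lemma Execution.isRun [Fintype 𝒯] {Pay : Measure (Arm 𝒯 → ℝ)} {T : ℕ} {qhat : ℝ} {Ω : Type w}
    [MeasurableSpace Ω] {P : Measure Ω} (E : Execution 𝒯 Pay T qhat P) (ω : Ω) :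
    IsRun T qhat (fun t => E.act t ω) (fun t => E.sel t ω) (fun t => E.arm t ω)
      (fun t => E.payFun t ω (E.arm t ω)) where
  act_zero := E.act_zero ω
  act_succ t ht := E.act_succ t ht ω
  invariant t ht := E.invariant t ht ω
  sel_mem t ht := E.sel_mem t ht ω
  sel_max t ht := E.sel_max t ht ω

variable {T : ℕ} {qhat : ℝ} {act : ℕ → Set 𝒯} {sel : ℕ → 𝒯} {arm : ℕ → Arm 𝒯} {pay : ℕ → ℝ}

lemma mem_hitRounds {t s : ℕ} {v : 𝒯} :
    s ∈ hitRounds sel arm t v ↔ s < t ∧ sel s ≤ v ∧ v ≤ (arm s).1 := by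
  simp [hitRounds]

lemma deact_induction {bad : 𝒯 → Prop} {I : Set 𝒯 → Prop} {A A' : Set 𝒯}
    (h : Relation.ReflTransGen (DeactStep bad) A A') (h0 : I A)
    (hstep : ∀ B, I B → ∀ v ∈ B, bad v → I (B \ {v} ∪ children v)) : I A' := by
  induction h with
  | refl => exact h0
  | tail _ h ih =>
    obtain ⟨v, hv, hbad, rfl⟩ := h
    exact hstep _ ih v hv hbad

/-- Induction over the deactivations of a run. -/
lemma IsRun.induction (R : IsRun T qhat act sel arm pay) {I : ℕ → Set 𝒯 → Prop} (h0 : I 0 {⊥})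
    (hstep : ∀ t < T, ∀ B, I t B → ∀ v ∈ B, Violates T qhat sel arm pay t v →
      I t (B \ {v} ∪ children v))
    (hnext : ∀ t, t + 1 < T → I t (act t) → I (t + 1) (act t)) {t : ℕ} (ht : t < T) :
    I t (act t) := by
  induction t with
  | zero => exact deact_induction R.act_zero h0 (hstep 0 ht)
  | succ t ih =>
    exact deact_induction (R.act_succ t ht) (hnext t ht (ih (by omega))) (hstep (t + 1) ht)

lemma IsRun.antichain (R : IsRun T qhat act sel arm pay) {t : ℕ} (ht : t < T) {a b : 𝒯}
    (ha : a ∈ act t) (hb : b ∈ act t) : ¬ a < b := by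
  refine R.induction (I := fun _ B => ∀ a ∈ B, ∀ b ∈ B, ¬ a < b) ?_ ?_ (fun _ _ h => h) ht
    a ha b hb
  · rintro a rfl b rfl
    exact lt_irrefl _
  · rintro t - B ih v hv - a (⟨ha, hav⟩ | ha) b (⟨hb, hbv⟩ | hb) hab
    · exact ih a ha b hb hab
    · rcases (le_of_lt_of_covBy hab hb).lt_or_eq with h | h
      · exact ih a ha v hv h
      · exact hav h
    · exact ih v hv b hb ((CovBy.lt ha).trans hab)
    · exact (show v ⋖ b from hb).2 (CovBy.lt ha) hab

/-- A non-root node becomes active only by splitting its parent. This supplies the violation that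
`IsClean.gap_le_weight` needs at ancestors of selected nodes. -/
lemma IsRun.exists_violates (R : IsRun T qhat act sel arm pay) {t : ℕ} (ht : t < T) {p y : 𝒯}
    (hy : y ∈ act t) (hp : p < y) : ∃ t' < T, Violates T qhat sel arm pay t' p := by
  refine R.induction (I := fun _ B => ∀ y ∈ B, ∀ p < y, ∃ t' < T, Violates T qhat sel arm pay t' p)
    ?_ ?_ (fun _ _ h => h) ht y hy p hp
  · rintro y rfl p hp
    exact absurd hp not_lt_bot
  · rintro t ht B ih v hv hviol y (⟨hy, -⟩ | hy) p hp
    · exact ih y hy p hp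
    · rcases (le_of_lt_of_covBy hp hy).lt_or_eq with h | h
      · exact ih v hv p h
      · exact ⟨t, ht, h ▸ hviol⟩

lemma IsRun.exists_le_of_succ (R : IsRun T qhat act sel arm pay) {t : ℕ} (ht : t + 1 < T) {y : 𝒯}
    (hy : y ∈ act (t + 1)) : ∃ z ∈ act t, z ≤ y := by
  refine deact_induction (I := fun B => ∀ y ∈ B, ∃ z ∈ act t, z ≤ y) (R.act_succ t ht)
    (fun y hy => ⟨y, hy, le_rfl⟩) ?_ y hy
  rintro B ih v hv - y (⟨hy, -⟩ | hy)
  · exact ih y hy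
  · obtain ⟨z, hz, hzv⟩ := ih v hv
    exact ⟨z, hz, hzv.trans (CovBy.le hy)⟩

lemma IsRun.exists_le_of_le (R : IsRun T qhat act sel arm pay) {s t : ℕ} (hst : s ≤ t)
    (ht : t < T) {y : 𝒯} (hy : y ∈ act t) : ∃ z ∈ act s, z ≤ y := by
  induction t, hst using Nat.le_induction generalizing y with
  | base => exact ⟨y, hy, le_rfl⟩
  | succ t _ ih =>
    obtain ⟨z, hz, hzy⟩ := R.exists_le_of_succ ht hy
    obtain ⟨z', hz', hz'z⟩ := ih (by omega) hz
    exact ⟨z', hz', hz'z.trans hzy⟩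

/-- The active front only moves down, so no earlier selection lies strictly below `sel s`; an
earlier walk through `b` therefore passed through `sel s` as well. Consequently the radius at `sel
s` is at most the radius at `b`. -/
lemma IsRun.hitRounds_subset (R : IsRun T qhat act sel arm pay) {s : ℕ} (hs : s < T) {b : 𝒯}
    (hb : sel s ≤ b) : hitRounds sel arm s b ⊆ hitRounds sel arm s (sel s) := by
  intro r hr
  rw [mem_hitRounds] at hr ⊢
  refine ⟨hr.1, ?_, hb.trans hr.2.2⟩
  rcases le_or_le_of_le hr.2.1 hb with h | h
  · exact h
  · rcases h.lt_or_eq with h | h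
    · obtain ⟨z, hz, hzs⟩ := R.exists_le_of_le hr.1.le hs (R.sel_mem s hs)
      exact absurd (hzs.trans_lt h)
        (R.antichain (hr.1.trans hs) hz (R.sel_mem r (hr.1.trans hs)))
    · exact h.ge

lemma weightEst_nonneg {t : ℕ} {v : 𝒯} : 0 ≤ weightEst T sel arm pay t v :=
  Real.iSup_nonneg fun _ => le_max_left _ _

lemma weightEst_le {t : ℕ} {v : 𝒯} {a : ℝ} (ha : 0 ≤ a)
    (h : ∀ u u', v ≤ u → v ≤ u' →
      |avgPayoff sel arm pay t u - avgPayoff sel arm pay t u'| - confRad T sel arm t u -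
        confRad T sel arm t u' ≤ a) : weightEst T sel arm pay t v ≤ a :=
  Real.iSup_le (fun p => max_le ha (h _ _ p.1.2 p.2.2)) ha

lemma confRad_pos (hT : 2 ≤ T) (t : ℕ) (v : 𝒯) : 0 < confRad T sel arm t v := by
  have : 0 < Real.log T := Real.log_pos (by exact_mod_cast hT)
  exact Real.sqrt_pos.2 (by positivity)

lemma confRad_sq (hT : 2 ≤ T) (t : ℕ) (v : 𝒯) :
    confRad T sel arm t v ^ 2 = 8 * Real.log T / (2 + ((hitRounds sel arm t v).card : ℝ)) := by
  have : 0 < Real.log T := Real.log_pos (by exact_mod_cast hT)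
  exact Real.sq_sqrt (by positivity)

lemma kFactor_pos (hq : 0 < qhat) : 0 < kFactor qhat := by
  rw [kFactor]
  positivity

lemma kFactor_sq (hq : 0 < qhat) : kFactor qhat ^ 2 = 32 / qhat := by
  rw [kFactor, mul_pow, Real.sq_sqrt (by positivity)]
  ring

/-- A rational lower bound for √32, just large enough for 6 ≤ (15/14)k in `IsClean.gap_le_weight`.
-/
lemma le_kFactor (hq : 0 < qhat) (hq1 : qhat ≤ 1) : 28 / 5 ≤ kFactor qhat := by
  refine le_of_sq_le_sq (α := ℝ) ?_ (kFactor_pos hq).le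
  rw [kFactor_sq hq, le_div_iff₀ hq]
  linarith

lemma confRad_le_of_card_le (hT : 2 ≤ T) {s t : ℕ} {a b : 𝒯}
    (h : (hitRounds sel arm s b).card ≤ (hitRounds sel arm t a).card) :
    confRad T sel arm t a ≤ confRad T sel arm s b := by
  have : 0 < Real.log T := Real.log_pos (by exact_mod_cast hT)
  rw [confRad, confRad]
  gcongr

variable [Fintype 𝒯]

lemma IsRun.exists_mem_le (R : IsRun T qhat act sel arm pay) {t : ℕ} (ht : t < T)
    (x : Arm 𝒯) : ∃ v ∈ act t, v ≤ x.1 := by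
  refine R.induction (I := fun _ B => ∃ v ∈ B, v ≤ x.1) ⟨⊥, rfl, bot_le⟩ ?_ (fun _ _ h => h) ht
  rintro t - B ⟨y, hy, hyx⟩ v hv hviol
  by_cases hyv : y = v
  · subst hyv
    have hlt : y < x.1 := lt_of_le_of_ne hyx (fun e => hviol.1 (e ▸ x.2))
    obtain ⟨u, hu, hux⟩ := exists_child_le hlt
    exact ⟨u, Or.inr hu, hux⟩
  · exact ⟨y, Or.inl ⟨hy, hyv⟩, hyx⟩

lemma le_weightEst {t : ℕ} {v u u' : 𝒯} (hu : v ≤ u) (hu' : v ≤ u') :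
    |avgPayoff sel arm pay t u - avgPayoff sel arm pay t u'| - confRad T sel arm t u -
      confRad T sel arm t u' ≤ weightEst T sel arm pay t v :=
  (le_max_right _ _).trans (le_ciSup (f := fun p : Set.Ici v × Set.Ici v =>
    max 0 (|avgPayoff sel arm pay t p.1.1 - avgPayoff sel arm pay t p.2.1|
      - confRad T sel arm t p.1.1 - confRad T sel arm t p.2.1))
    (Set.finite_range _).bddAbove (⟨u, hu⟩, ⟨u', hu'⟩))

/-- A walk that does not start at `u` enters it from `p`, and a walk that visits `p` has to continue
to `u`. -/
lemma hitRounds_onlyChild {t : ℕ} {p u : 𝒯} (hp : p ⋖ u) (hc : children p = {u})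
    (hsel : ∀ s < t, sel s ≠ u) : hitRounds sel arm t u = hitRounds sel arm t p := by
  ext s
  rw [mem_hitRounds, mem_hitRounds]
  constructor
  · rintro ⟨hs, h1, h2⟩
    exact ⟨hs, le_of_lt_of_covBy (lt_of_le_of_ne h1 (hsel s hs)) hp, hp.le.trans h2⟩
  · rintro ⟨hs, h1, h2⟩
    refine ⟨hs, h1.trans hp.le, ?_⟩
    have hlt : p < (arm s).1 := lt_of_le_of_ne h2 (fun e => hp.lt.not_isMax (e ▸ (arm s).2))
    obtain ⟨u', hu', hle⟩ := exists_child_le hlt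
    have : u' ∈ children p := hu'
    rw [hc, Set.mem_singleton_iff] at this
    exact this ▸ hle

/-- An only child violates the invariant as soon as its parent does. -/
lemma violates_onlyChild (hT : 2 ≤ T) (hq : 0 < qhat) {t : ℕ} {p u : 𝒯} (hp : p ⋖ u)
    (hc : children p = {u}) (hsel : ∀ s < t, sel s ≠ u)
    (hviol : Violates T qhat sel arm pay t p) : Violates T qhat sel arm pay t u := by
  have hhit := hitRounds_onlyChild (arm := arm) hp hc hsel
  have havg : avgPayoff sel arm pay t u = avgPayoff sel arm pay t p := by
    rw [avgPayoff, avgPayoff, hhit]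
  have hrad : confRad T sel arm t u = confRad T sel arm t p := by
    rw [confRad, confRad, hhit]
  have hrep : ∀ a, p ≤ a → ∃ b, u ≤ b ∧ avgPayoff sel arm pay t b = avgPayoff sel arm pay t a ∧
      confRad T sel arm t b = confRad T sel arm t a := by
    intro a ha
    rcases ha.lt_or_eq with h | rfl
    · obtain ⟨u', hu', hle⟩ := exists_child_le h
      have : u' ∈ children p := hu'
      rw [hc, Set.mem_singleton_iff] at this
      exact ⟨a, this ▸ hle, rfl, rfl⟩
    · exact ⟨u, le_rfl, havg, hrad⟩
  have hle : weightEst T sel arm pay t p ≤ weightEst T sel arm pay t u := by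
    refine weightEst_le weightEst_nonneg fun a a' ha ha' => ?_
    obtain ⟨b, hb, h1, h2⟩ := hrep a ha
    obtain ⟨b', hb', h1', h2'⟩ := hrep a' ha'
    rw [← h1, ← h2, ← h1', ← h2']
    exact le_weightEst hb hb'
  have hk := hviol.2
  rw [not_lt] at hk
  -- If `u` were a leaf, its weight estimate would vanish and could not reach k·rad > 0.
  refine ⟨fun hmax => ?_, by rw [not_lt, hrad]; exact hk.trans hle⟩
  have hzero : weightEst T sel arm pay t u ≤ 0 := by
    refine weightEst_le le_rfl fun a a' ha ha' => ?_
    rw [← le_antisymm ha (hmax ha), ← le_antisymm ha' (hmax ha'), sub_self, abs_zero]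
    linarith [confRad_pos (sel := sel) (arm := arm) hT t u]
  have := mul_pos (kFactor_pos hq) (confRad_pos (sel := sel) (arm := arm) hT t p)
  linarith

/-- An only child is activated by the deactivation of its parent, inherits the violation, and so is
split before the round's selection. The induction also carries that no only child was active in
earlier rounds, hence none was selected. -/
lemma IsRun.not_onlyChild (R : IsRun T qhat act sel arm pay) (hT : 2 ≤ T) (hq : 0 < qhat) {t : ℕ}
    (ht : t < T) {u : 𝒯} (hu : u ∈ act t) : ¬ OnlyChild u := by
  have key : (∀ s < t, ∀ u ∈ act s, ¬ OnlyChild u) ∧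
      ∀ u ∈ act t, OnlyChild u → Violates T qhat sel arm pay t u := by
    refine R.induction (I := fun t B => (∀ s < t, ∀ u ∈ act s, ¬ OnlyChild u) ∧
      ∀ u ∈ B, OnlyChild u → Violates T qhat sel arm pay t u) ?_ ?_ ?_ ht
    · refine ⟨fun s hs => absurd hs (Nat.not_lt_zero _), ?_⟩
      rintro u rfl ⟨p, hp, -⟩
      exact absurd hp.lt not_lt_bot
    · rintro t ht B ⟨ih1, ih2⟩ v hv hviol
      refine ⟨ih1, ?_⟩
      rintro u (⟨hu, -⟩ | hu) hoc
      · exact ih2 u hu hoc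
      · obtain ⟨p, hp, hc⟩ := id hoc
        have hvu : v ⋖ u := hu
        obtain rfl : v = p := le_antisymm (le_of_lt_of_covBy hvu.lt hp)
          (le_of_lt_of_covBy hp.lt hvu)
        exact violates_onlyChild hT hq hp hc
          (fun s hs e => ih1 s hs u (e ▸ R.sel_mem s (hs.trans ht)) hoc) hviol
    · rintro t ht ⟨ih1, ih2⟩
      have hno : ∀ u ∈ act t, ¬ OnlyChild u := fun u hu hoc =>
        R.invariant t (by omega) u hu (ih2 u hu hoc)
      refine ⟨fun s hs => ?_, fun u hu hoc => absurd hoc (hno u hu)⟩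
      rcases (Nat.lt_succ_iff.1 hs).lt_or_eq with h | rfl
      · exact ih1 s h
      · exact hno
  exact fun hoc => R.invariant t ht u hu (key.2 u hu hoc)

/-- An only child has the same statistics as its parent. -/
lemma IsRun.hitRounds_onlyChild (R : IsRun T qhat act sel arm pay) (hT : 2 ≤ T) (hq : 0 < qhat)
    {t : ℕ} (ht : t ≤ T) {p u : 𝒯} (hp : p ⋖ u) (hc : children p = {u}) :
    hitRounds sel arm t u = hitRounds sel arm t p :=
  Taxonomy.hitRounds_onlyChild hp hc fun s hs e =>
    R.not_onlyChild hT hq (hs.trans_le ht) (R.sel_mem s (hs.trans_le ht)) (e ▸ ⟨p, hp, hc⟩)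

end Runs

/-! ### Gap estimates on clean runs. -/

section CleanRuns

variable {𝒯 : RootedTree.{u}} [Fintype 𝒯]

/-- The estimates of a run are within the confidence radii, the samples come from the selected
subtrees, and the nodes which witness the quality of an active node are hit often enough. -/
structure IsClean (μ : Arm 𝒯 → ℝ) (T : ℕ) (qhat : ℝ) (act : ℕ → Set 𝒯) (sel : ℕ → 𝒯)
    (arm : ℕ → Arm 𝒯) (pay : ℕ → ℝ) : Prop where
  sel_le_arm : ∀ t < T, sel t ≤ (arm t).1
  mean : ∀ t < T, ∀ v, |avgPayoff sel arm pay t v - nodeMean μ v| ≤ confRad T sel arm t v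
  quality : ∀ t < T, ∀ v ∈ act t, (∃ x : Arm 𝒯, v ≤ x.1 ∧ μ x = bestMean μ) →
    ∃ u u', v ≤ u ∧ v ≤ u' ∧ weight μ v / 2 ≤ |nodeMean μ u - nodeMean μ u'| ∧
      (256 * Real.log T < qhat * (2 + ((hitRounds sel arm t v).card : ℝ)) →
        qhat / 2 * (2 + ((hitRounds sel arm t v).card : ℝ)) ≤
            2 + ((hitRounds sel arm t u).card : ℝ) ∧
          qhat / 2 * (2 + ((hitRounds sel arm t v).card : ℝ)) ≤
            2 + ((hitRounds sel arm t u').card : ℝ))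

variable {μ : Arm 𝒯 → ℝ} {T : ℕ} {qhat : ℝ} {act : ℕ → Set 𝒯} {sel : ℕ → 𝒯} {arm : ℕ → Arm 𝒯}
  {pay : ℕ → ℝ}

lemma weight_le_one (hμ : ∀ x, μ x ∈ Set.Icc (0 : ℝ) 1) (v : 𝒯) : weight μ v ≤ 1 :=
  weight_le μ fun x y _ _ => abs_sub_le_iff.2
    ⟨by linarith [(hμ x).2, (hμ y).1], by linarith [(hμ y).2, (hμ x).1]⟩

/-- An active node which contains an optimal arm has small weight. -/
lemma IsClean.weight_le (C : IsClean μ T qhat act sel arm pay) (R : IsRun T qhat act sel arm pay)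
    (hT : 2 ≤ T) (hq : 0 < qhat) (hμ : ∀ x, μ x ∈ Set.Icc (0 : ℝ) 1) {t : ℕ} (ht : t < T) {v : 𝒯}
    (hv : v ∈ act t) (hx : ∃ x : Arm 𝒯, v ≤ x.1 ∧ μ x = bestMean μ) :
    weight μ v ≤ 4 * kFactor qhat * confRad T sel arm t v := by
  have hL : 0 < Real.log T := Real.log_pos (by exact_mod_cast hT)
  have hk := kFactor_pos hq
  have hr := confRad_pos (sel := sel) (arm := arm) hT t v
  have hkr := mul_pos hk hr
  by_cases hmax : IsMax v
  · exact (weight_of_isMax μ hmax).trans (by positivity)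
  have hest : weightEst T sel arm pay t v < kFactor qhat * confRad T sel arm t v := by
    by_contra h
    exact R.invariant t ht v hv ⟨hmax, h⟩
  have hk2 := kFactor_sq hq
  have hr2 := confRad_sq (sel := sel) (arm := arm) hT t v
  obtain ⟨u, u', hu, hu', hw, hn⟩ := C.quality t ht v hv hx
  -- Since (k·rad)² = 256 log T / (qhat(2 + n)), few hits give k·rad ≥ 1 and the claim is trivial.
  -- Otherwise the witnesses have a share qhat/2 of the hits, and k²/16 = 2/qhat bounds their radii
  -- by (k/4)·rad.
  rcases le_or_gt (qhat * (2 + ((hitRounds sel arm t v).card : ℝ))) (256 * Real.log T) with h | h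
  · have h1 : 1 ≤ kFactor qhat * confRad T sel arm t v := by
      refine le_of_sq_le_sq (α := ℝ) ?_ hkr.le
      rw [mul_pow, hk2, hr2, div_mul_div_comm, one_pow, one_le_div (by positivity)]
      linarith
    linarith [weight_le_one hμ v]
  · have hsmall : ∀ z : 𝒯, qhat / 2 * (2 + ((hitRounds sel arm t v).card : ℝ)) ≤
        2 + ((hitRounds sel arm t z).card : ℝ) →
        confRad T sel arm t z ≤ kFactor qhat / 4 * confRad T sel arm t v := by
      intro z hz
      refine le_of_sq_le_sq (α := ℝ) ?_ (by positivity)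
      rw [mul_pow, div_pow, hk2, hr2, confRad_sq hT]
      calc 8 * Real.log T / (2 + ((hitRounds sel arm t z).card : ℝ))
          ≤ 8 * Real.log T / (qhat / 2 * (2 + ((hitRounds sel arm t v).card : ℝ))) := by gcongr
        _ = _ := by
          field_simp
          ring
    have h1 := hsmall u (hn h).1
    have h2 := hsmall u' (hn h).2
    have h3 := le_weightEst (T := T) (sel := sel) (arm := arm) (pay := pay) (t := t) hu hu'
    have h4 := C.mean t ht u
    have h5 := C.mean t ht u'
    have h6 : |nodeMean μ u - nodeMean μ u'| ≤
        |avgPayoff sel arm pay t u - nodeMean μ u| +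
        |avgPayoff sel arm pay t u - avgPayoff sel arm pay t u'| +
        |avgPayoff sel arm pay t u' - nodeMean μ u'| := by
      rw [abs_sub_comm (avgPayoff sel arm pay t u) (nodeMean μ u)]
      refine le_trans (le_of_eq ?_) ((abs_add_le _ _).trans (add_le_add_left (abs_add_le _ _) _))
      congr 1
      ring
    linarith

/-- Optimism: for an active node above an optimal arm, the bonus 4k·rad pays for the weight and one
further rad for the estimation error, so its index is at least μ*. The selected index is no smaller
and exceeds the selected mean by at most (2 + 4k)·rad. -/
lemma IsClean.gap_sel_le (C : IsClean μ T qhat act sel arm pay) (R : IsRun T qhat act sel arm pay)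
    (hT : 2 ≤ T) (hq : 0 < qhat) (hμ : ∀ x, μ x ∈ Set.Icc (0 : ℝ) 1) {t : ℕ} (ht : t < T) :
    bestMean μ - nodeMean μ (sel t) ≤ (2 + 4 * kFactor qhat) * confRad T sel arm t (sel t) := by
  obtain ⟨x, hx⟩ := exists_eq_bestMean μ
  obtain ⟨v, hv, hvx⟩ := R.exists_mem_le ht x
  have h1 := C.weight_le R hT hq hμ ht hv ⟨x, hvx, hx⟩
  have h2 := bestMean_le_nodeMean_add_weight ⟨x, hvx, hx⟩
  have h3 := (abs_le.1 (C.mean t ht v)).1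
  have h4 := (abs_le.1 (C.mean t ht (sel t))).2
  have h5 := R.sel_max t ht v hv
  rw [nodeIndex, nodeIndex] at h5
  linarith

/-- The gaps of the selected node and of the nodes in its subtree are controlled by the confidence
radii. -/
lemma IsClean.gap_le (C : IsClean μ T qhat act sel arm pay) (R : IsRun T qhat act sel arm pay)
    (hT : 2 ≤ T) (hq : 0 < qhat) (hμ : ∀ x, μ x ∈ Set.Icc (0 : ℝ) 1) {s : ℕ} (hs : s < T)
    {b : 𝒯} (hb : sel s ≤ b) :
    bestMean μ - nodeMean μ (sel s) ≤ (2 + 4 * kFactor qhat) * confRad T sel arm s b ∧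
    bestMean μ - nodeMean μ b ≤ (6 + 5 * kFactor qhat) * confRad T sel arm s b := by
  have hk := kFactor_pos hq
  have hrb := confRad_pos (sel := sel) (arm := arm) hT s b
  have hrad : confRad T sel arm s (sel s) ≤ confRad T sel arm s b :=
    confRad_le_of_card_le hT (Finset.card_le_card (R.hitRounds_subset hs hb))
  have h1 : bestMean μ - nodeMean μ (sel s) ≤ (2 + 4 * kFactor qhat) * confRad T sel arm s b :=
    (C.gap_sel_le R hT hq hμ hs).trans (by gcongr)
  refine ⟨h1, ?_⟩
  rcases hb.lt_or_eq with hlt | heq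
  -- By the invariant the means at `sel s` and `b` differ by at most k·rad plus two radii for each
  -- node, which turns 2 + 4k into 6 + 5k.
  · have hest : weightEst T sel arm pay s (sel s) <
        kFactor qhat * confRad T sel arm s (sel s) := by
      by_contra h
      exact R.invariant s hs _ (R.sel_mem s hs) ⟨not_isMax_iff.2 ⟨b, hlt⟩, h⟩
    have h3 := le_weightEst (T := T) (sel := sel) (arm := arm) (pay := pay) (t := s)
      (le_refl (sel s)) hb
    have h4 := (abs_le.1 (C.mean s hs (sel s))).1
    have h4' := (abs_le.1 (C.mean s hs (sel s))).2
    have h5 := (abs_le.1 (C.mean s hs b)).2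
    have h6 := le_abs_self (avgPayoff sel arm pay s (sel s) - avgPayoff sel arm pay s b)
    have h7 : kFactor qhat * confRad T sel arm s (sel s) ≤ kFactor qhat * confRad T sel arm s b :=
      by gcongr
    linarith
  · rw [← heq] at h1 ⊢
    have hr := confRad_pos (sel := sel) (arm := arm) hT s (sel s)
    have := mul_pos hk hr
    linarith

/-- Subtracting both radii compensates the estimation errors, so the estimate never exceeds the true
variation. -/
lemma IsClean.weightEst_le (C : IsClean μ T qhat act sel arm pay) {t : ℕ} (ht : t < T) (p : 𝒯) :
    weightEst T sel arm pay t p ≤ weight μ p := by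
  refine Taxonomy.weightEst_le (weight_nonneg μ p) fun u u' hu hu' => ?_
  have h1 := abs_nodeMean_sub_le_weight (μ := μ) hu hu'
  have h2 := C.mean t ht u
  have h3 := C.mean t ht u'
  have h4 : |avgPayoff sel arm pay t u - avgPayoff sel arm pay t u'| ≤
      |avgPayoff sel arm pay t u - nodeMean μ u| + |nodeMean μ u - nodeMean μ u'| +
      |avgPayoff sel arm pay t u' - nodeMean μ u'| := by
    rw [abs_sub_comm (avgPayoff sel arm pay t u') (nodeMean μ u')]
    refine le_trans (le_of_eq ?_) ((abs_add_le _ _).trans (add_le_add_left (abs_add_le _ _) _))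
    congr 1
    ring
  linarith

/-- All nodes below a deactivated node have a gap comparable to its weight. -/
lemma IsClean.gap_le_weight (C : IsClean μ T qhat act sel arm pay)
    (R : IsRun T qhat act sel arm pay) (hT : 2 ≤ T) (hq : 0 < qhat) (hq1 : qhat ≤ 1)
    (hμ : ∀ x, μ x ∈ Set.Icc (0 : ℝ) 1) {t : ℕ} (ht : t < T) {p b : 𝒯}
    (hp : Violates T qhat sel arm pay t p) (hb : p ≤ b) :
    bestMean μ - nodeMean μ b ≤ 37 / 5 * weight μ p := by
  have hL : 0 < Real.log T := Real.log_pos (by exact_mod_cast hT)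
  have hL' : 0.69 < Real.log T := by
    have h2 : Real.log 2 ≤ Real.log T := Real.log_le_log (by norm_num) (by exact_mod_cast hT)
    linarith [Real.log_two_gt_d9]
  have hk := kFactor_pos hq
  have hk5 := le_kFactor hq hq1
  have hr := confRad_pos (sel := sel) (arm := arm) hT t p
  have hkr := mul_pos hk hr
  have hwk : kFactor qhat * confRad T sel arm t p ≤ weight μ p :=
    (not_lt.1 hp.2).trans (C.weightEst_le ht p)
  have hr2 := confRad_sq (sel := sel) (arm := arm) hT t p
  -- From k·rad ≤ weight ≤ 1 follows 256 log T ≤ qhat(2 + n), and 256 · 0.69 > 176.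
  have hn : (176 : ℝ) ≤ 2 + ((hitRounds sel arm t p).card : ℝ) := by
    have h1 : (kFactor qhat * confRad T sel arm t p) ^ 2 ≤ 1 :=
      pow_le_one₀ hkr.le (hwk.trans (weight_le_one hμ p))
    rw [mul_pow, kFactor_sq hq, hr2, div_mul_div_comm, div_le_one (by positivity)] at h1
    have h2 : qhat * (2 + ((hitRounds sel arm t p).card : ℝ)) ≤
        1 * (2 + ((hitRounds sel arm t p).card : ℝ)) := by gcongr
    linarith
  have hcard : 0 < (hitRounds sel arm t p).card := by
    by_contra h
    have h0 : (hitRounds sel arm t p).card = 0 := by omega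
    rw [h0] at hn
    norm_num at hn
  -- At the last hit of `p` before `t` the selected node was `p` or an ancestor, so `gap_le` applies
  -- at `p`. Only one hit is missing there, which enlarges the radius by a factor of at most 21/20.
  obtain ⟨s, hs, hsmax⟩ := (hitRounds sel arm t p).exists_max_image id (Finset.card_pos.1 hcard)
  have hs' := mem_hitRounds.1 hs
  have herase : hitRounds sel arm s p = (hitRounds sel arm t p).erase s := by
    ext r
    rw [Finset.mem_erase, mem_hitRounds]
    constructor
    · rintro ⟨h1, h2⟩
      exact ⟨h1.ne, mem_hitRounds.2 ⟨h1.trans hs'.1, h2⟩⟩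
    · rintro ⟨h1, h2⟩
      exact ⟨lt_of_le_of_ne (hsmax r h2) h1, (mem_hitRounds.1 h2).2⟩
  have hcs : ((hitRounds sel arm s p).card : ℝ) = (hitRounds sel arm t p).card - 1 := by
    rw [herase, Finset.card_erase_of_mem hs, Nat.cast_sub hcard, Nat.cast_one]
  have hrs : confRad T sel arm s p ≤ 21 / 20 * confRad T sel arm t p := by
    refine le_of_sq_le_sq (α := ℝ) ?_ (by positivity)
    rw [mul_pow, hr2, confRad_sq hT, hcs, ← mul_div_assoc,
      div_le_div_iff₀ (by linarith) (by linarith)]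
    nlinarith
  have hgap := (C.gap_le R hT hq hμ (hs'.1.trans ht) hs'.2.1).2
  have hpb := nodeMean_sub_le_weight (μ := μ) (le_refl p) hb
  -- Here 6 ≤ (15/14)k is used. Then (85/14)(21/20) = 51/8, and one more weight for passing from `p`
  -- to `b` gives 59/8 ≤ 37/5.
  have h6 : (6 + 5 * kFactor qhat) * confRad T sel arm s p ≤
      (85 / 14 * kFactor qhat) * (21 / 20 * confRad T sel arm t p) := by
    gcongr
    · exact (confRad_pos hT _ _).le
    · linarith
  linarith

end CleanRuns

/-! ### Charging the costly rounds to the frontier. -/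

section Cost

/-- The sum of the inverse square roots of the ranks of the elements of a finite set. -/
lemma sum_inv_sqrt_rank_le (R : Finset ℕ) :
    ∑ s ∈ R, (Real.sqrt (1 + ((R.filter (· < s)).card : ℝ)))⁻¹ ≤ 2 * Real.sqrt (R.card : ℝ) := by
  induction R using Finset.induction_on_max with
  | empty => simp
  | insert a R ha ih =>
    have hnot : a ∉ R := fun h => (ha a h).false
    rw [Finset.sum_insert hnot, Finset.card_insert_of_notMem hnot]
    have h1 : (insert a R).filter (· < a) = R := by
      ext s
      simp only [Finset.mem_filter, Finset.mem_insert]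
      constructor
      · rintro ⟨rfl | h, h'⟩
        · exact absurd h' (lt_irrefl _)
        · exact h
      · exact fun h => ⟨Or.inr h, ha s h⟩
    have h2 : ∀ s ∈ R, (insert a R).filter (· < s) = R.filter (· < s) := by
      intro s hs
      rw [Finset.filter_insert, if_neg (ha s hs).not_gt]
    rw [h1, Finset.sum_congr rfl fun s hs => by rw [h2 s hs]]
    push_cast
    set n : ℝ := (R.card : ℝ)
    have hn : 0 ≤ n := Nat.cast_nonneg _
    have hx : 0 < Real.sqrt (1 + n) := Real.sqrt_pos.2 (by linarith)
    have hkey : (Real.sqrt (1 + n))⁻¹ ≤ 2 * (Real.sqrt (1 + n) - Real.sqrt n) := by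
      rw [inv_le_iff_one_le_mul₀ hx]
      nlinarith [Real.sq_sqrt hn, Real.sq_sqrt (show 0 ≤ 1 + n by linarith),
        sq_nonneg (Real.sqrt (1 + n) - Real.sqrt n)]
    rw [add_comm n 1]
    linarith

/-- The last scale j = J collects all small values, for which no lower bound is claimed. -/
lemma exists_scale (J : ℕ) {x r : ℝ} (hx : x ≤ 1) :
    ∃ j ≤ J, x ≤ r ^ j ∧ (j = J ∨ r * r ^ j < x) := by
  induction J with
  | zero => exact ⟨0, le_rfl, by simpa using hx, Or.inl rfl⟩
  | succ J ih =>
    obtain ⟨j, hj, hxj, h⟩ := ih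
    rcases lt_or_ge (r * r ^ j) x with h' | h'
    · exact ⟨j, by omega, hxj, Or.inr h'⟩
    · rcases h with rfl | h
      · exact ⟨j + 1, le_rfl, by rw [pow_succ']; exact h', Or.inl rfl⟩
      · exact absurd h h'.not_gt

variable {𝒯 : RootedTree.{u}} [Fintype 𝒯]

/-- The highest nodes that have weight at most `δ / 8` or are never deactivated. -/
noncomputable def frontier (μ : Arm 𝒯 → ℝ) (T : ℕ) (qhat : ℝ) (sel : ℕ → 𝒯) (arm : ℕ → Arm 𝒯) (pay : ℕ → ℝ)
    (δ : ℝ) : Finset 𝒯 :=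
  Finset.univ.filter fun w =>
    (weight μ w ≤ δ / 8 ∨ ∀ t < T, ¬ Violates T qhat sel arm pay t w) ∧
    ∀ p < w, δ / 8 < weight μ p ∧ ∃ t < T, Violates T qhat sel arm pay t p

variable {μ : Arm 𝒯 → ℝ} {T : ℕ} {qhat : ℝ} {act : ℕ → Set 𝒯} {sel : ℕ → 𝒯} {arm : ℕ → Arm 𝒯}
  {pay : ℕ → ℝ}

lemma mem_frontier {δ : ℝ} {w : 𝒯} : w ∈ frontier μ T qhat sel arm pay δ ↔
    (weight μ w ≤ δ / 8 ∨ ∀ t < T, ¬ Violates T qhat sel arm pay t w) ∧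
    ∀ p < w, δ / 8 < weight μ p ∧ ∃ t < T, Violates T qhat sel arm pay t p := by
  simp only [frontier, Finset.mem_filter, Finset.mem_univ, true_and]

lemma frontier_antichain {δ : ℝ} {a b : 𝒯} (ha : a ∈ frontier μ T qhat sel arm pay δ)
    (hb : b ∈ frontier μ T qhat sel arm pay δ) : ¬ a < b := by
  intro h
  obtain ⟨h1, t, ht, h2⟩ := (mem_frontier.1 hb).2 a h
  rcases (mem_frontier.1 ha).1 with h3 | h3
  · exact h1.not_ge h3
  · exact h3 t ht h2

/-- Leaves are never deactivated, so some node on the path to `x` is light or never deactivated; the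
highest such node is in the frontier. -/
lemma exists_mem_frontier_le (δ : ℝ) (x : Arm 𝒯) :
    ∃ b ∈ frontier μ T qhat sel arm pay δ, b ≤ x.1 := by
  obtain ⟨b, hb, hmin⟩ := (Finset.univ.filter fun w : 𝒯 => w ≤ x.1 ∧
    (weight μ w ≤ δ / 8 ∨ ∀ t < T, ¬ Violates T qhat sel arm pay t w)).exists_minimal
    ⟨x.1, by simpa using Or.inr fun t _ h => h.1 x.2⟩
  simp only [Finset.mem_filter, Finset.mem_univ, true_and] at hb hmin
  refine ⟨b, mem_frontier.2 ⟨hb.2, fun p hp => ?_⟩, hb.1⟩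
  by_contra hcon
  refine hp.not_ge (hmin ⟨hp.le.trans hb.1, ?_⟩ hp.le)
  by_contra hcon'
  push Not at hcon'
  exact hcon hcon'

/-- The rounds with gap larger than `δ` which hit the node `b`. -/
noncomputable def costlyRounds (μ : Arm 𝒯 → ℝ) (T : ℕ) (sel : ℕ → 𝒯) (arm : ℕ → Arm 𝒯) (δ : ℝ) (b : 𝒯) :
    Finset ℕ :=
  (hitRounds sel arm T b).filter fun s => δ < bestMean μ - nodeMean μ (sel s)

/-- A frontier node strictly above the selected one would have been deactivated, hence be light, and
the gap would be at most (37/5)(δ/8) < δ. -/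
lemma IsClean.exists_mem_costlyRounds (C : IsClean μ T qhat act sel arm pay)
    (R : IsRun T qhat act sel arm pay) (hT : 2 ≤ T) (hq : 0 < qhat) (hq1 : qhat ≤ 1)
    (hμ : ∀ x, μ x ∈ Set.Icc (0 : ℝ) 1) {δ : ℝ} (hδ : 0 < δ) {s : ℕ} (hs : s < T)
    (hgap : δ < bestMean μ - nodeMean μ (sel s)) :
    ∃ b ∈ frontier μ T qhat sel arm pay δ, s ∈ costlyRounds μ T sel arm δ b := by
  obtain ⟨b, hb, hbx⟩ := exists_mem_frontier_le (μ := μ) (T := T) (qhat := qhat) (sel := sel)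
    (arm := arm) (pay := pay) δ (arm s)
  refine ⟨b, hb, Finset.mem_filter.2 ⟨mem_hitRounds.2 ⟨hs, ?_, hbx⟩, hgap⟩⟩
  by_contra hnot
  have hlt : b < sel s := by
    rcases le_or_le_of_le hbx (C.sel_le_arm s hs) with h | h
    · exact lt_of_le_of_ne h fun e => hnot e.ge
    · exact absurd h hnot
  obtain ⟨t, ht, hviol⟩ := R.exists_violates hs (R.sel_mem s hs) hlt
  have h1 := C.gap_le_weight R hT hq hq1 hμ ht hviol hlt.le
  rcases (mem_frontier.1 hb).1 with h | h
  · linarith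
  · exact h t ht hviol

/-- The total gap of the costly rounds that hit a given node. -/
lemma IsClean.sum_costlyRounds_le (C : IsClean μ T qhat act sel arm pay)
    (R : IsRun T qhat act sel arm pay) (hT : 2 ≤ T) (hq : 0 < qhat) (hq1 : qhat ≤ 1)
    (hμ : ∀ x, μ x ∈ Set.Icc (0 : ℝ) 1) {δ : ℝ} (hδ : 0 < δ) (b : 𝒯) :
    ∑ s ∈ costlyRounds μ T sel arm δ b, (bestMean μ - nodeMean μ (sel s)) ≤
      2 * (12544 * Real.log T / qhat) / max δ (bestMean μ - nodeMean μ b) := by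
  set Q := costlyRounds μ T sel arm δ b with hQ
  -- This is (7k)² · 8 log T with k² = 32/qhat, so that 7k·rad = √K / √(2 + n).
  set K := 12544 * Real.log T / qhat with hK
  set m := max δ (bestMean μ - nodeMean μ b) with hm
  have hL : 0 < Real.log T := Real.log_pos (by exact_mod_cast hT)
  have hKpos : 0 < K := by positivity
  have hmpos : 0 < m := hδ.trans_le (le_max_left _ _)
  have hk := kFactor_pos hq
  have hk5 := le_kFactor hq hq1
  have hmem : ∀ s ∈ Q, s < T ∧ sel s ≤ b ∧ b ≤ (arm s).1 ∧
      δ < bestMean μ - nodeMean μ (sel s) := by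
    intro s hs
    rw [hQ, costlyRounds, Finset.mem_filter, mem_hitRounds] at hs
    exact ⟨hs.1.1, hs.1.2.1, hs.1.2.2, hs.2⟩
  have hrank : ∀ s ∈ Q, ((Q.filter (· < s)).card : ℝ) ≤ ((hitRounds sel arm s b).card : ℝ) := by
    intro s _
    refine Nat.cast_le.2 (Finset.card_le_card fun r hr => ?_)
    obtain ⟨hr1, hr2⟩ := Finset.mem_filter.1 hr
    have := hmem r hr1
    exact mem_hitRounds.2 ⟨hr2, this.2.1, this.2.2.1⟩
  have hrad : ∀ s, 7 * kFactor qhat * confRad T sel arm s b =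
      Real.sqrt K * (Real.sqrt (2 + ((hitRounds sel arm s b).card : ℝ)))⁻¹ := by
    intro s
    have hpos := confRad_pos (sel := sel) (arm := arm) hT s b
    rw [← Real.sqrt_inv, ← Real.sqrt_mul hKpos.le]
    rw [← Real.sqrt_sq (show 0 ≤ 7 * kFactor qhat * confRad T sel arm s b by positivity)]
    congr 1
    rw [mul_pow, mul_pow, kFactor_sq hq, confRad_sq hT, hK]
    field_simp
    ring
  have hgap : ∀ s ∈ Q, bestMean μ - nodeMean μ (sel s) ≤ 7 * kFactor qhat * confRad T sel arm s b ∧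
      m ≤ 7 * kFactor qhat * confRad T sel arm s b := by
    intro s hs
    obtain ⟨h1, h2, -, h4⟩ := hmem s hs
    obtain ⟨h5, h6⟩ := C.gap_le R hT hq hμ h1 h2
    have hpos := confRad_pos (sel := sel) (arm := arm) hT s b
    have h7 : (2 + 4 * kFactor qhat) * confRad T sel arm s b ≤
        7 * kFactor qhat * confRad T sel arm s b := by
      gcongr
      linarith
    have h8 : (6 + 5 * kFactor qhat) * confRad T sel arm s b ≤
        7 * kFactor qhat * confRad T sel arm s b := by
      gcongr
      linarith
    exact ⟨h5.trans h7, max_le (by linarith) (h6.trans h8)⟩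
  have hsum : ∑ s ∈ Q, (bestMean μ - nodeMean μ (sel s)) ≤
      Real.sqrt K * (2 * Real.sqrt (Q.card : ℝ)) := by
    refine le_trans ?_ (mul_le_mul_of_nonneg_left (sum_inv_sqrt_rank_le Q) (Real.sqrt_nonneg K))
    rw [Finset.mul_sum]
    refine Finset.sum_le_sum fun s hs => (hgap s hs).1.trans ?_
    rw [hrad s]
    have := hrank s hs
    gcongr
    linarith
  -- Even at the last costly round m ≤ √K / √(2 + n), and n is at least the number of earlier costly
  -- rounds.
  have hcard : Real.sqrt (Q.card : ℝ) ≤ Real.sqrt K / m := by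
    rcases Q.eq_empty_or_nonempty with h | h
    · rw [h, Finset.card_empty, Nat.cast_zero, Real.sqrt_zero]
      positivity
    · obtain ⟨s, hs, hsmax⟩ := Q.exists_max_image id h
      have h1 := (hgap s hs).2
      rw [hrad s, ← div_eq_mul_inv, le_div_iff₀ (Real.sqrt_pos.2 (by positivity))] at h1
      rw [le_div_iff₀ hmpos, mul_comm]
      refine le_trans ?_ h1
      have h2 : Q.erase s ⊆ Q.filter (· < s) := by
        intro r hr
        obtain ⟨hr1, hr2⟩ := Finset.mem_erase.1 hr
        exact Finset.mem_filter.2 ⟨hr2, lt_of_le_of_ne (hsmax r hr2) hr1⟩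
      have h3 := Finset.card_le_card h2
      rw [Finset.card_erase_of_mem hs] at h3
      have h4 : (Q.card : ℝ) ≤ (Q.filter (· < s)).card + 1 := by
        exact_mod_cast (by omega : Q.card ≤ (Q.filter (· < s)).card + 1)
      have := hrank s hs
      gcongr
      linarith
  calc _ ≤ Real.sqrt K * (2 * Real.sqrt (Q.card : ℝ)) := hsum
    _ ≤ Real.sqrt K * (2 * (Real.sqrt K / m)) := by gcongr
    _ = 2 * (Real.sqrt K * Real.sqrt K) / m := by ring
    _ = _ := by rw [Real.mul_self_sqrt hKpos.le]

/-- The frontier has few nodes of a given gap. -/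
lemma IsClean.card_frontier_le (C : IsClean μ T qhat act sel arm pay)
    (R : IsRun T qhat act sel arm pay) (hT : 2 ≤ T) (hq : 0 < qhat) (hq1 : qhat ≤ 1)
    (hμ : ∀ x, μ x ∈ Set.Icc (0 : ℝ) 1) {c d : ℝ} (hcov : ZoomingCover μ c d) {δ₀ δ : ℝ}
    (hδ : 0 < δ) (hδ1 : δ ≤ 1) :
    ((((frontier μ T qhat sel arm pay δ₀).filter fun b => bestMean μ - nodeMean μ b ≤ δ ∧
      (δ ≤ δ₀ ∨ 15 / 16 * δ < bestMean μ - nodeMean μ b)).card : ℕ) : ℝ) ≤ c * δ ^ (-d) := by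
  obtain ⟨S, hS, hw, hS'⟩ := hcov δ hδ hδ1
  refine le_trans (Nat.cast_le.2 ?_) hS
  -- An arm below `b` that is at least as good as its mean lies under some cover member `z`. If `z`
  -- were strictly above `b`, it would be deactivated with δ₀/8 < weight ≤ δ/8: impossible when δ ≤
  -- δ₀, and otherwise the gap of `b` would be at most (37/40)δ < (15/16)δ. So `z` lies below `b`,
  -- and distinct frontier nodes have disjoint subtrees.
  have hex : ∀ b ∈ (frontier μ T qhat sel arm pay δ₀).filter fun b =>
      bestMean μ - nodeMean μ b ≤ δ ∧ (δ ≤ δ₀ ∨ 15 / 16 * δ < bestMean μ - nodeMean μ b),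
      ∃ z ∈ S, b ≤ z := by
    intro b hb
    obtain ⟨hb1, hb2, hb3⟩ := Finset.mem_filter.1 hb
    obtain ⟨x, hx, hxm⟩ := exists_arm_nodeMean_le (μ := μ) b
    obtain ⟨z, hz, hzx⟩ := hS' x (by linarith)
    refine ⟨z, hz, ?_⟩
    by_contra hnot
    have hlt : z < b := by
      rcases le_or_le_of_le hzx hx with h | h
      · exact lt_of_le_of_ne h fun e => hnot e.ge
      · exact absurd h hnot
    obtain ⟨h1, t, ht, h2⟩ := (mem_frontier.1 hb1).2 z hlt
    have h3 := C.gap_le_weight R hT hq hq1 hμ ht h2 hlt.le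
    have h4 := hw z hz
    rcases hb3 with h | h <;> linarith
  choose! f hf hle using hex
  refine Finset.card_le_card_of_injOn f hf ?_
  intro a ha b hb hab
  have ha' := (Finset.mem_filter.1 ha).1
  have hb' := (Finset.mem_filter.1 hb).1
  rcases le_or_le_of_le (hle a ha) (hab ▸ hle b hb) with h | h
  · exact h.eq_of_not_lt (frontier_antichain ha' hb')
  · exact (h.eq_of_not_lt (frontier_antichain hb' ha')).symm

/-- The frontier is sorted by gap into the scales (15/16)^j. The count at each scale is bounded by
that of the finest scale, and the inverse scales form a geometric series. -/
lemma IsClean.sum_frontier_le (C : IsClean μ T qhat act sel arm pay)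
    (R : IsRun T qhat act sel arm pay) (hT : 2 ≤ T) (hq : 0 < qhat) (hq1 : qhat ≤ 1)
    (hμ : ∀ x, μ x ∈ Set.Icc (0 : ℝ) 1) {c d : ℝ} (hcov : ZoomingCover μ c d) (J : ℕ) :
    ∑ b ∈ frontier μ T qhat sel arm pay ((15 / 16 : ℝ) ^ J),
      (max ((15 / 16 : ℝ) ^ J) (bestMean μ - nodeMean μ b))⁻¹ ≤
      18 * c * ((15 / 16 : ℝ) ^ J) ^ (-d) / (15 / 16 : ℝ) ^ J := by
  set r : ℝ := 15 / 16 with hr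
  have hrpos : 0 < r := by norm_num [hr]
  have hr1 : r ≤ 1 := by norm_num [hr]
  have hc := one_le_const_of_zoomingCover hcov
  have hd := dim_nonneg_of_zoomingCover hcov
  set Z := frontier μ T qhat sel arm pay (r ^ J) with hZ
  have hpart : ∀ b ∈ Z, (max (r ^ J) (bestMean μ - nodeMean μ b))⁻¹ ≤
      ∑ j ∈ Finset.range (J + 1), if bestMean μ - nodeMean μ b ≤ r ^ j ∧
        (r ^ j ≤ r ^ J ∨ 15 / 16 * r ^ j < bestMean μ - nodeMean μ b) then (r * r ^ j)⁻¹ else 0 := by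
    intro b _
    have hle1 : bestMean μ - nodeMean μ b ≤ 1 := by
      obtain ⟨x, hx⟩ := exists_eq_bestMean μ
      have h1 := (hμ x).2
      have h2 : 0 ≤ nodeMean μ b := le_nodeMean fun x _ => (hμ x).1
      linarith
    obtain ⟨j, hj, h1, h2⟩ := exists_scale (r := r) J hle1
    have hmem : j ∈ Finset.range (J + 1) := Finset.mem_range.2 (by omega)
    refine le_trans ?_ (Finset.single_le_sum (fun i _ => ?_) hmem)
    · rw [if_pos ⟨h1, h2.imp (fun e => by rw [e]) (fun h => h)⟩]
      refine inv_anti₀ (by positivity) ?_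
      rcases h2 with rfl | h2
      · refine le_trans ?_ (le_max_left _ _)
        have : 0 < r ^ j := by positivity
        nlinarith
      · exact h2.le.trans (le_max_right _ _)
    · split_ifs
      · positivity
      · exact le_rfl
  have hscale : ∀ j ∈ Finset.range (J + 1),
      (∑ b ∈ Z, if bestMean μ - nodeMean μ b ≤ r ^ j ∧
        (r ^ j ≤ r ^ J ∨ 15 / 16 * r ^ j < bestMean μ - nodeMean μ b) then (r * r ^ j)⁻¹ else 0) ≤
      c * (r ^ J) ^ (-d) * (r * r ^ j)⁻¹ := by
    intro j hj
    rw [← Finset.sum_filter, Finset.sum_const, nsmul_eq_mul]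
    refine mul_le_mul_of_nonneg_right ?_ (by positivity)
    refine (C.card_frontier_le R hT hq hq1 hμ hcov (by positivity)
      (pow_le_one₀ hrpos.le hr1)).trans ?_
    refine mul_le_mul_of_nonneg_left ?_ (by linarith)
    refine Real.rpow_le_rpow_of_nonpos (by positivity) ?_ (by linarith)
    exact pow_le_pow_of_le_one hrpos.le hr1 (by have := Finset.mem_range.1 hj; omega)
  -- The constant 18 works because 18 · (15/16) + 16/15 ≤ 18.
  have hgeom : ∀ J : ℕ, ∑ j ∈ Finset.range (J + 1), (r * r ^ j)⁻¹ ≤ 18 / r ^ J := by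
    intro J
    induction J with
    | zero =>
      norm_num [hr]
    | succ J ih =>
      rw [Finset.sum_range_succ]
      have h1 : 0 < r ^ J := by positivity
      calc _ ≤ 18 / r ^ J + (r * r ^ (J + 1))⁻¹ := by gcongr
        _ = (18 * r + r⁻¹) / r ^ (J + 1) := by
          rw [pow_succ]
          field_simp
        _ ≤ 18 / r ^ (J + 1) := by
          gcongr
          norm_num [hr]
  calc _ ≤ ∑ b ∈ Z, ∑ j ∈ Finset.range (J + 1), (if bestMean μ - nodeMean μ b ≤ r ^ j ∧
        (r ^ j ≤ r ^ J ∨ 15 / 16 * r ^ j < bestMean μ - nodeMean μ b) then (r * r ^ j)⁻¹ else 0) :=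
        Finset.sum_le_sum hpart
    _ ≤ ∑ j ∈ Finset.range (J + 1), c * (r ^ J) ^ (-d) * (r * r ^ j)⁻¹ := by
        rw [Finset.sum_comm]
        exact Finset.sum_le_sum hscale
    _ ≤ c * (r ^ J) ^ (-d) * (18 / r ^ J) := by
        rw [← Finset.mul_sum]
        exact mul_le_mul_of_nonneg_left (hgeom J) (by positivity)
    _ = _ := by ring

/-- The total gap of the nodes selected in a clean run. -/
lemma IsClean.sum_gap_le (C : IsClean μ T qhat act sel arm pay)
    (R : IsRun T qhat act sel arm pay) (hT : 2 ≤ T) (hq : 0 < qhat) (hq1 : qhat ≤ 1)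
    (hμ : ∀ x, μ x ∈ Set.Icc (0 : ℝ) 1) {c d : ℝ} (hcov : ZoomingCover μ c d) (J : ℕ) :
    ∑ s ∈ Finset.range T, (bestMean μ - nodeMean μ (sel s)) ≤
      (15 / 16 : ℝ) ^ J * T + 2 * (12544 * Real.log T / qhat) *
        (18 * c * ((15 / 16 : ℝ) ^ J) ^ (-d) / (15 / 16 : ℝ) ^ J) := by
  set δ : ℝ := (15 / 16 : ℝ) ^ J with hδ
  have hδpos : 0 < δ := by positivity
  have hL : 0 < Real.log T := Real.log_pos (by exact_mod_cast hT)
  set Z := frontier μ T qhat sel arm pay δ with hZ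
  have hnn : ∀ v : 𝒯, 0 ≤ bestMean μ - nodeMean μ v := fun v =>
    sub_nonneg.2 (nodeMean_le_bestMean v)
  have hpt : ∀ s ∈ Finset.range T, bestMean μ - nodeMean μ (sel s) ≤ δ +
      ∑ b ∈ Z, if s ∈ costlyRounds μ T sel arm δ b then bestMean μ - nodeMean μ (sel s) else 0 := by
    intro s hs
    have hsum : ∀ b ∈ Z, (0 : ℝ) ≤ if s ∈ costlyRounds μ T sel arm δ b then
        bestMean μ - nodeMean μ (sel s) else 0 := by
      intro b _
      split_ifs
      · exact hnn _
      · exact le_rfl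
    rcases le_or_gt (bestMean μ - nodeMean μ (sel s)) δ with h | h
    · linarith [Finset.sum_nonneg hsum]
    · obtain ⟨b, hb, hsb⟩ := C.exists_mem_costlyRounds R hT hq hq1 hμ hδpos
        (Finset.mem_range.1 hs) h
      have := Finset.single_le_sum hsum hb
      rw [if_pos hsb] at this
      linarith
  calc _ ≤ ∑ s ∈ Finset.range T, (δ + ∑ b ∈ Z, if s ∈ costlyRounds μ T sel arm δ b then
        bestMean μ - nodeMean μ (sel s) else 0) := Finset.sum_le_sum hpt
    _ = δ * T + ∑ b ∈ Z, ∑ s ∈ costlyRounds μ T sel arm δ b,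
        (bestMean μ - nodeMean μ (sel s)) := by
      rw [Finset.sum_add_distrib, Finset.sum_const, Finset.card_range, nsmul_eq_mul, mul_comm,
        Finset.sum_comm]
      congr 1
      refine Finset.sum_congr rfl fun b _ => ?_
      rw [← Finset.sum_filter]
      refine Finset.sum_congr ?_ fun _ _ => rfl
      ext s
      simp only [costlyRounds, Finset.mem_filter, Finset.mem_range, mem_hitRounds]
      tauto
    _ ≤ δ * T + ∑ b ∈ Z, 2 * (12544 * Real.log T / qhat) *
        (max δ (bestMean μ - nodeMean μ b))⁻¹ := by
      gcongr with b hb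
      rw [← div_eq_mul_inv]
      exact C.sum_costlyRounds_le R hT hq hq1 hμ hδpos b
    _ ≤ _ := by
      rw [← Finset.mul_sum]
      gcongr
      exact C.sum_frontier_le R hT hq hq1 hμ hcov J

end Cost

/-! ### Random samples and products over the hits of a node. -/

namespace Execution

variable {𝒯 : RootedTree.{u}} [Fintype 𝒯] {Pay : Measure (Arm 𝒯 → ℝ)} {T : ℕ} {qhat : ℝ}
  {Ω : Type w} [mΩ : MeasurableSpace Ω] {P : Measure Ω} (E : Execution 𝒯 Pay T qhat P)

/-- The payoff received in round `t`. -/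
def pay (t : ℕ) (ω : Ω) : ℝ := E.payFun t ω (E.arm t ω)

/-- The event that the node `v` is hit in round `t`. -/
def hit (t : ℕ) (v : 𝒯) : Set Ω := {ω | E.sel t ω ≤ v ∧ v ≤ (E.arm t ω).1}

/-- The rounds before round `t` in which the node `v` is hit. -/
noncomputable def hits (t : ℕ) (v : 𝒯) (ω : Ω) : Finset ℕ :=
  hitRounds (fun s => E.sel s ω) (fun s => E.arm s ω) t v

lemma mem_hits {t s : ℕ} {v : 𝒯} {ω : Ω} : s ∈ E.hits t v ω ↔ s < t ∧ ω ∈ E.hit s v :=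
  mem_hitRounds

lemma hits_succ_of_mem {t : ℕ} {v : 𝒯} {ω : Ω} (h : ω ∈ E.hit t v) :
    E.hits (t + 1) v ω = insert t (E.hits t v ω) := by
  ext s
  rw [Finset.mem_insert, mem_hits, mem_hits, Nat.lt_succ_iff_lt_or_eq]
  constructor
  · rintro ⟨h1 | h1, h2⟩
    · exact Or.inr ⟨h1, h2⟩
    · exact Or.inl h1
  · rintro (rfl | ⟨h1, h2⟩)
    · exact ⟨Or.inr rfl, h⟩
    · exact ⟨Or.inl h1, h2⟩

lemma hits_succ_of_notMem {t : ℕ} {v : 𝒯} {ω : Ω} (h : ω ∉ E.hit t v) :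
    E.hits (t + 1) v ω = E.hits t v ω := by
  ext s
  rw [mem_hits, mem_hits, Nat.lt_succ_iff_lt_or_eq]
  constructor
  · rintro ⟨h1 | h1, h2⟩
    · exact ⟨h1, h2⟩
    · exact absurd (h1 ▸ h2) h
  · rintro ⟨h1, h2⟩
    exact ⟨Or.inl h1, h2⟩

lemma notMem_hits (t : ℕ) (v : 𝒯) (ω : Ω) : t ∉ E.hits t v ω := fun h =>
  lt_irrefl _ (E.mem_hits.1 h).1

lemma hits_mono {s t : ℕ} (h : s ≤ t) (v : 𝒯) (ω : Ω) : E.hits s v ω ⊆ E.hits t v ω := by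
  intro r hr
  rw [mem_hits] at hr ⊢
  exact ⟨hr.1.trans_le h, hr.2⟩

lemma measurableSet_sel {t : ℕ} (ht : t < T) (v : 𝒯) : MeasurableSet {ω | E.sel t ω = v} :=
  E.ℱ.le t _ (E.measurable_sel t ht v)

lemma measurableSet_arm {t : ℕ} (ht : t < T) (x : Arm 𝒯) : MeasurableSet {ω | E.arm t ω = x} :=
  E.ℱ.le (t + 1) _ (E.measurable_arm t ht x)

lemma hit_eq_biUnion (t : ℕ) (v : 𝒯) :
    E.hit t v = ⋃ p ∈ Finset.univ.filter (fun p : 𝒯 × Arm 𝒯 => p.1 ≤ v ∧ v ≤ p.2.1),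
      ({ω | E.sel t ω = p.1} ∩ {ω | E.arm t ω = p.2}) := by
  ext ω
  simp only [hit, Set.mem_ofPred_eq, Finset.mem_filter, Finset.mem_univ, true_and, Set.mem_iUnion,
    Set.mem_inter_iff, exists_prop, Prod.exists]
  constructor
  · exact fun h => ⟨_, _, h, rfl, rfl⟩
  · rintro ⟨a, x, h, rfl, rfl⟩
    exact h

lemma measurableSet_hit_filtration {t : ℕ} (ht : t < T) (v : 𝒯) :
    MeasurableSet[E.ℱ (t + 1)] (E.hit t v) := by
  rw [hit_eq_biUnion]
  refine Finset.measurableSet_biUnion _ fun p _ => ?_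
  exact (E.ℱ.mono (Nat.le_succ t) _ (E.measurable_sel t ht p.1)).inter
    (E.measurable_arm t ht p.2)

lemma measurableSet_hit {t : ℕ} (ht : t < T) (v : 𝒯) : MeasurableSet (E.hit t v) :=
  E.ℱ.le (t + 1) _ (E.measurableSet_hit_filtration ht v)

lemma measurable_comp_arm_pay {t : ℕ} (ht : t < T) {φ : Arm 𝒯 → ℝ → ℝ≥0∞}
    (hφ : ∀ x, Measurable (φ x)) :
    Measurable[E.ℱ (t + 1)] (fun ω => φ (E.arm t ω) (E.pay t ω)) := by
  have h : (fun ω => φ (E.arm t ω) (E.pay t ω)) =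
      fun ω => ∑ x : Arm 𝒯, {ω | E.arm t ω = x}.indicator (fun ω => φ x (E.pay t ω)) ω := by
    ext ω
    rw [Finset.sum_eq_single (E.arm t ω)]
    · simp
    · intro x _ hx
      exact Set.indicator_of_notMem (fun h => hx h.symm) _
    · exact fun h => absurd (Finset.mem_univ _) h
  rw [h]
  refine Finset.measurable_sum _ fun x _ => ?_
  exact ((hφ x).comp (E.measurable_pay t ht)).indicator (E.measurable_arm t ht x)

lemma measurable_card_hits {t : ℕ} (ht : t ≤ T) (v : 𝒯) :
    Measurable[E.ℱ t] (fun ω => (E.hits t v ω).card) := by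
  have h : (fun ω => (E.hits t v ω).card) =
      fun ω => ∑ s ∈ Finset.range t, (E.hit s v).indicator (fun _ => 1) ω := by
    ext ω
    rw [Finset.card_eq_sum_ones, hits, hitRounds, Finset.sum_filter]
    refine Finset.sum_congr rfl fun s _ => ?_
    by_cases h : ω ∈ E.hit s v
    · rw [Set.indicator_of_mem h]
      exact if_pos h
    · rw [Set.indicator_of_notMem h]
      exact if_neg h
  rw [h]
  refine Finset.measurable_sum _ fun s hs => ?_
  have hs := Finset.mem_range.1 hs
  exact measurable_const.indicator (E.ℱ.mono (by omega : s + 1 ≤ t) _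
    (E.measurableSet_hit_filtration (by omega) v))

/-- The product over the hits of `v` before round `t` of a function of the arm and the payoff. -/
noncomputable def hitProd (φ : Arm 𝒯 → ℝ → ℝ≥0∞) (t : ℕ) (v : 𝒯) (ω : Ω) : ℝ≥0∞ :=
  ∏ s ∈ E.hits t v ω, φ (E.arm s ω) (E.pay s ω)

lemma measurable_hitProd {φ : Arm 𝒯 → ℝ → ℝ≥0∞} (hφ : ∀ x, Measurable (φ x)) {t : ℕ}
    (ht : t ≤ T) (v : 𝒯) : Measurable[E.ℱ t] (E.hitProd φ t v) := by
  have h : E.hitProd φ t v = fun ω => ∏ s ∈ Finset.range t,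
      if ω ∈ E.hit s v then φ (E.arm s ω) (E.pay s ω) else 1 := by
    ext ω
    rw [hitProd, hits, hitRounds, Finset.prod_filter]
    refine Finset.prod_congr rfl fun s _ => ?_
    by_cases h : ω ∈ E.hit s v
    · exact (if_pos h).trans (if_pos h).symm
    · exact (if_neg h).trans (if_neg h).symm
  rw [h]
  refine Finset.measurable_prod _ fun s hs => ?_
  have hs := Finset.mem_range.1 hs
  have hmono := E.ℱ.mono (by omega : s + 1 ≤ t)
  exact Measurable.ite (hmono _ (E.measurableSet_hit_filtration (by omega) v))
    ((E.measurable_comp_arm_pay (by omega) hφ).mono hmono le_rfl) measurable_const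

lemma law_setLIntegral {t : ℕ} (ht : t < T) {A : Set Ω} (hA : MeasurableSet[E.ℱ t] A) (v : 𝒯)
    (x : Arm 𝒯) {φ : (Arm 𝒯 → ℝ) → ℝ≥0∞} (hφ : Measurable φ) :
    ∫⁻ ω in A ∩ {ω | E.sel t ω = v} ∩ {ω | E.arm t ω = x}, φ (E.payFun t ω) ∂P =
      P (A ∩ {ω | E.sel t ω = v}) * ENNReal.ofReal (reachProb v x.1) * ∫⁻ f, φ f ∂Pay := by
  have hmap : (P.restrict (A ∩ {ω | E.sel t ω = v} ∩ {ω | E.arm t ω = x})).map (E.payFun t) =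
      (P (A ∩ {ω | E.sel t ω = v}) * ENNReal.ofReal (reachProb v x.1)) • Pay := by
    ext B hB
    rw [Measure.map_apply (E.measurable_payFun t ht) hB,
      Measure.restrict_apply (E.measurable_payFun t ht hB), Set.inter_comm,
      E.law t ht A hA v x B hB, Measure.smul_apply, smul_eq_mul]
  rw [← lintegral_map hφ (E.measurable_payFun t ht), hmap, lintegral_smul_measure, smul_eq_mul]

/-- Given the information before round `t`, the arm of round `t` is a random sample, independent of
the payoff function. -/
lemma law_lintegral {t : ℕ} (ht : t < T) {G : Ω → ℝ≥0∞} (hG : Measurable[E.ℱ t] G) (v : 𝒯)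
    (x : Arm 𝒯) {φ : (Arm 𝒯 → ℝ) → ℝ≥0∞} (hφ : Measurable φ) :
    ∫⁻ ω in {ω | E.sel t ω = v} ∩ {ω | E.arm t ω = x}, G ω * φ (E.payFun t ω) ∂P =
      (∫⁻ ω in {ω | E.sel t ω = v}, G ω ∂P) *
        (ENNReal.ofReal (reachProb v x.1) * ∫⁻ f, φ f ∂Pay) := by
  set S := {ω | E.sel t ω = v} with hS
  set X := {ω | E.arm t ω = x} with hX
  set κ := ENNReal.ofReal (reachProb v x.1) * ∫⁻ f, φ f ∂Pay with hκ
  have hSm : MeasurableSet S := E.measurableSet_sel ht v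
  have hXm : MeasurableSet X := E.measurableSet_arm ht x
  have hφ' : Measurable (fun ω => φ (E.payFun t ω)) := hφ.comp (E.measurable_payFun t ht)
  have hG' : Measurable G := hG.mono (E.ℱ.le t) le_rfl
  -- As `G` is measurable for ℱ t, it is enough that the two measures agree on ℱ t, where the law of
  -- the round applies.
  have htrim : ((P.restrict (S ∩ X)).withDensity (fun ω => φ (E.payFun t ω))).trim (E.ℱ.le t) =
      (κ • P.restrict S).trim (E.ℱ.le t) := by
    refine @Measure.ext _ (E.ℱ t) _ _ fun A hA => ?_
    have hA' := E.ℱ.le t A hA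
    rw [trim_measurableSet_eq _ hA, trim_measurableSet_eq _ hA, withDensity_apply _ hA',
      Measure.restrict_restrict hA', ← Set.inter_assoc, E.law_setLIntegral ht hA v x hφ,
      Measure.smul_apply, Measure.restrict_apply hA', smul_eq_mul, hκ, mul_assoc, mul_comm]
  calc _ = ∫⁻ ω, G ω ∂((P.restrict (S ∩ X)).withDensity (fun ω => φ (E.payFun t ω))) := by
        rw [lintegral_withDensity_eq_lintegral_mul _ hφ' hG']
        exact lintegral_congr fun ω => mul_comm _ _
    _ = ∫⁻ ω, G ω ∂(κ • P.restrict S) := by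
        rw [← lintegral_trim (E.ℱ.le t) hG, htrim, lintegral_trim (E.ℱ.le t) hG]
    _ = _ := by rw [lintegral_smul_measure, smul_eq_mul, mul_comm]

/-- The expectation of `φ` for a random sample from the subtree of `v` and its payoff. -/
noncomputable def sampleMean (Pay : Measure (Arm 𝒯 → ℝ)) (φ : Arm 𝒯 → ℝ → ℝ≥0∞) (v : 𝒯) : ℝ≥0∞ :=
  ∑ x ∈ Finset.univ.filter (fun x : Arm 𝒯 => v ≤ x.1),
    ENNReal.ofReal (reachProb v x.1) * ∫⁻ f, φ x (f x) ∂Pay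

lemma sampleMean_one [IsProbabilityMeasure Pay] (v : 𝒯) : sampleMean Pay (fun _ _ => 1) v = 1 := by
  simp only [sampleMean, lintegral_one, measure_univ, mul_one]
  rw [← ENNReal.ofReal_sum_of_nonneg fun _ _ => reachProb_nonneg _ _, sum_reachProb_arms,
    ENNReal.ofReal_one]

/-- By multiplicativity of reach probabilities, a walk that passes through `v` ends in a random
sample from `v`, whichever ancestor it started from; so the factor `sampleMean` splits off. -/
lemma lintegral_hit {t : ℕ} (ht : t < T) {G : Ω → ℝ≥0∞} (hG : Measurable[E.ℱ t] G) (v : 𝒯)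
    {φ : Arm 𝒯 → ℝ → ℝ≥0∞} (hφ : ∀ x, Measurable (φ x)) :
    ∫⁻ ω in E.hit t v, G ω * φ (E.arm t ω) (E.pay t ω) ∂P =
      (∑ a ∈ Finset.univ.filter (fun a : 𝒯 => a ≤ v),
        (∫⁻ ω in {ω | E.sel t ω = a}, G ω ∂P) * ENNReal.ofReal (reachProb a v)) *
        sampleMean Pay φ v := by
  rw [hit_eq_biUnion, lintegral_biUnion_finset]
  · rw [sampleMean, Finset.sum_mul_sum, ← Finset.sum_product']
    refine Finset.sum_congr ?_ fun p hp => ?_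
    · ext p
      simp
    · simp only [Finset.mem_product, Finset.mem_filter, Finset.mem_univ, true_and] at hp
      have hm : Measurable fun f : Arm 𝒯 → ℝ => φ p.2 (f p.2) :=
        (hφ p.2).comp (measurable_pi_apply p.2)
      rw [setLIntegral_congr_fun (g := fun ω => G ω * φ p.2 (E.payFun t ω p.2))
        ((E.measurableSet_sel ht p.1).inter (E.measurableSet_arm ht p.2))]
      · rw [E.law_lintegral ht hG p.1 p.2 hm, reachProb_mul hp.1 hp.2,
          ENNReal.ofReal_mul (reachProb_nonneg _ _)]
        ring
      · rintro ω ⟨-, h2⟩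
        have h2 : E.arm t ω = p.2 := h2
        simp only [pay, h2]
  · rintro p - p' - hne
    rw [Function.onFun, Set.disjoint_left]
    rintro ω ⟨h1, h2⟩ ⟨h3, h4⟩
    exact hne (Prod.ext (h1.symm.trans h3) (h2.symm.trans h4))
  · exact fun p _ => (E.measurableSet_sel ht p.1).inter (E.measurableSet_arm ht p.2)

lemma setLIntegral_hit [IsProbabilityMeasure Pay] {t : ℕ} (ht : t < T) {G : Ω → ℝ≥0∞}
    (hG : Measurable[E.ℱ t] G) (v : 𝒯) :
    ∫⁻ ω in E.hit t v, G ω ∂P = ∑ a ∈ Finset.univ.filter (fun a : 𝒯 => a ≤ v),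
        (∫⁻ ω in {ω | E.sel t ω = a}, G ω ∂P) * ENNReal.ofReal (reachProb a v) := by
  have := E.lintegral_hit ht hG v (φ := fun _ _ => 1) fun _ => measurable_const
  simpa only [mul_one, sampleMean_one] using this

lemma lintegral_hit_le [IsProbabilityMeasure Pay] {t : ℕ} (ht : t < T) {G : Ω → ℝ≥0∞}
    (hG : Measurable[E.ℱ t] G) (v : 𝒯) {φ : Arm 𝒯 → ℝ → ℝ≥0∞} (hφ : ∀ x, Measurable (φ x))
    (h1 : sampleMean Pay φ v ≤ 1) :
    ∫⁻ ω in E.hit t v, G ω * φ (E.arm t ω) (E.pay t ω) ∂P ≤ ∫⁻ ω in E.hit t v, G ω ∂P := by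
  rw [E.lintegral_hit ht hG v hφ, E.setLIntegral_hit ht hG v]
  exact mul_le_of_le_one_right' h1

lemma measurableSet_two_le {t : ℕ} (ht : t ≤ T) (v : 𝒯) :
    MeasurableSet[E.ℱ t] {ω | 2 ≤ (E.hits t v ω).card} :=
  E.measurable_card_hits ht v (measurableSet_Ici (a := 2))

/-- After the second hit of `v`, the product of a function with sample mean at most one does not
grow in expectation. -/
lemma lintegral_hitProd_le [IsProbabilityMeasure Pay] {φ : Arm 𝒯 → ℝ → ℝ≥0∞}
    (hφ : ∀ x, Measurable (φ x)) {K : ℝ≥0∞} (hK : ∀ x y, φ x y ≤ K) {v : 𝒯}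
    (h1 : sampleMean Pay φ v ≤ 1) {t : ℕ} (ht : t ≤ T) :
    ∫⁻ ω in {ω | 2 ≤ (E.hits t v ω).card}, E.hitProd φ t v ω ∂P ≤
      K ^ 2 * P {ω | 2 ≤ (E.hits t v ω).card} := by
  induction t with
  | zero =>
    have : {ω | 2 ≤ (E.hits 0 v ω).card} = ∅ := by
      ext ω
      simp [hits, hitRounds]
    rw [this]
    simp
  | succ t ih =>
    have ih := ih (by omega)
    have ht' : t < T := ht
    set A := {ω | 2 ≤ (E.hits t v ω).card} with hA
    set B := {ω | (E.hits t v ω).card = 1} with hB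
    set H := E.hit t v with hH
    have hAf : MeasurableSet[E.ℱ t] A := E.measurableSet_two_le ht'.le v
    have hAm : MeasurableSet A := E.ℱ.le t _ hAf
    have hBm : MeasurableSet B :=
      E.ℱ.le t _ (E.measurable_card_hits ht'.le v (measurableSet_singleton 1))
    have hHm : MeasurableSet H := E.measurableSet_hit ht' v
    -- Either `v` already had two hits, and the expectation of the product does not grow, or this
    -- round is the second hit, and the product has exactly two factors, each at most K.
    have hset : {ω | 2 ≤ (E.hits (t + 1) v ω).card} = A ∪ (B ∩ H) := by
      ext ω
      by_cases h : ω ∈ H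
      · simp only [Set.mem_ofPred_eq, E.hits_succ_of_mem h,
          Finset.card_insert_of_notMem (E.notMem_hits t v ω), hA, hB, Set.mem_union,
          Set.mem_inter_iff, h, and_true]
        omega
      · simp only [Set.mem_ofPred_eq, E.hits_succ_of_notMem h, hA, hB, Set.mem_union,
          Set.mem_inter_iff, h, and_false, or_false]
    have hdisj : Disjoint A (B ∩ H) := by
      rw [Set.disjoint_left]
      rintro ω hω ⟨hω', -⟩
      rw [hA, Set.mem_ofPred_eq] at hω
      rw [hB, Set.mem_ofPred_eq] at hω'
      omega
    have hprod : ∀ ω ∈ H, E.hitProd φ (t + 1) v ω =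
        E.hitProd φ t v ω * φ (E.arm t ω) (E.pay t ω) := by
      intro ω h
      rw [hitProd, E.hits_succ_of_mem h, Finset.prod_insert (E.notMem_hits t v ω), mul_comm,
        hitProd]
    have hprod' : ∀ ω ∉ H, E.hitProd φ (t + 1) v ω = E.hitProd φ t v ω := by
      intro ω h
      rw [hitProd, E.hits_succ_of_notMem h, hitProd]
    have hW : Measurable[E.ℱ t] (A.indicator (E.hitProd φ t v)) :=
      (E.measurable_hitProd hφ ht'.le v).indicator hAf
    have hpartA : ∫⁻ ω in A, E.hitProd φ (t + 1) v ω ∂P ≤ ∫⁻ ω in A, E.hitProd φ t v ω ∂P := by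
      rw [← lintegral_inter_add_sdiff _ A hHm, ← lintegral_inter_add_sdiff (E.hitProd φ t v) A hHm]
      refine add_le_add ?_ (le_of_eq ?_)
      · have h2 := E.lintegral_hit_le ht' hW v hφ h1
        rw [setLIntegral_congr_fun (hAm.inter hHm) fun ω hω => hprod ω hω.2]
        rw [← hH, setLIntegral_indicator hAm] at h2
        refine le_trans (le_of_eq ?_) h2
        rw [← setLIntegral_indicator hAm]
        refine lintegral_congr fun ω => ?_
        by_cases h : ω ∈ A <;> simp [h]
      · exact setLIntegral_congr_fun (hAm.diff hHm) fun ω hω => hprod' ω hω.2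
    have hpartB : ∫⁻ ω in B ∩ H, E.hitProd φ (t + 1) v ω ∂P ≤ K ^ 2 * P (B ∩ H) := by
      rw [← setLIntegral_const]
      refine setLIntegral_mono' (hBm.inter hHm) fun ω hω => ?_
      have hcard : (E.hits (t + 1) v ω).card = 2 := by
        rw [E.hits_succ_of_mem hω.2, Finset.card_insert_of_notMem (E.notMem_hits t v ω)]
        have : (E.hits t v ω).card = 1 := hω.1
        omega
      rw [hitProd, ← hcard]
      exact Finset.prod_le_pow_card _ _ _ fun s _ => hK _ _
    rw [hset, lintegral_union (hBm.inter hHm) hdisj, measure_union hdisj (hBm.inter hHm), mul_add]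
    exact add_le_add (hpartA.trans ih) hpartB

end Execution

/-! ### Exponential moments of a single payoff. -/

section Exponential

/-- Hoeffding's bound for the moment generating function of a Bernoulli variable. -/
lemma bernoulli_mgf_le {p : ℝ} (hp : p ∈ Set.Icc (0 : ℝ) 1) (l : ℝ) :
    1 - p + p * Real.exp l ≤ Real.exp (l * p + l ^ 2 / 8) := by
  set ν : Measure ℝ := ENNReal.ofReal (1 - p) • Measure.dirac 0 + ENNReal.ofReal p • Measure.dirac 1
    with hν
  have h1p : 0 ≤ 1 - p := sub_nonneg.2 hp.2
  have : IsProbabilityMeasure ν := ⟨by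
    simp only [hν, Measure.coe_add, Measure.coe_smul, Pi.add_apply, Pi.smul_apply, measure_univ,
      smul_eq_mul, mul_one]
    rw [← ENNReal.ofReal_add h1p hp.1]
    simp⟩
  have hint : ∀ f : ℝ → ℝ, ∫ y, f y ∂ν = (1 - p) * f 0 + p * f 1 := by
    intro f
    rw [hν, integral_add_measure, integral_smul_measure, integral_smul_measure, integral_dirac,
      integral_dirac, ENNReal.toReal_ofReal h1p, ENNReal.toReal_ofReal hp.1, smul_eq_mul,
      smul_eq_mul]
    · exact (integrable_dirac (by simp)).smul_measure ENNReal.ofReal_ne_top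
    · exact (integrable_dirac (by simp)).smul_measure ENNReal.ofReal_ne_top
  have hmem : ∀ᵐ y ∂ν, y ∈ Set.Icc (0 : ℝ) 1 := by
    rw [hν, ae_add_measure_iff]
    constructor
    · refine Measure.ae_smul_measure ?_ _
      refine (ae_dirac_iff (p := fun y => y ∈ Set.Icc (0 : ℝ) 1) measurableSet_Icc).2 ?_
      simp
    · refine Measure.ae_smul_measure ?_ _
      refine (ae_dirac_iff (p := fun y => y ∈ Set.Icc (0 : ℝ) 1) measurableSet_Icc).2 ?_
      simp
  have h := (hasSubgaussianMGF_of_mem_Icc (X := fun y : ℝ => y) (μ := ν) aemeasurable_id hmem).mgf_le l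
  rw [mgf, hint, hint] at h
  have hexp : Real.exp (l * p + l ^ 2 / 8) = Real.exp (l * p) * Real.exp (l ^ 2 / 8) :=
    Real.exp_add _ _
  have h0 : Real.exp (l * p) * Real.exp (l * (0 - ((1 - p) * 0 + p * 1))) = 1 := by
    rw [← Real.exp_add]
    ring_nf
    exact Real.exp_zero
  have h1 : Real.exp (l * p) * Real.exp (l * (1 - ((1 - p) * 0 + p * 1))) = Real.exp l := by
    rw [← Real.exp_add]
    ring_nf
  have h2 : Real.exp (((‖(1 : ℝ) - 0‖₊ / 2) ^ 2 : NNReal) * l ^ 2 / 2) = Real.exp (l ^ 2 / 8) := by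
    congr 1
    push_cast
    simp only [sub_zero, norm_one]
    ring
  rw [h2] at h
  rw [hexp]
  calc 1 - p + p * Real.exp l = Real.exp (l * p) *
        ((1 - p) * Real.exp (l * (0 - ((1 - p) * 0 + p * 1))) +
          p * Real.exp (l * (1 - ((1 - p) * 0 + p * 1)))) := by
        rw [mul_add, mul_left_comm, h0, mul_left_comm, h1, mul_one]
    _ ≤ _ := by gcongr

lemma exp_mul_le_of_mem_Icc {y : ℝ} (hy : y ∈ Set.Icc (0 : ℝ) 1) (l : ℝ) :
    Real.exp (l * y) ≤ 1 - y + y * Real.exp l := by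
  have := convexOn_exp.2 (Set.mem_univ 0) (Set.mem_univ l) (sub_nonneg.2 hy.2) hy.1
    (sub_add_cancel 1 y)
  simp only [smul_eq_mul, mul_zero, zero_add, Real.exp_zero, mul_one] at this
  rwa [mul_comm]

/-- The truncation of a real number to the unit interval. -/
noncomputable def clampUnit (y : ℝ) : ℝ := max 0 (min 1 y)

lemma clampUnit_mem (y : ℝ) : clampUnit y ∈ Set.Icc (0 : ℝ) 1 :=
  ⟨le_max_left _ _, max_le zero_le_one (min_le_left _ _)⟩

lemma clampUnit_of_mem {y : ℝ} (hy : y ∈ Set.Icc (0 : ℝ) 1) : clampUnit y = y := by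
  rw [clampUnit, min_eq_right hy.2, max_eq_right hy.1]

lemma measurable_clampUnit : Measurable clampUnit :=
  measurable_const.max (measurable_const.min measurable_id)

lemma meanPayoff_mem {𝒯 : RootedTree.{u}} {Pay : Measure (Arm 𝒯 → ℝ)}
    [IsProbabilityMeasure Pay]
    (hPay : ∀ᵐ f ∂Pay, ∀ x, f x ∈ Set.Icc (0 : ℝ) 1) (x : Arm 𝒯) :
    meanPayoff Pay x ∈ Set.Icc (0 : ℝ) 1 := by
  have hae : ∀ᵐ f ∂Pay, f x ∈ Set.Icc (0 : ℝ) 1 := hPay.mono fun f hf => hf x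
  have hint : Integrable (fun f : Arm 𝒯 → ℝ => f x) Pay :=
    Integrable.of_mem_Icc 0 1 (measurable_pi_apply x).aemeasurable hae
  refine ⟨integral_nonneg_of_ae (hae.mono fun f hf => hf.1), ?_⟩
  calc meanPayoff Pay x ≤ ∫ _, (1 : ℝ) ∂Pay :=
        integral_mono_ae hint (integrable_const _) (hae.mono fun f hf => hf.2)
    _ = 1 := by simp

/-- Convexity replaces the exponential by its chord. The bound is left affine in the mean of the arm
so that it can be averaged over a random sample. -/
lemma lintegral_exp_clamp_le {𝒯 : RootedTree.{u}} {Pay : Measure (Arm 𝒯 → ℝ)}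
    [IsProbabilityMeasure Pay]
    (hPay : ∀ᵐ f ∂Pay, ∀ x, f x ∈ Set.Icc (0 : ℝ) 1) (l m : ℝ) (x : Arm 𝒯) :
    ∫⁻ f, ENNReal.ofReal (Real.exp (l * (clampUnit (f x) - m) - l ^ 2 / 8)) ∂Pay ≤
      ENNReal.ofReal (Real.exp (-(l * m) - l ^ 2 / 8) *
        (1 - meanPayoff Pay x + meanPayoff Pay x * Real.exp l)) := by
  have hmeas : Measurable fun f : Arm 𝒯 → ℝ => clampUnit (f x) :=
    measurable_clampUnit.comp (measurable_pi_apply x)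
  have hint : Integrable (fun f : Arm 𝒯 → ℝ => clampUnit (f x)) Pay :=
    Integrable.of_mem_Icc 0 1 hmeas.aemeasurable (ae_of_all _ fun f => clampUnit_mem _)
  have hmean : ∫ f, clampUnit (f x) ∂Pay = meanPayoff Pay x :=
    integral_congr_ae (hPay.mono fun f hf => clampUnit_of_mem (hf x))
  have hint2 : Integrable (fun f : Arm 𝒯 → ℝ => 1 - clampUnit (f x)) Pay :=
    (integrable_const _).sub hint
  have heq : ∫ f, Real.exp (-(l * m) - l ^ 2 / 8) *
      (1 - clampUnit (f x) + clampUnit (f x) * Real.exp l) ∂Pay =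
      Real.exp (-(l * m) - l ^ 2 / 8) *
        (1 - meanPayoff Pay x + meanPayoff Pay x * Real.exp l) := by
    rw [integral_const_mul, integral_add hint2 (hint.mul_const _),
      integral_sub (integrable_const _) hint, integral_mul_const, hmean]
    simp
  have hint3 : Integrable (fun f : Arm 𝒯 → ℝ => Real.exp (-(l * m) - l ^ 2 / 8) *
      (1 - clampUnit (f x) + clampUnit (f x) * Real.exp l)) Pay :=
    (hint2.add (hint.mul_const _)).const_mul _
  rw [← heq, ofReal_integral_eq_lintegral_ofReal hint3 (ae_of_all _ fun f => ?_)]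
  · refine lintegral_mono fun f => ENNReal.ofReal_le_ofReal ?_
    calc Real.exp (l * (clampUnit (f x) - m) - l ^ 2 / 8)
        = Real.exp (-(l * m) - l ^ 2 / 8) * Real.exp (l * clampUnit (f x)) := by
          rw [← Real.exp_add]
          ring_nf
      _ ≤ _ := by
          gcongr
          exact exp_mul_le_of_mem_Icc (clampUnit_mem _) l
  · have := clampUnit_mem (f x)
    have h1 : 0 ≤ 1 - clampUnit (f x) := sub_nonneg.2 this.2
    have h2 := this.1
    simp only [Pi.zero_apply]
    positivity

end Exponential

/-! ### Concentration of averages and hit counts. -/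

namespace Execution

variable {𝒯 : RootedTree.{u}} [Fintype 𝒯] {Pay : Measure (Arm 𝒯 → ℝ)} {T : ℕ} {qhat : ℝ}
  {Ω : Type w} [mΩ : MeasurableSpace Ω] {P : Measure Ω} (E : Execution 𝒯 Pay T qhat P)

/-- The probability that the node `v` is hit at least twice. -/
noncomputable def twiceProb (v : 𝒯) : ℝ≥0∞ := P {ω | 2 ≤ (E.hits T v ω).card}

/-- Markov's inequality on the event of two hits. The factor `twiceProb v` is kept because it makes
the sum over all nodes independent of the size of the tree. -/
lemma measure_le_hitProd_le [IsProbabilityMeasure Pay] (hT : 2 ≤ T) {φ : Arm 𝒯 → ℝ → ℝ≥0∞}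
    (hφ : ∀ x, Measurable (φ x)) (hK : ∀ x y, φ x y ≤ ENNReal.ofReal (Real.exp 2)) {v : 𝒯}
    (h1 : sampleMean Pay φ v ≤ 1) {t : ℕ} (ht : t ≤ T) :
    P {ω | 2 ≤ (E.hits t v ω).card ∧ ENNReal.ofReal ((T : ℝ) ^ 8) ≤ E.hitProd φ t v ω} ≤
      ENNReal.ofReal (Real.exp 4 / (T : ℝ) ^ 8) * E.twiceProb v := by
  have hTpos : (0 : ℝ) < (T : ℝ) ^ 8 := by
    have : (0 : ℝ) < T := by exact_mod_cast (by omega : 0 < T)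
    positivity
  have hm : Measurable (E.hitProd φ t v) := (E.measurable_hitProd hφ ht v).mono (E.ℱ.le t) le_rfl
  have hmk := mul_meas_ge_le_lintegral (μ := P.restrict {ω | 2 ≤ (E.hits t v ω).card}) hm
    (ENNReal.ofReal ((T : ℝ) ^ 8))
  rw [Measure.restrict_apply (measurableSet_le measurable_const hm)] at hmk
  have hle := hmk.trans (E.lintegral_hitProd_le hφ hK h1 ht)
  have hset : {ω | 2 ≤ (E.hits t v ω).card ∧ ENNReal.ofReal ((T : ℝ) ^ 8) ≤ E.hitProd φ t v ω} =
      {ω | ENNReal.ofReal ((T : ℝ) ^ 8) ≤ E.hitProd φ t v ω} ∩ {ω | 2 ≤ (E.hits t v ω).card} := by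
    ext ω
    exact and_comm
  have hmono : P {ω | 2 ≤ (E.hits t v ω).card} ≤ E.twiceProb v :=
    measure_mono fun ω hω => le_trans hω (Finset.card_le_card (E.hits_mono ht v ω))
  have hT0 : ENNReal.ofReal ((T : ℝ) ^ 8) ≠ 0 := (ENNReal.ofReal_pos.2 hTpos).ne'
  rw [hset, ENNReal.ofReal_div_of_pos hTpos, ENNReal.mul_comm_div, mul_comm, ENNReal.mul_comm_div,
    ← mul_div_assoc, ENNReal.le_div_iff_mul_le (Or.inl hT0) (Or.inl ENNReal.ofReal_ne_top),
    mul_comm]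
  refine hle.trans ?_
  rw [← ENNReal.ofReal_pow (Real.exp_pos _).le, ← Real.exp_nat_mul]
  norm_num
  rw [mul_comm]
  gcongr

/-- Averaging the affine bounds over the arms gives the moment generating function of a Bernoulli
variable with mean `nodeMean`, so Hoeffding's bound applies although the arms below `v` have
different means. -/
lemma sampleMean_exp_le [IsProbabilityMeasure Pay]
    (hPay : ∀ᵐ f ∂Pay, ∀ x, f x ∈ Set.Icc (0 : ℝ) 1) (l : ℝ) (v : 𝒯) :
    sampleMean Pay (fun _ y => ENNReal.ofReal
      (Real.exp (l * (clampUnit y - nodeMean (meanPayoff Pay) v) - l ^ 2 / 8))) v ≤ 1 := by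
  set m := nodeMean (meanPayoff Pay) v with hm
  have hmem := meanPayoff_mem hPay
  have hm01 : m ∈ Set.Icc (0 : ℝ) 1 :=
    ⟨le_nodeMean fun x _ => (hmem x).1, nodeMean_le fun x _ => (hmem x).2⟩
  have hnn : ∀ x : Arm 𝒯, 0 ≤ Real.exp (-(l * m) - l ^ 2 / 8) *
        (1 - meanPayoff Pay x + meanPayoff Pay x * Real.exp l) := by
    intro x
    have h1 : 0 ≤ 1 - meanPayoff Pay x := sub_nonneg.2 (hmem x).2
    have h2 := (hmem x).1
    positivity
  calc _ ≤ ∑ x ∈ Finset.univ.filter (fun x : Arm 𝒯 => v ≤ x.1),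
        ENNReal.ofReal (reachProb v x.1) * ENNReal.ofReal (Real.exp (-(l * m) - l ^ 2 / 8) *
        (1 - meanPayoff Pay x + meanPayoff Pay x * Real.exp l)) := by
        refine Finset.sum_le_sum fun x _ => ?_
        gcongr
        exact lintegral_exp_clamp_le hPay l m x
    _ = ENNReal.ofReal (∑ x ∈ Finset.univ.filter (fun x : Arm 𝒯 => v ≤ x.1),
        reachProb v x.1 * (Real.exp (-(l * m) - l ^ 2 / 8) *
        (1 - meanPayoff Pay x + meanPayoff Pay x * Real.exp l))) := by
        rw [ENNReal.ofReal_sum_of_nonneg fun x _ => mul_nonneg (reachProb_nonneg _ _) (hnn x)]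
        exact Finset.sum_congr rfl fun x _ => (ENNReal.ofReal_mul (reachProb_nonneg _ _)).symm
    _ ≤ 1 := by
        refine ENNReal.ofReal_le_one.2 ?_
        have hsum : ∑ x ∈ Finset.univ.filter (fun x : Arm 𝒯 => v ≤ x.1),
            reachProb v x.1 * (Real.exp (-(l * m) - l ^ 2 / 8) *
            (1 - meanPayoff Pay x + meanPayoff Pay x * Real.exp l)) =
            Real.exp (-(l * m) - l ^ 2 / 8) * (1 - m + m * Real.exp l) := by
          calc _ = ∑ x ∈ Finset.univ.filter (fun x : Arm 𝒯 => v ≤ x.1),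
                Real.exp (-(l * m) - l ^ 2 / 8) * (reachProb v x.1 +
                (Real.exp l - 1) * (meanPayoff Pay x * reachProb v x.1)) :=
                Finset.sum_congr rfl fun x _ => by ring
            _ = _ := by
                rw [← Finset.mul_sum, Finset.sum_add_distrib, ← Finset.mul_sum, sum_reachProb_arms,
                  hm, nodeMean]
                ring
        rw [hsum]
        calc _ ≤ Real.exp (-(l * m) - l ^ 2 / 8) * Real.exp (l * m + l ^ 2 / 8) := by
              gcongr
              exact bernoulli_mgf_le hm01 l
          _ = 1 := by
              rw [← Real.exp_add]
              ring_nf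
              exact Real.exp_zero

/-- The average payoff of a node is concentrated around its mean. -/
lemma measure_deviation_le [IsProbabilityMeasure Pay]
    (hPay : ∀ᵐ f ∂Pay, ∀ x, f x ∈ Set.Icc (0 : ℝ) 1) (hT : 2 ≤ T) {t : ℕ} (ht : t < T) (v : 𝒯)
    {ε : ℝ} (hε : ε ^ 2 = 1) :
    P {ω | 2 ≤ (E.hits t v ω).card ∧ ((E.hits t v ω).card : ℝ) *
        Real.sqrt (8 * Real.log T / (2 + ((E.hits t v ω).card : ℝ))) <
        ε * ∑ s ∈ E.hits t v ω, (clampUnit (E.pay s ω) - nodeMean (meanPayoff Pay) v)} ≤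
      T * (ENNReal.ofReal (Real.exp 4 / (T : ℝ) ^ 8) * E.twiceProb v) := by
  have hTpos : (0 : ℝ) < T := by exact_mod_cast (by omega : 0 < T)
  have hL : 0 < Real.log T := Real.log_pos (by exact_mod_cast hT)
  set m := nodeMean (meanPayoff Pay) v with hm
  have hmem := meanPayoff_mem hPay
  have hm01 : m ∈ Set.Icc (0 : ℝ) 1 :=
    ⟨le_nodeMean fun x _ => (hmem x).1, nodeMean_le fun x _ => (hmem x).2⟩
  set ψ : ℝ → Arm 𝒯 → ℝ → ℝ≥0∞ := fun l _ y =>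
    ENNReal.ofReal (Real.exp (l * (clampUnit y - m) - l ^ 2 / 8)) with hψ
  have hψm : ∀ l x, Measurable (ψ l x) := fun l x => by
    have := measurable_clampUnit
    exact (Real.measurable_exp.comp
      (((this.sub_const m).const_mul l).sub_const _)).ennreal_ofReal
  -- Clamping makes this hold for every real payoff, not just almost surely; |l| - l²/8 is at most
  -- 2, attained at |l| = 4.
  have hψK : ∀ l x y, ψ l x y ≤ ENNReal.ofReal (Real.exp 2) := by
    intro l x y
    refine ENNReal.ofReal_le_ofReal (Real.exp_le_exp.2 ?_)
    have h1 := clampUnit_mem y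
    have h2 : |clampUnit y - m| ≤ 1 := abs_sub_le_iff.2
      ⟨by linarith [h1.2, hm01.1], by linarith [h1.1, hm01.2]⟩
    have h3 : l * (clampUnit y - m) ≤ |l| := by
      refine (le_abs_self _).trans ?_
      rw [abs_mul]
      exact mul_le_of_le_one_right (abs_nonneg _) h2
    nlinarith [sq_nonneg (|l| - 4), sq_abs l]
  set ρ : ℕ → ℝ := fun n => Real.sqrt (8 * Real.log T / (2 + (n : ℝ))) with hρ
  have hprod : ∀ l ω, E.hitProd (ψ l) t v ω = ENNReal.ofReal (Real.exp
      (l * ∑ s ∈ E.hits t v ω, (clampUnit (E.pay s ω) - m) -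
        (E.hits t v ω).card * (l ^ 2 / 8))) := by
    intro l ω
    rw [hitProd, hψ, ← ENNReal.ofReal_prod_of_nonneg fun _ _ => (Real.exp_pos _).le, ← Real.exp_sum,
      Finset.sum_sub_distrib, Finset.sum_const, nsmul_eq_mul, Finset.mul_sum]
  -- The right l depends on the random number n of hits, hence a union over n with l = 4ερ(n). A
  -- deviation makes the exponent at least 4nρ² - 2nρ² = 2nρ², which is at least 8 log T because n ≥
  -- 2.
  calc _ ≤ P (⋃ n ∈ Finset.range T, {ω | 2 ≤ (E.hits t v ω).card ∧
        ENNReal.ofReal ((T : ℝ) ^ 8) ≤ E.hitProd (ψ (4 * ε * ρ n)) t v ω}) := by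
        refine measure_mono ?_
        rintro ω ⟨h2, hlt⟩
        set n := (E.hits t v ω).card with hn
        have hnT : n < T := by
          refine lt_of_le_of_lt ?_ ht
          rw [hn]
          refine (Finset.card_le_card (t := Finset.range t) fun s hs => ?_).trans_eq
            (Finset.card_range t)
          exact Finset.mem_range.2 (E.mem_hits.1 hs).1
        refine Set.mem_biUnion (Finset.mem_coe.2 (Finset.mem_range.2 hnT)) ⟨h2, ?_⟩
        rw [hprod, ← hn]
        refine ENNReal.ofReal_le_ofReal ?_
        have hn2 : (2 : ℝ) ≤ n := by exact_mod_cast h2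
        have hρ2 : ρ n ^ 2 = 8 * Real.log T / (2 + (n : ℝ)) := Real.sq_sqrt (by positivity)
        have hρ0 : 0 ≤ ρ n := Real.sqrt_nonneg _
        have hnρ : 4 * Real.log T ≤ n * ρ n ^ 2 := by
          rw [hρ2, ← mul_div_assoc, le_div_iff₀ (by positivity)]
          nlinarith
        have hmul := mul_le_mul_of_nonneg_left hlt.le hρ0
        change ρ n * (n * ρ n) ≤ _ at hmul
        rw [← Real.exp_log hTpos, ← Real.exp_nat_mul, Real.exp_le_exp]
        have hsq : (4 * ε * ρ n) ^ 2 = 16 * ρ n ^ 2 := by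
          rw [mul_pow, mul_pow, hε]
          ring
        rw [hsq]
        push_cast
        nlinarith
    _ ≤ ∑ n ∈ Finset.range T, P {ω | 2 ≤ (E.hits t v ω).card ∧
        ENNReal.ofReal ((T : ℝ) ^ 8) ≤ E.hitProd (ψ (4 * ε * ρ n)) t v ω} :=
        measure_biUnion_finset_le _ _
    _ ≤ ∑ n ∈ Finset.range T, ENNReal.ofReal (Real.exp 4 / (T : ℝ) ^ 8) * E.twiceProb v :=
        Finset.sum_le_sum fun n _ => E.measure_le_hitProd_le hT (hψm _) (hψK _)
          (sampleMean_exp_le hPay _ v) ht.le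
    _ = _ := by rw [Finset.sum_const, Finset.card_range, nsmul_eq_mul]

/-- A descendant which is reached with probability `p` gets at least half of the expected
number of hits. -/
lemma measure_few_hits_le [IsProbabilityMeasure Pay] (hT : 2 ≤ T) {t : ℕ}
    (ht : t < T) {v u : 𝒯} (hu : v ≤ u) (hqu : qhat ≤ reachProb v u) :
    P {ω | 2 ≤ (E.hits t v ω).card ∧
        256 * Real.log T < qhat * (2 + ((E.hits t v ω).card : ℝ)) ∧
        (((E.hits t v ω).filter fun s => u ≤ (E.arm s ω).1).card : ℝ) <
          reachProb v u * (E.hits t v ω).card / 2} ≤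
      ENNReal.ofReal (Real.exp 4 / (T : ℝ) ^ 8) * E.twiceProb v := by
  have hTpos : (0 : ℝ) < T := by exact_mod_cast (by omega : 0 < T)
  have hL : 0.69 < Real.log T := by
    have h2 : Real.log 2 ≤ Real.log T := Real.log_le_log (by norm_num) (by exact_mod_cast hT)
    linarith [Real.log_two_gt_d9]
  set p := reachProb v u with hp
  have hp1 : p ≤ 1 := reachProb_le_one _ _
  have hp0 : 0 ≤ p := reachProb_nonneg _ _
  -- Samples below `u` are discounted by 1/2, and the sample mean is e^(p/2)(1 - p/2) ≤ 1. With
  -- fewer than pn/2 such samples the product is at least exp((pn/2)(1 - log 2)), which the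
  -- threshold 256 log T lifts above T⁸.
  set ψ : Arm 𝒯 → ℝ → ℝ≥0∞ := fun x _ =>
    ENNReal.ofReal (Real.exp (p / 2) * if u ≤ x.1 then 1 / 2 else 1) with hψ
  have hhalf : ∀ x : Arm 𝒯, (0 : ℝ) ≤ (if u ≤ x.1 then 1 / 2 else 1) ∧
      (if u ≤ x.1 then (1 : ℝ) / 2 else 1) ≤ 1 := by
    intro x
    split_ifs <;> norm_num
  have hψK : ∀ x y, ψ x y ≤ ENNReal.ofReal (Real.exp 2) := by
    intro x y
    refine ENNReal.ofReal_le_ofReal ?_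
    calc _ ≤ Real.exp (p / 2) * 1 := by
          gcongr
          exact (hhalf x).2
      _ ≤ Real.exp 2 := by
          rw [mul_one, Real.exp_le_exp]
          linarith
  have hmean : sampleMean Pay ψ v ≤ 1 := by
    have h1 : sampleMean Pay ψ v = ENNReal.ofReal (Real.exp (p / 2) * (1 - p / 2)) := by
      simp only [sampleMean, hψ, lintegral_const, measure_univ, mul_one]
      calc _ = ENNReal.ofReal (∑ x ∈ Finset.univ.filter (fun x : Arm 𝒯 => v ≤ x.1),
            reachProb v x.1 * (Real.exp (p / 2) * if u ≤ x.1 then 1 / 2 else 1)) := by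
            rw [ENNReal.ofReal_sum_of_nonneg fun x _ => mul_nonneg (reachProb_nonneg _ _)
              (mul_nonneg (Real.exp_pos _).le (hhalf x).1)]
            exact Finset.sum_congr rfl fun x _ => (ENNReal.ofReal_mul (reachProb_nonneg _ _)).symm
        _ = _ := by
            congr 1
            have h2 : ∀ x : Arm 𝒯,
                reachProb v x.1 * (Real.exp (p / 2) * if u ≤ x.1 then 1 / 2 else 1) =
                Real.exp (p / 2) * (reachProb v x.1 -
                  1 / 2 * (if u ≤ x.1 then reachProb v x.1 else 0)) := by
              intro x
              split_ifs <;> ring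
            rw [Finset.sum_congr rfl fun x _ => h2 x, ← Finset.mul_sum, Finset.sum_sub_distrib,
              ← Finset.mul_sum, sum_reachProb_arms, ← Finset.sum_filter, Finset.filter_filter]
            have h3 : (Finset.univ.filter fun x : Arm 𝒯 => v ≤ x.1 ∧ u ≤ x.1) =
                Finset.univ.filter fun x : Arm 𝒯 => u ≤ x.1 :=
              Finset.filter_congr fun x _ => and_iff_right_of_imp fun h => hu.trans h
            rw [h3, sum_reachProb_arms_above hu]
            ring
    rw [h1, ENNReal.ofReal_le_one]
    calc _ ≤ Real.exp (p / 2) * Real.exp (-(p / 2)) := by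
          gcongr
          linarith [Real.add_one_le_exp (-(p / 2))]
      _ = 1 := by rw [← Real.exp_add, add_neg_cancel, Real.exp_zero]
  have hψm : ∀ x, Measurable (ψ x) := fun _ => measurable_const
  refine le_trans (measure_mono ?_) (E.measure_le_hitProd_le hT hψm hψK hmean ht.le)
  rintro ω ⟨h2, h3, h4⟩
  refine ⟨h2, ?_⟩
  set n := (E.hits t v ω).card with hn
  set N := ((E.hits t v ω).filter fun s => u ≤ (E.arm s ω).1).card with hN
  have hprod : E.hitProd ψ t v ω = ENNReal.ofReal (Real.exp (n * (p / 2)) * (1 / 2) ^ N) := by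
    rw [hitProd, hψ, ← ENNReal.ofReal_prod_of_nonneg fun s _ =>
      mul_nonneg (Real.exp_pos _).le (hhalf (E.arm s ω)).1, Finset.prod_mul_distrib,
      Finset.prod_const, Finset.prod_ite, Finset.prod_const, Finset.prod_const_one, mul_one,
      ← Real.exp_nat_mul]
  rw [hprod]
  refine ENNReal.ofReal_le_ofReal ?_
  have hhalfpow : ((1 : ℝ) / 2) ^ N = Real.exp (-(N * Real.log 2)) := by
    rw [Real.exp_neg, Real.exp_nat_mul, Real.exp_log (by norm_num), one_div, inv_pow]
  rw [hhalfpow, ← Real.exp_add]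
  have hT8 : (T : ℝ) ^ 8 = Real.exp (8 * Real.log T) := by
    have := Real.exp_nat_mul (Real.log T) 8
    rw [Real.exp_log hTpos] at this
    exact_mod_cast this.symm
  rw [hT8, Real.exp_le_exp]
  have hlog2 := Real.log_two_lt_d9
  have hlog2' := Real.log_two_gt_d9
  have hpn : qhat * n ≤ p * n := by gcongr
  have hNlog : N * Real.log 2 ≤ p * n / 2 * 0.7 := by
    have hN0 : (0 : ℝ) ≤ N := Nat.cast_nonneg _
    have : (N : ℝ) * Real.log 2 ≤ N * 0.7 := by gcongr; linarith
    linarith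
  linarith

end Execution

/-! ### The union bound over the nodes. -/

namespace Execution

variable {𝒯 : RootedTree.{u}} [Fintype 𝒯] {Pay : Measure (Arm 𝒯 → ℝ)} {T : ℕ} {qhat : ℝ}
  {Ω : Type w} [mΩ : MeasurableSpace Ω] {P : Measure Ω} (E : Execution 𝒯 Pay T qhat P)

/-- Few nodes with siblings are hit in two given rounds. -/
lemma sum_measure_hit_inter_hit_le [IsProbabilityMeasure Pay] [IsProbabilityMeasure P] {s t : ℕ}
    (hst : s < t) (ht : t < T) :
    ∑ v ∈ Finset.univ.filter (fun v : 𝒯 => ¬ OnlyChild v), P (E.hit s v ∩ E.hit t v) ≤ 2 := by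
  have hGm : ∀ v, Measurable[E.ℱ t] ((E.hit s v).indicator (1 : Ω → ℝ≥0∞)) := fun v =>
    (@measurable_const _ _ _ (E.ℱ t) 1).indicator (E.ℱ.mono (by omega : s + 1 ≤ t) _
      (E.measurableSet_hit_filtration (hst.trans ht) v))
  have hG : ∀ v, P (E.hit s v ∩ E.hit t v) = ∑ a ∈ Finset.univ.filter (fun a : 𝒯 => a ≤ v),
      ∫⁻ ω in {ω | E.sel t ω = a},
        ENNReal.ofReal (reachProb a v) * (E.hit s v).indicator 1 ω ∂P := by
    intro v
    have h := E.setLIntegral_hit ht (hGm v) v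
    rw [lintegral_indicator_one (E.measurableSet_hit (hst.trans ht) v),
      Measure.restrict_apply (E.measurableSet_hit (hst.trans ht) v)] at h
    rw [h]
    refine Finset.sum_congr rfl fun a _ => ?_
    rw [lintegral_const_mul _ ((hGm v).mono (E.ℱ.le t) le_rfl), mul_comm]
  -- The nodes hit in round s lie on the path to one arm. For a walk of round t from `a`, the node
  -- `a` contributes at most 1 and the nodes below it at most 1 by `sum_reachProb_path_le`.
  have hpath : ∀ a ω, ∑ v ∈ Finset.univ.filter (fun v : 𝒯 => ¬ OnlyChild v ∧ a ≤ v),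
      ENNReal.ofReal (reachProb a v) * (E.hit s v).indicator 1 ω ≤ (2 : ℝ≥0∞) := by
    intro a ω
    have hreal : ∑ v ∈ Finset.univ.filter
        (fun v : 𝒯 => ¬ OnlyChild v ∧ a ≤ v ∧ v ≤ (E.arm s ω).1), reachProb a v ≤ 2 := by
      have h1 := sum_reachProb_path_le a (E.arm s ω).1
      have h2 : ∑ v ∈ Finset.univ.filter
          (fun v : 𝒯 => ¬ OnlyChild v ∧ a ≤ v ∧ v ≤ (E.arm s ω).1), reachProb a v ≤
          ∑ v ∈ insert a (Finset.univ.filter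
            (fun v : 𝒯 => ¬ OnlyChild v ∧ a < v ∧ v ≤ (E.arm s ω).1)), reachProb a v := by
        refine Finset.sum_le_sum_of_subset_of_nonneg ?_ fun _ _ _ => reachProb_nonneg _ _
        intro v hv
        simp only [Finset.mem_insert, Finset.mem_filter, Finset.mem_univ, true_and] at hv ⊢
        rcases hv.2.1.lt_or_eq with h | h
        · exact Or.inr ⟨hv.1, h, hv.2.2⟩
        · exact Or.inl h.symm
      rw [Finset.sum_insert (by simp), reachProb_self] at h2
      linarith
    calc _ ≤ ∑ v ∈ Finset.univ.filter (fun v : 𝒯 => ¬ OnlyChild v ∧ a ≤ v),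
          if v ≤ (E.arm s ω).1 then ENNReal.ofReal (reachProb a v) else 0 := by
          refine Finset.sum_le_sum fun v _ => ?_
          by_cases h : ω ∈ E.hit s v
          · rw [Set.indicator_of_mem h, if_pos h.2, Pi.one_apply, mul_one]
          · rw [Set.indicator_of_notMem h, mul_zero]
            exact zero_le
      _ = ENNReal.ofReal (∑ v ∈ Finset.univ.filter
          (fun v : 𝒯 => ¬ OnlyChild v ∧ a ≤ v ∧ v ≤ (E.arm s ω).1), reachProb a v) := by
          rw [← Finset.sum_filter, Finset.filter_filter,
            ENNReal.ofReal_sum_of_nonneg fun _ _ => reachProb_nonneg _ _]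
          simp only [and_assoc]
      _ ≤ 2 := by
          rw [← ENNReal.ofReal_ofNat]
          exact ENNReal.ofReal_le_ofReal hreal
  calc _ = ∑ a : 𝒯, ∑ v ∈ Finset.univ.filter (fun v : 𝒯 => ¬ OnlyChild v ∧ a ≤ v),
        ∫⁻ ω in {ω | E.sel t ω = a},
          ENNReal.ofReal (reachProb a v) * (E.hit s v).indicator 1 ω ∂P := by
        rw [Finset.sum_congr rfl fun v _ => hG v]
        refine Finset.sum_comm' fun v a => ?_
        simp
    _ = ∑ a : 𝒯, ∫⁻ ω in {ω | E.sel t ω = a},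
        ∑ v ∈ Finset.univ.filter (fun v : 𝒯 => ¬ OnlyChild v ∧ a ≤ v),
          ENNReal.ofReal (reachProb a v) * (E.hit s v).indicator 1 ω ∂P := by
        refine Finset.sum_congr rfl fun a _ => ?_
        rw [lintegral_finsetSum]
        exact fun v _ => ((hGm v).mono (E.ℱ.le t) le_rfl).const_mul _
    _ ≤ ∑ a : 𝒯, ∫⁻ ω in {ω | E.sel t ω = a}, 2 ∂P :=
        Finset.sum_le_sum fun a _ => lintegral_mono fun ω => hpath a ω
    _ = 2 * ∑ a : 𝒯, P {ω | E.sel t ω = a} := by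
        rw [Finset.mul_sum]
        exact Finset.sum_congr rfl fun a _ => setLIntegral_const _ _
    _ = 2 := by
        rw [← measure_biUnion_finset, Set.iUnion₂_eq_univ_iff.2 fun ω =>
          ⟨E.sel t ω, Finset.mem_univ _, rfl⟩, measure_univ, mul_one]
        · rintro a - b - hab
          rw [Function.onFun, Set.disjoint_left]
          rintro ω h1 h2
          exact hab (Eq.trans (Eq.symm h1) h2)
        · exact fun a _ => E.measurableSet_sel ht a

lemma sum_twiceProb_le [IsProbabilityMeasure Pay] [IsProbabilityMeasure P] :
    ∑ v ∈ Finset.univ.filter (fun v : 𝒯 => ¬ OnlyChild v), E.twiceProb v ≤ 2 * (T : ℝ≥0∞) ^ 2 := by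
  have hle : ∀ v, E.twiceProb v ≤ ∑ t ∈ Finset.range T, ∑ s ∈ Finset.range t,
      P (E.hit s v ∩ E.hit t v) := by
    intro v
    refine le_trans (measure_mono (t := ⋃ t ∈ Finset.range T, ⋃ s ∈ Finset.range t,
      E.hit s v ∩ E.hit t v) ?_) ((measure_biUnion_finset_le _ _).trans
        (Finset.sum_le_sum fun t _ => measure_biUnion_finset_le _ _))
    intro ω hω
    obtain ⟨a, ha, b, hb, hab⟩ := Finset.one_lt_card.1 (show 1 < (E.hits T v ω).card from hω)
    rw [mem_hits] at ha hb
    simp only [Set.mem_iUnion, Finset.mem_range, Set.mem_inter_iff, exists_prop]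
    rcases lt_or_gt_of_ne hab with h | h
    · exact ⟨b, hb.1, a, h, ha.2, hb.2⟩
    · exact ⟨a, ha.1, b, h, hb.2, ha.2⟩
  calc _ ≤ ∑ v ∈ Finset.univ.filter (fun v : 𝒯 => ¬ OnlyChild v),
        ∑ t ∈ Finset.range T, ∑ s ∈ Finset.range t, P (E.hit s v ∩ E.hit t v) :=
        Finset.sum_le_sum fun v _ => hle v
    _ = ∑ t ∈ Finset.range T, ∑ s ∈ Finset.range t,
        ∑ v ∈ Finset.univ.filter (fun v : 𝒯 => ¬ OnlyChild v), P (E.hit s v ∩ E.hit t v) := by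
        rw [Finset.sum_comm]
        exact Finset.sum_congr rfl fun t _ => Finset.sum_comm
    _ ≤ ∑ t ∈ Finset.range T, ∑ s ∈ Finset.range T, 2 := by
        refine Finset.sum_le_sum fun t ht => ?_
        have ht := Finset.mem_range.1 ht
        refine (Finset.sum_le_sum fun s hs =>
          E.sum_measure_hit_inter_hit_le (Finset.mem_range.1 hs) ht).trans ?_
        exact Finset.sum_le_sum_of_subset (Finset.range_subset_range.2 ht.le)
    _ = _ := by
        simp only [Finset.sum_const, Finset.card_range, nsmul_eq_mul]
        ring

lemma ae_sel_le_arm [IsProbabilityMeasure Pay] : ∀ᵐ ω ∂P, ∀ t < T, E.sel t ω ≤ (E.arm t ω).1 := by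
  rw [ae_all_iff]
  intro t
  rw [Filter.eventually_imp_distrib_left]
  intro ht
  have h0 : ∀ p : 𝒯 × Arm 𝒯, ¬ p.1 ≤ p.2.1 →
      P ({ω | E.sel t ω = p.1} ∩ {ω | E.arm t ω = p.2}) = 0 := by
    intro p hp
    have h := E.law t ht Set.univ MeasurableSet.univ p.1 p.2 Set.univ MeasurableSet.univ
    rw [reachProb_of_not_le hp] at h
    simpa using h
  have hall : ∀ᵐ ω ∂P, ∀ p : 𝒯 × Arm 𝒯, ¬ p.1 ≤ p.2.1 →
      ω ∉ {ω | E.sel t ω = p.1} ∩ {ω | E.arm t ω = p.2} := by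
    rw [ae_all_iff]
    intro p
    rw [Filter.eventually_imp_distrib_left]
    exact fun hp => measure_eq_zero_iff_ae_notMem.1 (h0 p hp)
  filter_upwards [hall] with ω hω
  by_contra hcon
  exact hω (E.sel t ω, E.arm t ω) hcon ⟨rfl, rfl⟩

lemma ae_pay_mem (hPay : ∀ᵐ f ∂Pay, ∀ x, f x ∈ Set.Icc (0 : ℝ) 1) :
    ∀ᵐ ω ∂P, ∀ t < T, E.pay t ω ∈ Set.Icc (0 : ℝ) 1 := by
  rw [ae_all_iff]
  intro t
  rw [Filter.eventually_imp_distrib_left]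
  intro ht
  set B : Set (Arm 𝒯 → ℝ) := {f | ∀ x, f x ∈ Set.Icc (0 : ℝ) 1}ᶜ with hB
  have hBm : MeasurableSet B := by
    have : {f : Arm 𝒯 → ℝ | ∀ x, f x ∈ Set.Icc (0 : ℝ) 1} =
        ⋂ x, (fun f : Arm 𝒯 → ℝ => f x) ⁻¹' Set.Icc 0 1 := by
      ext f
      simp
    rw [hB, this]
    exact (MeasurableSet.iInter fun x => measurable_pi_apply x measurableSet_Icc).compl
  have hall : ∀ᵐ ω ∂P, ∀ p : 𝒯 × Arm 𝒯,
      ω ∉ Set.univ ∩ {ω | E.sel t ω = p.1} ∩ {ω | E.arm t ω = p.2} ∩ E.payFun t ⁻¹' B := by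
    rw [ae_all_iff]
    intro p
    refine measure_eq_zero_iff_ae_notMem.1 ?_
    rw [E.law t ht Set.univ MeasurableSet.univ p.1 p.2 B hBm,
      show Pay B = 0 from ae_iff.1 hPay, mul_zero]
  filter_upwards [hall] with ω hω
  by_contra hcon
  exact hω (E.sel t ω, E.arm t ω) ⟨⟨⟨trivial, rfl⟩, rfl⟩, fun h => hcon (h _)⟩

/-- With high probability the run is clean. -/
lemma exists_clean [IsProbabilityMeasure Pay] [IsProbabilityMeasure P]
    (hPay : ∀ᵐ f ∂Pay, ∀ x, f x ∈ Set.Icc (0 : ℝ) 1) (hT : 2 ≤ T) (hq : 0 < qhat)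
    (hqual : QualityAtLeast (meanPayoff Pay) qhat) :
    ∃ bad : Set Ω, P bad ≤ ENNReal.ofReal (8 * Real.exp 4 / (T : ℝ) ^ 4) ∧
      ∀ᵐ ω ∂P, ω ∉ bad → IsClean (meanPayoff Pay) T qhat (fun t => E.act t ω)
        (fun t => E.sel t ω) (fun t => E.arm t ω) (fun t => E.pay t ω) := by
  have hTpos : (0 : ℝ) < T := by exact_mod_cast (by omega : 0 < T)
  have hL : 0.69 < Real.log T := by
    have h2 : Real.log 2 ≤ Real.log T := Real.log_le_log (by norm_num) (by exact_mod_cast hT)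
    linarith [Real.log_two_gt_d9]
  set μ := meanPayoff Pay with hμ
  have hmem : ∀ x, μ x ∈ Set.Icc (0 : ℝ) 1 := meanPayoff_mem hPay
  have hm01 : ∀ v, nodeMean μ v ∈ Set.Icc (0 : ℝ) 1 := fun v =>
    ⟨le_nodeMean fun x _ => (hmem x).1, nodeMean_le fun x _ => (hmem x).2⟩
  -- The witnesses are fixed before the union bound, with `v` itself as the default when no optimal
  -- arm lies below it.
  have hwit : ∀ v : 𝒯, ∃ u u' : 𝒯, v ≤ u ∧ v ≤ u' ∧ ((∃ x : Arm 𝒯, v ≤ x.1 ∧ μ x = bestMean μ) →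
      weight μ v / 2 ≤ |nodeMean μ u - nodeMean μ u'| ∧ qhat ≤ reachProb v u ∧
        qhat ≤ reachProb v u') := by
    intro v
    by_cases h : ∃ x : Arm 𝒯, v ≤ x.1 ∧ μ x = bestMean μ
    · obtain ⟨u, u', h1, h2, h3, h4⟩ := hqual v h
      exact ⟨u, u', h1, h2, fun _ => ⟨h3, h4.trans (min_le_left _ _), h4.trans (min_le_right _ _)⟩⟩
    · exact ⟨v, v, le_rfl, le_rfl, fun h' => absurd h' h⟩
  choose U U' hU hU' hwit using hwit
  set dev : ℝ → ℕ → 𝒯 → Set Ω := fun ε t v => {ω | 2 ≤ (E.hits t v ω).card ∧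
    ((E.hits t v ω).card : ℝ) * Real.sqrt (8 * Real.log T / (2 + ((E.hits t v ω).card : ℝ))) <
      ε * ∑ s ∈ E.hits t v ω, (clampUnit (E.pay s ω) - nodeMean μ v)} with hdev
  set few : ℕ → 𝒯 → 𝒯 → Set Ω := fun t v u => {ω | 2 ≤ (E.hits t v ω).card ∧
        256 * Real.log T < qhat * (2 + ((E.hits t v ω).card : ℝ)) ∧
        (((E.hits t v ω).filter fun s => u ≤ (E.arm s ω).1).card : ℝ) <
          reachProb v u * (E.hits t v ω).card / 2 ∧ qhat ≤ reachProb v u} with hfew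
  set κ : ℝ≥0∞ := ENNReal.ofReal (Real.exp 4 / (T : ℝ) ^ 8) with hκ
  have hfewle : ∀ t < T, ∀ v u, v ≤ u → P (few t v u) ≤ κ * E.twiceProb v := by
    intro t ht v u hvu
    by_cases hp : qhat ≤ reachProb v u
    · refine le_trans (measure_mono ?_) (E.measure_few_hits_le hT ht hvu hp)
      rintro ω ⟨h1, h2, h3, -⟩
      exact ⟨h1, h2, h3⟩
    · have : few t v u = ∅ := Set.eq_empty_of_forall_notMem fun ω hω => hp hω.2.2.2
      rw [this, measure_empty]
      exact zero_le
  -- Per node and round the bound is 4Tκ·`twiceProb v` with κ = e⁴/T⁸; T rounds and the sum 2T² over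
  -- the nodes give 8e⁴/T⁴.
  refine ⟨⋃ v ∈ Finset.univ.filter (fun v : 𝒯 => ¬ OnlyChild v), ⋃ t ∈ Finset.range T,
    (dev 1 t v ∪ dev (-1) t v) ∪ (few t v (U v) ∪ few t v (U' v)), ?_, ?_⟩
  · have hone : ∀ v, ∀ t ∈ Finset.range T,
        P ((dev 1 t v ∪ dev (-1) t v) ∪ (few t v (U v) ∪ few t v (U' v))) ≤
        4 * T * (κ * E.twiceProb v) := by
      intro v t ht
      have ht := Finset.mem_range.1 ht
      have hT1 : (1 : ℝ≥0∞) ≤ T := by exact_mod_cast (by omega : 1 ≤ T)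
      have hκT : κ * E.twiceProb v ≤ T * (κ * E.twiceProb v) := le_mul_of_one_le_left' hT1
      calc _ ≤ (P (dev 1 t v) + P (dev (-1) t v)) + (P (few t v (U v)) + P (few t v (U' v))) :=
            (measure_union_le _ _).trans
              (add_le_add (measure_union_le _ _) (measure_union_le _ _))
        _ ≤ (T * (κ * E.twiceProb v) + T * (κ * E.twiceProb v)) +
            (T * (κ * E.twiceProb v) + T * (κ * E.twiceProb v)) := by
            gcongr
            · exact E.measure_deviation_le hPay hT ht v (by norm_num)
            · exact E.measure_deviation_le hPay hT ht v (by norm_num)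
            · exact (hfewle t ht v _ (hU v)).trans hκT
            · exact (hfewle t ht v _ (hU' v)).trans hκT
        _ = _ := by ring
    calc _ ≤ ∑ v ∈ Finset.univ.filter (fun v : 𝒯 => ¬ OnlyChild v), ∑ t ∈ Finset.range T,
          P ((dev 1 t v ∪ dev (-1) t v) ∪ (few t v (U v) ∪ few t v (U' v))) :=
          (measure_biUnion_finset_le _ _).trans
            (Finset.sum_le_sum fun v _ => measure_biUnion_finset_le _ _)
      _ ≤ ∑ v ∈ Finset.univ.filter (fun v : 𝒯 => ¬ OnlyChild v), ∑ t ∈ Finset.range T,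
          4 * T * (κ * E.twiceProb v) :=
          Finset.sum_le_sum fun v _ => Finset.sum_le_sum fun t ht => hone v t ht
      _ = 4 * T ^ 2 * κ * ∑ v ∈ Finset.univ.filter (fun v : 𝒯 => ¬ OnlyChild v), E.twiceProb v := by
          rw [Finset.mul_sum]
          refine Finset.sum_congr rfl fun v _ => ?_
          rw [Finset.sum_const, Finset.card_range, nsmul_eq_mul]
          ring
      _ ≤ 4 * T ^ 2 * κ * (2 * T ^ 2) := by
          gcongr
          exact E.sum_twiceProb_le
      _ = ENNReal.ofReal (8 * Real.exp 4 / (T : ℝ) ^ 4) := by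
          have hcast : (T : ℝ≥0∞) = ENNReal.ofReal T := (ENNReal.ofReal_natCast T).symm
          rw [hκ, hcast, ← ENNReal.ofReal_pow hTpos.le, ← ENNReal.ofReal_ofNat 4,
            ← ENNReal.ofReal_ofNat 2, ← ENNReal.ofReal_mul (by norm_num),
            ← ENNReal.ofReal_mul (by positivity), ← ENNReal.ofReal_mul (by norm_num),
            ← ENNReal.ofReal_mul (by positivity)]
          congr 1
          field_simp
          ring
  · filter_upwards [E.ae_sel_le_arm, E.ae_pay_mem hPay] with ω hsel hpay hbad
    have hgood : ∀ v : 𝒯, ¬ OnlyChild v → ∀ t < T,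
        ω ∉ (dev 1 t v ∪ dev (-1) t v) ∪ (few t v (U v) ∪ few t v (U' v)) := by
      intro v hv t ht hω
      refine hbad (Set.mem_biUnion (Finset.mem_coe.2 (Finset.mem_filter.2
        ⟨Finset.mem_univ v, hv⟩)) (Set.mem_biUnion (Finset.mem_coe.2 (Finset.mem_range.2 ht)) hω))
    have R := E.isRun ω
    refine ⟨hsel, ?_, ?_⟩
    · intro t ht v
      -- From the root downwards: an only child inherits average, radius and mean from its parent.
      induction v using (wellFounded_lt (α := 𝒯)).induction with
      | _ v ih =>
      by_cases hoc : OnlyChild v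
      · obtain ⟨p, hp, hc⟩ := hoc
        have h1 := R.hitRounds_onlyChild hT hq ht.le hp hc
        have h2 := ih p hp.lt
        rw [avgPayoff, confRad] at h2 ⊢
        rw [h1, nodeMean_eq_of_one_le_reachProb μ hp.le (reachProb_onlyChild hp hc).ge]
        exact h2
      · have hno := hgood v hoc t ht
        simp only [Set.mem_union, not_or] at hno
        rw [avgPayoff, confRad]
        change |(∑ s ∈ E.hits t v ω, E.pay s ω) / ((E.hits t v ω).card : ℝ) - nodeMean μ v| ≤
          Real.sqrt (8 * Real.log T / (2 + ((E.hits t v ω).card : ℝ)))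
        set n := (E.hits t v ω).card with hn
        have hclamp : ∑ s ∈ E.hits t v ω, (clampUnit (E.pay s ω) - nodeMean μ v) =
            ∑ s ∈ E.hits t v ω, E.pay s ω - n * nodeMean μ v := by
          rw [Finset.sum_sub_distrib, Finset.sum_const, nsmul_eq_mul]
          congr 1
          exact Finset.sum_congr rfl fun s hs =>
            clampUnit_of_mem (hpay s ((E.mem_hits.1 hs).1.trans ht))
        rcases le_or_gt 2 n with h2 | h2
        · have hn0 : (0 : ℝ) < n := by exact_mod_cast (by omega : 0 < n)
          have h3 := not_lt.1 fun h => hno.1.1 ⟨h2, h⟩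
          have h4 := not_lt.1 fun h => hno.1.2 ⟨h2, h⟩
          rw [hclamp] at h3 h4
          rw [div_sub' hn0.ne', abs_div, abs_of_pos hn0, div_le_iff₀ hn0, abs_le]
          constructor <;> linarith
        -- With at most one hit, 8 · 0.69 > 3 ≥ 2 + n makes the radius at least 1, and both
        -- quantities lie in [0,1].
        · have hrad : 1 ≤ Real.sqrt (8 * Real.log T / (2 + (n : ℝ))) := by
            rw [Real.one_le_sqrt, one_le_div (by positivity)]
            have : (n : ℝ) ≤ 1 := by exact_mod_cast (by omega : n ≤ 1)
            linarith
          refine le_trans ?_ hrad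
          have hS0 : 0 ≤ ∑ s ∈ E.hits t v ω, E.pay s ω :=
            Finset.sum_nonneg fun s hs => (hpay s ((E.mem_hits.1 hs).1.trans ht)).1
          have hS1 : ∑ s ∈ E.hits t v ω, E.pay s ω ≤ n := by
            have := Finset.sum_le_card_nsmul (E.hits t v ω) (fun s => E.pay s ω) 1
              fun s hs => (hpay s ((E.mem_hits.1 hs).1.trans ht)).2
            simpa using this
          have hq0 : 0 ≤ (∑ s ∈ E.hits t v ω, E.pay s ω) / (n : ℝ) := by positivity
          have hq1 : (∑ s ∈ E.hits t v ω, E.pay s ω) / (n : ℝ) ≤ 1 :=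
            div_le_one_of_le₀ hS1 (Nat.cast_nonneg _)
          exact abs_sub_le_iff.2 ⟨by linarith [(hm01 v).1], by linarith [(hm01 v).2]⟩
    · intro t ht v hv hx
      obtain ⟨h1, h2, h3⟩ := hwit v hx
      refine ⟨U v, U' v, hU v, hU' v, h1, fun hlarge => ?_⟩
      change 256 * Real.log T < qhat * (2 + ((E.hits t v ω).card : ℝ)) at hlarge
      change qhat / 2 * (2 + ((E.hits t v ω).card : ℝ)) ≤ 2 + ((E.hits t (U v) ω).card : ℝ) ∧
        qhat / 2 * (2 + ((E.hits t v ω).card : ℝ)) ≤ 2 + ((E.hits t (U' v) ω).card : ℝ)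
      have hno := hgood v (R.not_onlyChild hT hq ht hv) t ht
      simp only [Set.mem_union, not_or] at hno
      have hq1 : qhat ≤ 1 := h2.trans (reachProb_le_one _ _)
      have hcard : 2 ≤ (E.hits t v ω).card := by
        by_contra hlt
        have h4 : ((E.hits t v ω).card : ℝ) ≤ 1 := by
          exact_mod_cast (by omega : (E.hits t v ω).card ≤ 1)
        have h5 : qhat * (2 + ((E.hits t v ω).card : ℝ)) ≤ 1 * (2 + 1) := by gcongr
        linarith
      have hmain : ∀ u, v ≤ u → qhat ≤ reachProb v u → ω ∉ few t v u →
          qhat / 2 * (2 + ((E.hits t v ω).card : ℝ)) ≤ 2 + ((E.hits t u ω).card : ℝ) := by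
        intro u hvu hqu hfewu
        have h6 : reachProb v u * (E.hits t v ω).card / 2 ≤
            (((E.hits t v ω).filter fun s => u ≤ (E.arm s ω).1).card : ℝ) := by
          by_contra hcon
          exact hfewu ⟨hcard, hlarge, not_le.1 hcon, hqu⟩
        have h7 : (((E.hits t v ω).filter fun s => u ≤ (E.arm s ω).1).card : ℝ) ≤
            (E.hits t u ω).card := by
          refine Nat.cast_le.2 (Finset.card_le_card fun s hs => ?_)
          obtain ⟨hs1, hs2⟩ := Finset.mem_filter.1 hs
          obtain ⟨hs3, hs4⟩ := E.mem_hits.1 hs1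
          exact E.mem_hits.2 ⟨hs3, hs4.1.trans hvu, hs2⟩
        have h8 : qhat * (E.hits t v ω).card ≤ reachProb v u * (E.hits t v ω).card := by gcongr
        linarith
      exact ⟨hmain _ (hU v) h2 hno.2.1, hmain _ (hU' v) h3 hno.2.2⟩

end Execution

/-! ### From clean runs to the expected regret. -/

namespace Execution

variable {𝒯 : RootedTree.{u}} [Fintype 𝒯] {Pay : Measure (Arm 𝒯 → ℝ)} {T : ℕ} {qhat : ℝ}
  {Ω : Type w} [mΩ : MeasurableSpace Ω] {P : Measure Ω} (E : Execution 𝒯 Pay T qhat P)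

lemma comp_sel_arm_eq_sum (t : ℕ) (g : 𝒯 × Arm 𝒯 → ℝ) :
    (fun ω => g (E.sel t ω, E.arm t ω)) = fun ω => ∑ p : 𝒯 × Arm 𝒯,
      ({ω | E.sel t ω = p.1} ∩ {ω | E.arm t ω = p.2}).indicator (fun _ => g p) ω := by
  ext ω
  rw [Finset.sum_eq_single (E.sel t ω, E.arm t ω)]
  · rw [Set.indicator_of_mem]
    exact ⟨rfl, rfl⟩
  · intro p _ hp
    exact Set.indicator_of_notMem (fun h => hp (Prod.ext h.1.symm h.2.symm)) _
  · exact fun h => absurd (Finset.mem_univ _) h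

lemma sum_gap_mem [IsProbabilityMeasure Pay]
    (hPay : ∀ᵐ f ∂Pay, ∀ x, f x ∈ Set.Icc (0 : ℝ) 1) (ω : Ω) :
    ∑ t ∈ Finset.range T, (bestMean (meanPayoff Pay) - nodeMean (meanPayoff Pay) (E.sel t ω)) ∈
      Set.Icc (0 : ℝ) T := by
  set μ := meanPayoff Pay with hμ
  have hmem : ∀ x, μ x ∈ Set.Icc (0 : ℝ) 1 := meanPayoff_mem hPay
  constructor
  · exact Finset.sum_nonneg fun t _ => sub_nonneg.2 (nodeMean_le_bestMean _)
  · have : ∀ t ∈ Finset.range T, bestMean μ - nodeMean μ (E.sel t ω) ≤ 1 := by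
      intro t _
      obtain ⟨x, hx⟩ := exists_eq_bestMean μ
      have h1 := (hmem x).2
      have h2 : 0 ≤ nodeMean μ (E.sel t ω) := le_nodeMean fun x _ => (hmem x).1
      linarith
    simpa using Finset.sum_le_card_nsmul _ _ _ this

variable [IsProbabilityMeasure P]

lemma integrable_comp_sel_arm {t : ℕ} (ht : t < T) (g : 𝒯 × Arm 𝒯 → ℝ) :
    Integrable (fun ω => g (E.sel t ω, E.arm t ω)) P := by
  rw [comp_sel_arm_eq_sum]
  exact integrable_finsetSum _ fun p _ => (integrable_const _).indicator
    ((E.measurableSet_sel ht p.1).inter (E.measurableSet_arm ht p.2))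

lemma integral_comp_sel_arm [IsProbabilityMeasure Pay] {t : ℕ} (ht : t < T)
    (g : 𝒯 × Arm 𝒯 → ℝ) :
    ∫ ω, g (E.sel t ω, E.arm t ω) ∂P =
      ∑ v : 𝒯, P.real {ω | E.sel t ω = v} * ∑ x : Arm 𝒯, g (v, x) * reachProb v x.1 := by
  have hm : ∀ p : 𝒯 × Arm 𝒯, MeasurableSet ({ω | E.sel t ω = p.1} ∩ {ω | E.arm t ω = p.2}) :=
    fun p => (E.measurableSet_sel ht p.1).inter (E.measurableSet_arm ht p.2)
  rw [comp_sel_arm_eq_sum, integral_finsetSum _ fun p _ => (integrable_const _).indicator (hm p),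
    Fintype.sum_prod_type]
  refine Finset.sum_congr rfl fun v _ => ?_
  rw [Finset.mul_sum]
  refine Finset.sum_congr rfl fun x _ => ?_
  have h := E.law t ht Set.univ MeasurableSet.univ v x Set.univ MeasurableSet.univ
  simp only [Set.univ_inter, Set.preimage_univ, Set.inter_univ, measure_univ, mul_one] at h
  rw [integral_indicator_const _ (hm (v, x)), Measure.real, h, ENNReal.toReal_mul,
    ENNReal.toReal_ofReal (reachProb_nonneg _ _), smul_eq_mul, Measure.real]
  ring

/-- The regret of a round is the expected gap of the selected node. -/
lemma regret_eq [IsProbabilityMeasure Pay] :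
    E.regret = ∫ ω, ∑ t ∈ Finset.range T,
      (bestMean (meanPayoff Pay) - nodeMean (meanPayoff Pay) (E.sel t ω)) ∂P := by
  set μ := meanPayoff Pay with hμ
  have h1 : ∀ t ∈ Finset.range T, Integrable (fun ω => bestMean μ - μ (E.arm t ω)) P :=
    fun t ht => E.integrable_comp_sel_arm (Finset.mem_range.1 ht) fun p => bestMean μ - μ p.2
  have h2 : ∀ t ∈ Finset.range T, Integrable (fun ω => bestMean μ - nodeMean μ (E.sel t ω)) P :=
    fun t ht => E.integrable_comp_sel_arm (Finset.mem_range.1 ht)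
      fun p => bestMean μ - nodeMean μ p.1
  rw [regret, integral_finsetSum _ h1, integral_finsetSum _ h2]
  refine Finset.sum_congr rfl fun t ht => ?_
  have ht := Finset.mem_range.1 ht
  rw [E.integral_comp_sel_arm ht fun p => bestMean μ - μ p.2,
    E.integral_comp_sel_arm ht fun p => bestMean μ - nodeMean μ p.1]
  refine Finset.sum_congr rfl fun v _ => ?_
  simp only [sub_mul]
  rw [Finset.sum_sub_distrib, Finset.sum_sub_distrib, ← nodeMean_eq_sum μ v,
    ← Finset.mul_sum Finset.univ _ (nodeMean μ v), sum_reachProb_univ, mul_one]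

lemma integrable_sum_gap (μ : Arm 𝒯 → ℝ) :
    Integrable (fun ω => ∑ t ∈ Finset.range T, (bestMean μ - nodeMean μ (E.sel t ω))) P :=
  integrable_finsetSum _ fun _ ht => E.integrable_comp_sel_arm (Finset.mem_range.1 ht)
    fun p => bestMean μ - nodeMean μ p.1

lemma regret_le_horizon [IsProbabilityMeasure Pay]
    (hPay : ∀ᵐ f ∂Pay, ∀ x, f x ∈ Set.Icc (0 : ℝ) 1) : E.regret ≤ T := by
  rw [regret_eq]
  calc _ ≤ ∫ _, (T : ℝ) ∂P := integral_mono (E.integrable_sum_gap _) (integrable_const _)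
        fun ω => (E.sum_gap_mem hPay ω).2
    _ = T := by simp

/-- A bound for clean runs gives a bound for the regret. -/
lemma regret_le_of_clean [IsProbabilityMeasure Pay]
    (hPay : ∀ᵐ f ∂Pay, ∀ x, f x ∈ Set.Icc (0 : ℝ) 1) (hT : 2 ≤ T) (hq : 0 < qhat)
    (hqual : QualityAtLeast (meanPayoff Pay) qhat) {B : ℝ} (hB : 0 ≤ B)
    (hclean : ∀ ω, IsClean (meanPayoff Pay) T qhat (fun t => E.act t ω)
        (fun t => E.sel t ω) (fun t => E.arm t ω) (fun t => E.pay t ω) →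
      ∑ t ∈ Finset.range T,
        (bestMean (meanPayoff Pay) - nodeMean (meanPayoff Pay) (E.sel t ω)) ≤ B) :
    E.regret ≤ B + T * (8 * Real.exp 4 / (T : ℝ) ^ 4) := by
  obtain ⟨bad, hbad, hgood⟩ := E.exists_clean hPay hT hq hqual
  set N := toMeasurable P bad with hN
  have hNm : MeasurableSet N := measurableSet_toMeasurable _ _
  have hPN : P.real N ≤ 8 * Real.exp 4 / (T : ℝ) ^ 4 := by
    rw [Measure.real, hN, measure_toMeasurable]
    exact ENNReal.toReal_le_of_le_ofReal (by positivity) hbad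
  have hint : Integrable (N.indicator fun _ => (T : ℝ)) P := (integrable_const _).indicator hNm
  rw [regret_eq]
  calc _ ≤ ∫ ω, (B + N.indicator (fun _ => (T : ℝ)) ω) ∂P := by
        refine integral_mono_ae (E.integrable_sum_gap _) ((integrable_const _).add hint) ?_
        filter_upwards [hgood] with ω hω
        by_cases h : ω ∈ N
        · rw [Set.indicator_of_mem h]
          linarith [(E.sum_gap_mem hPay ω).2]
        · rw [Set.indicator_of_notMem h, add_zero]
          exact hclean ω (hω fun h' => h (subset_toMeasurable _ _ h'))
    _ = B + T * P.real N := by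
        rw [integral_add (integrable_const _) hint, integral_indicator_const _ hNm]
        simp [mul_comm]
    _ ≤ _ := by gcongr

/-- The regret bound before the choice of the constant. -/
lemma regret_le_rpow [IsProbabilityMeasure Pay]
    (hPay : ∀ᵐ f ∂Pay, ∀ x, f x ∈ Set.Icc (0 : ℝ) 1) (hT : 8 ≤ T) (hq : 0 < qhat)
    (hqlog : 1 / Real.logb 2 T ≤ qhat) (hqual : QualityAtLeast (meanPayoff Pay) qhat) {c d : ℝ}
    (hcov : ZoomingCover (meanPayoff Pay) c d) :
    E.regret ≤ 4 * (T * (660000 * c * Real.log T ^ 2 / T) ^ (1 / (2 + d))) := by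
  have hc := one_le_const_of_zoomingCover hcov
  have hd := dim_nonneg_of_zoomingCover hcov
  have hq1 := quality_le_one hqual
  have hT2 : 2 ≤ T := by omega
  have hT8 : (8 : ℝ) ≤ T := by exact_mod_cast hT
  have hTpos : (0 : ℝ) < T := by linarith
  have hL1 : 1 ≤ Real.log T := by
    rw [Real.le_log_iff_exp_le hTpos]
    linarith [Real.exp_one_lt_d9]
  set L := Real.log T with hL
  -- With δ = H^(1/(2+d)), the two parts of the clean bound balance. The constant exceeds 2 · 12544
  -- · 18 · 1.45 = 654796.8, where 1/qhat ≤ log T / log 2 ≤ 1.45 log T supplies the second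
  -- logarithm.
  set H := 660000 * c * L ^ 2 / T with hH
  set e := 1 / (2 + d) with he
  have hepos : 0 < e := by positivity
  have he1 : e ≤ 1 := by
    rw [he, div_le_one (by linarith)]
    linarith
  have hHpos : 0 < H := by positivity
  have hHT : T * H = 660000 * c * L ^ 2 := by
    rw [hH]
    field_simp
  rcases le_or_gt 1 H with hH1 | hH1
  · have h1 : 1 ≤ H ^ e := Real.one_le_rpow hH1 hepos.le
    have h2 := E.regret_le_horizon hPay
    have h3 : (T : ℝ) * 1 ≤ T * H ^ e := by gcongr
    linarith
  set δ := H ^ e with hδ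
  have hδpos : 0 < δ := by positivity
  have hδ1 : δ < 1 := Real.rpow_lt_one hHpos.le hH1 hepos
  have hδH : δ ^ (2 + d) = H := by
    rw [hδ, ← Real.rpow_mul hHpos.le, he, one_div_mul_cancel (by linarith), Real.rpow_one]
  have hTδ : 1 ≤ T * δ := by
    have h1 : 1 / (T : ℝ) ≤ H := by
      rw [hH]
      gcongr
      nlinarith [mul_self_nonneg (L - 1)]
    have h2 : H ≤ δ := by
      calc H = H ^ (1 : ℝ) := (Real.rpow_one H).symm
        _ ≤ H ^ e := Real.rpow_le_rpow_of_exponent_ge hHpos hH1.le he1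
    rw [div_le_iff₀ hTpos] at h1
    nlinarith
  -- Rounding δ up to a power of 15/16 costs a factor 16/15 in the term rT; with the frontier term
  -- this makes 16/15 + 1 = 31/15.
  obtain ⟨J, hJ1, hJ2⟩ := exists_nat_pow_near_of_lt_one hδpos hδ1.le (by norm_num : (0 : ℝ) < 15 / 16)
    (by norm_num)
  set r : ℝ := (15 / 16 : ℝ) ^ J with hr
  have hrpos : 0 < r := by positivity
  rw [pow_succ, ← hr] at hJ1
  have hlogq : L / qhat ≤ 1.45 * L ^ 2 := by
    have hlog2 := Real.log_two_gt_d9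
    have h1 : Real.log 2 ≤ qhat * L := by
      rw [Real.logb, one_div_div, div_le_iff₀ (by linarith)] at hqlog
      exact hqlog
    rw [div_le_iff₀ hq]
    nlinarith
  have hbound : ∀ ω, IsClean (meanPayoff Pay) T qhat (fun t => E.act t ω)
        (fun t => E.sel t ω) (fun t => E.arm t ω) (fun t => E.pay t ω) →
      ∑ t ∈ Finset.range T,
        (bestMean (meanPayoff Pay) - nodeMean (meanPayoff Pay) (E.sel t ω)) ≤
      31 / 15 * (T * δ) := by
    intro ω hω
    refine (hω.sum_gap_le (E.isRun ω) hT2 hq hq1 (meanPayoff_mem hPay) hcov J).trans ?_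
    rw [← hr, ← hL]
    have h1 : r ^ (-d) / r ≤ δ ^ (-d) / δ :=
      div_le_div₀ (by positivity)
        (Real.rpow_le_rpow_of_nonpos hδpos hJ2 (neg_nonpos.2 hd)) hδpos hJ2
    have h2 : T * H * (δ ^ (-d) / δ) = T * δ := by
      rw [← hδH, mul_assoc]
      congr 1
      rw [← mul_div_assoc, ← Real.rpow_add hδpos, show 2 + d + -d = (2 : ℝ) by ring,
        Real.rpow_two]
      field_simp
    have h3 : 2 * (12544 * L / qhat) * (18 * c * r ^ (-d) / r) ≤ T * δ := by
      calc _ = 451584 * c * (L / qhat) * (r ^ (-d) / r) := by ring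
        _ ≤ 451584 * c * (1.45 * L ^ 2) * (δ ^ (-d) / δ) := by gcongr
        _ = 654796.8 * (c * L ^ 2) * (δ ^ (-d) / δ) := by ring
        _ ≤ 660000 * (c * L ^ 2) * (δ ^ (-d) / δ) := by
            gcongr
            norm_num
        _ = T * H * (δ ^ (-d) / δ) := by
            rw [hHT]
            ring
        _ = _ := h2
    have h4 : r * T ≤ 16 / 15 * (T * δ) := by
      have : r ≤ 16 / 15 * δ := by linarith
      nlinarith
    linarith
  refine (E.regret_le_of_clean hPay hT2 hq hqual (by positivity) hbound).trans ?_
  have hbadle : T * (8 * Real.exp 4 / (T : ℝ) ^ 4) ≤ 1 := by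
    have he4 : Real.exp 4 ≤ 64 := by
      have h1 : Real.exp 4 = Real.exp 1 ^ 4 := by
        rw [← Real.exp_nat_mul]
        norm_num
      rw [h1]
      calc Real.exp 1 ^ 4 ≤ 2.7182818286 ^ 4 := by
            gcongr
            exact Real.exp_one_lt_d9.le
        _ ≤ 64 := by norm_num
    have h3 : (512 : ℝ) ≤ (T : ℝ) ^ 3 := by
      calc (512 : ℝ) = 8 ^ 3 := by norm_num
        _ ≤ (T : ℝ) ^ 3 := by gcongr
    have h4 : T * (8 * Real.exp 4 / (T : ℝ) ^ 4) = 8 * Real.exp 4 / (T : ℝ) ^ 3 := by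
      field_simp
    rw [h4, div_le_one (by positivity)]
    linarith
  linarith

end Execution

/-- The comparison of the two forms of the regret bound. -/
lemma four_mul_rpow_le {A c q T L e : ℝ} (hA : 0 < A) (hc : 0 < c) (hq : 0 < q) (hq1 : q ≤ 1)
    (hT : 0 < T) (hL : 4 ≤ L) (he : 0 < e) (he2 : e ≤ 1 / 2) :
    4 * (T * (A * c * L ^ 2 / T) ^ e) ≤ (16 * A * (c / q)) ^ e * T ^ (1 - e) * L := by
  have hL0 : 0 < L := by linarith
  have hTe : T ^ (1 - e) = T * T ^ (-e) := by
    rw [sub_eq_add_neg, Real.rpow_add hT, Real.rpow_one]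
  have h1 : (A * c * L ^ 2 / T) ^ e = (A * c) ^ e * L ^ (2 * e) * T ^ (-e) := by
    rw [Real.div_rpow (by positivity) hT.le, Real.mul_rpow (by positivity) (by positivity),
      Real.rpow_neg hT.le, div_eq_mul_inv, Real.rpow_mul hL0.le, Real.rpow_two]
  have h2 : (16 : ℝ) ^ e * (A * c) ^ e ≤ (16 * A * (c / q)) ^ e := by
    rw [← Real.mul_rpow (by norm_num) (by positivity), ← mul_assoc]
    refine Real.rpow_le_rpow (by positivity) ?_ he.le
    have : c ≤ c / q := by
      rw [le_div_iff₀ hq]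
      nlinarith
    gcongr
  have h3 : L = L ^ (2 * e) * L ^ (1 - 2 * e) := by
    rw [← Real.rpow_add hL0]
    simp
  have h4 : (4 : ℝ) ^ (1 - 2 * e) ≤ L ^ (1 - 2 * e) :=
    Real.rpow_le_rpow (by norm_num) hL (by linarith)
  -- Splitting 4 this way puts 16^e into the constant, while 4^(1-2e) ≤ L^(1-2e) completes L^(2e) to
  -- a single factor L.
  have h5 : (16 : ℝ) ^ e * 4 ^ (1 - 2 * e) = 4 := by
    rw [show (16 : ℝ) = 4 ^ (2 : ℝ) by norm_num, ← Real.rpow_mul (by norm_num),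
      ← Real.rpow_add (by norm_num)]
    simp
  calc 4 * (T * (A * c * L ^ 2 / T) ^ e)
      = (16 ^ e * 4 ^ (1 - 2 * e)) * (T * ((A * c) ^ e * L ^ (2 * e) * T ^ (-e))) := by
        rw [h1, h5]
    _ = (16 ^ e * (A * c) ^ e) * (T * T ^ (-e)) * (L ^ (2 * e) * 4 ^ (1 - 2 * e)) := by ring
    _ ≤ (16 * A * (c / q)) ^ e * (T * T ^ (-e)) * (L ^ (2 * e) * L ^ (1 - 2 * e)) := by gcongr
    _ = _ := by rw [hTe, ← h3]

end Taxonomy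

/-! ### Choice of the constant and small horizons. -/

theorem mainTheorem4 (D : ℕ) :
    ∃ C : ℝ, 0 < C ∧
      ∀ (𝒯 : RootedTree.{u}) [Fintype 𝒯], (∀ v : 𝒯, (Taxonomy.children v).ncard ≤ D) →
      ∀ (Pay : Measure (Taxonomy.Arm 𝒯 → ℝ)) [IsProbabilityMeasure Pay],
        (∀ᵐ f ∂Pay, ∀ x, f x ∈ Set.Icc (0 : ℝ) 1) →
      ∀ c d q : ℝ, 0 < c → Taxonomy.IsZoomingDim (Taxonomy.meanPayoff Pay) c d →
        Taxonomy.IsQuality (Taxonomy.meanPayoff Pay) q →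
      ∀ T : ℕ, (2 : ℝ) ^ (1 / q) ≤ (T : ℝ) →
      ∀ qhat : ℝ, 1 / Real.logb 2 (T : ℝ) ≤ qhat → qhat ≤ q →
      ∀ (Ω : Type w) [MeasurableSpace Ω] (P : Measure Ω) [IsProbabilityMeasure P]
        (E : Taxonomy.Execution 𝒯 Pay T qhat P),
        E.regret ≤
          (C * (c / q)) ^ (1 / (2 + d)) * (T : ℝ) ^ (1 - 1 / (2 + d)) * Real.log (T : ℝ) := by
  refine ⟨16 * 660000, by norm_num, ?_⟩
  intro 𝒯 _ _ Pay _ hPay c d q hc hdim hqual T hTq qhat hqlog hqq Ω _ P _ E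
  have hcov := hdim.1
  have hq := Taxonomy.quality_pos hqual
  have hq1 := Taxonomy.quality_le_one hqual.1
  have hc1 := Taxonomy.one_le_const_of_zoomingCover hcov
  have hd := Taxonomy.dim_nonneg_of_zoomingCover hcov
  have hT2 : (2 : ℝ) ≤ T := by
    refine le_trans ?_ hTq
    calc (2 : ℝ) = 2 ^ (1 : ℝ) := (Real.rpow_one 2).symm
      _ ≤ 2 ^ (1 / q) := Real.rpow_le_rpow_of_exponent_le (by norm_num) ((one_le_div hq).2 hq1)
  have hTpos : (0 : ℝ) < T := by linarith
  have hL : 0 < Real.log T := Real.log_pos (by linarith)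
  have hqhat : 0 < qhat := lt_of_lt_of_le (one_div_pos.2 (Real.logb_pos one_lt_two (by linarith)))
    hqlog
  have hqual' : Taxonomy.QualityAtLeast (Taxonomy.meanPayoff Pay) qhat := by
    intro v hv
    obtain ⟨u, u', h1, h2, h3, h4⟩ := hqual.1 v hv
    exact ⟨u, u', h1, h2, h3, hqq.trans h4⟩
  set e := 1 / (2 + d) with he
  have hepos : 0 < e := by positivity
  have he2 : e ≤ 1 / 2 := one_div_le_one_div_of_le (by norm_num) (by linarith)
  -- For T ≤ C·c/q the trivial bound T = T^e · T^(1-e) is enough once log T ≥ 1. The exception T = 2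
  -- forces q ≥ 1, so all arms have the same mean and the regret is zero.
  rcases le_or_gt (T : ℝ) (16 * 660000 * (c / q)) with hsmall | hlarge
  · rcases Nat.lt_or_ge T 3 with h3 | h3
    · have hTeq : (T : ℝ) = 2 := by
        have : T = 2 := le_antisymm (by omega) (by exact_mod_cast hT2)
        exact_mod_cast this
      have hq1' : 1 ≤ q := by
        rw [hTeq] at hTq
        by_contra! hlt
        have : (2 : ℝ) ^ (1 : ℝ) < 2 ^ (1 / q) :=
          Real.rpow_lt_rpow_of_exponent_lt (by norm_num) ((one_lt_div hq).2 hlt)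
        rw [Real.rpow_one] at this
        linarith
      have hzero : E.regret = 0 := by
        rw [Taxonomy.Execution.regret]
        simp [Taxonomy.eq_bestMean_of_one_le_quality hqual.1 hq1']
      rw [hzero]
      positivity
    · have hL1 : 1 ≤ Real.log T := by
        have : (3 : ℝ) ≤ T := by exact_mod_cast h3
        rw [Real.le_log_iff_exp_le hTpos]
        linarith [Real.exp_one_lt_d9]
      refine (E.regret_le_horizon hPay).trans ?_
      calc (T : ℝ) = (T : ℝ) ^ e * (T : ℝ) ^ (1 - e) * 1 := by
            rw [← Real.rpow_add hTpos]
            simp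
        _ ≤ _ := by gcongr
  · have hT0 : (16 * 660000 : ℝ) ≤ T := by
      have : (1 : ℝ) ≤ c / q := (one_le_div hq).2 (hq1.trans hc1)
      linarith
    have hL4 : 4 ≤ Real.log T := by
      rw [Real.le_log_iff_exp_le hTpos]
      have h1 : Real.exp 4 = Real.exp 1 ^ 4 := by
        rw [← Real.exp_nat_mul]
        norm_num
      rw [h1]
      calc Real.exp 1 ^ 4 ≤ 2.7182818286 ^ 4 := by
            gcongr
            exact Real.exp_one_lt_d9.le
        _ ≤ (16 * 660000 : ℝ) := by norm_num
        _ ≤ T := hT0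
    have hT8 : 8 ≤ T := by
      have : (8 : ℝ) ≤ T := by linarith
      exact_mod_cast this
    exact (E.regret_le_rpow hPay hT8 hqhat hqlog hqual' hcov).trans
      (Taxonomy.four_mul_rpow_le (by norm_num) hc hq hq1 hTpos hL4 hepos he2)
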